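/- Conventions. Let $(M^m,c)$ be a conformal manifold: $c$ is a positive definite symmetric bilinear form on $TM$ with values in $L^2$, where $L$ is the weight bundle; equivalently, the conformal class of the Riemannian metrics $g=l^{-2}c$, $l$ a positive section of $L$. A Weyl structure $\nabla$ is a torsion-free connection on $TM$ with $\nabla c=0$; it induces a connection on every $L^k$. Let $R_{X,Y}=[\nabla_X,\nabla_Y]-\nabla_{[X,Y]}$ be its curvature, $F^\nabla=\frac1m\operatorname{tr}R$ its Faraday form, $\mathrm{Ric}(X,Y)=\operatorname{tr}(R_{\cdot,X}Y)$, $\mathrm{Ric}_0$ the symmetric trace-free part of $\mathrm{Ric}$, and $\mathrm{scal}=\operatorname{tr}_c\mathrm{Ric}$. For a section $l$ of $L^k$ let $\mathrm{Hess}^\nabla(X,Y)l=\nabla_X\nabla_Yl-\nabla_{\nabla_XY}l$, with symmetric trace-free part $\mathrm{Hess}^\nabla_0$. A Möbius structure on a conformal surface is an operator $\mathcal M:C^\infty(L)\to C^\infty(S^2_0M\otimes L)$ with $\mathcal M-\mathrm{Hess}^\nabla_0=:h_0^{\mathcal M,\nabla}\in C^\infty(S^2_0M)$ a scalar operator for some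 (hence every) Weyl structure $\nabla$. A Laplace structure on a curve is an operator $\mathcal L:C^\infty(L^{1/2})\to C^\infty(L^{-3/2})$ with $\mathcal L-\operatorname{tr}_c\mathrm{Hess}^\nabla=:\frac12\sigma^{\mathcal L,\nabla}$ a scalar operator, $\sigma^{\mathcal L,\nabla}\in C^\infty(L^{-2})$, for some (hence every) $\nabla$. A Möbius surface (Laplace curve) is a conformal surface (curve) with such a structure. The Schouten–Weyl tensor $h^\nabla$ of $\nabla$ is $$h^\nabla=\tfrac1{m-2}\mathrm{Ric}_0+\tfrac1{2m(m-1)}\mathrm{scal}\cdot c-\tfrac12F^\nabla\quad(m\ge3),$$ $$h^\nabla=h_0^{\mathcal M,\nabla}+\tfrac14\mathrm{scal}\cdot c-\tfrac12F^\nabla\quad(\text{Möbius surface}),\qquad h^\nabla=\sigma^{\mathcal L,\nabla}\,c\quad(\text{Laplace curve}).$$ Proposition 4.10. Let $(M^m,c)$ be a conformal manifold of dimension $m\ge3$ or a Möbius surface. Let $N^n\subset M$ be an embedded submanifold with the conformal structure induced by $M$, such that $n\ge3$, or $N$ is a Möbius surface (for this conformal structure), or $N$ is a Laplace curve. Let $\nabla$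 be a Weyl structure on $M$, write $TM|_N=TN\oplus\nu$ for the orthogonal decomposition and $A^N$, $A^\perp$ for the components of $A$, and let $\nabla^N_XY=(\nabla_XY)^N$ be the induced Weyl structure on $N$, $B^\nabla(X,Y)=(\nabla_XY)^\perp$ the fundamental form, $H^\nabla=\frac1n\operatorname{tr}_{c}B^\nabla$, a section of $\nu\otimes L^{-2}\simeq\nu^*$, the mean curvature, and $B_0=B^\nabla-H^\nabla\cdot c$ the trace-free part of $B^\nabla$. Let $h^M=h^\nabla$ and $h^N=h^{\nabla^N}$ be the Schouten–Weyl tensors of $\nabla$ on $M$ and of $\nabla^N$ on $N$. Then the relative Schouten–Weyl tensor $$\rho(X,Y)=(h^M-h^N)(X,Y)+\tfrac12c(H^\nabla,H^\nabla)\,c(X,Y)+H^\nabla(B_0(X,Y)),\qquad X,Y\in TN,$$ is a symmetric bilinear form on $TN$, independent of the Weyl structure $\nabla$ on $M$. -/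

import Mathlib

open Bundle FiberBundle Manifold
open scoped ContDiff Matrix

noncomputable section

namespace ConformalSubmanifold

/-! ### Linear algebra: traces and duals with respect to a bilinear form -/

section LinearAlgebra

variable {k : ℕ} {V W : Type*} [AddCommGroup V] [Module ℝ V] [AddCommGroup W] [Module ℝ W]

/-- Gram matrix of `q` in the basis `b`. -/
def gram (b : Module.Basis (Fin k) ℝ V) (q : V → V → ℝ) : Matrix (Fin k) (Fin k) ℝ :=
  Matrix.of fun i j => q (b i) (b j)

/-- Trace of a (vector valued) bilinear map `B` with respect to the inner product `q`:
`tr_q B = ∑ q^{ij} B(b_i, b_j)`, which for bilinear `B` does not depend on the basis. -/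
def traceWith (b : Module.Basis (Fin k) ℝ V) (q : V → V → ℝ) (B : V → V → W) : W :=
  ∑ i, ∑ j, (gram b q)⁻¹ i j • B (b i) (b j)

/-- Trace of an endomorphism. -/
def traceEnd (b : Module.Basis (Fin k) ℝ V) (T : V → V) : ℝ :=
  ∑ i, b.repr (T (b i)) i

end LinearAlgebra

/-! ### Manifolds, metrics, conformal structures -/

/-- Smooth Riemannian metrics on the `m`-manifold `M`. -/
abbrev Metric (m : ℕ) (M : Type*) [TopologicalSpace M] [ChartedSpace (EuclideanSpace ℝ (Fin m)) M]
    [IsManifold (𝓡 m) ∞ M] :=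
  ContMDiffRiemannianMetric (𝓡 m) ∞ (EuclideanSpace ℝ (Fin m)) (TangentSpace (𝓡 m) : M → Type _)

/-- Operators with the type of a covariant derivative on `TM`; `cov Y x v` is `(∇_v Y)(x)`. -/
abbrev ConnOp (m : ℕ) (M : Type*) [TopologicalSpace M]
    [ChartedSpace (EuclideanSpace ℝ (Fin m)) M] :=
  (Π x : M, TangentSpace (𝓡 m) x) → (Π x : M, TangentSpace (𝓡 m) x →L[ℝ] TangentSpace (𝓡 m) x)

/-- The coordinate basis of a tangent space. -/
def stdBasis {m : ℕ} {M : Type*} [TopologicalSpace M]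
    [ChartedSpace (EuclideanSpace ℝ (Fin m)) M] (x : M) :
    Module.Basis (Fin m) ℝ (TangentSpace (𝓡 m) x) :=
  (EuclideanSpace.basisFun (Fin m) ℝ).toBasis

section Intrinsic

variable {m : ℕ} {M : Type*} [TopologicalSpace M] [ChartedSpace (EuclideanSpace ℝ (Fin m)) M]
  [IsManifold (𝓡 m) ∞ M]

/-- `g' = e^{2f} g`. -/
def IsRescaling (g g' : Metric m M) (f : M → ℝ) : Prop :=
  ContMDiff (𝓡 m) 𝓘(ℝ) ∞ f ∧
    ∀ (x : M) (u v : TangentSpace (𝓡 m) x), g'.inner x u v = Real.exp (2 * f x) * g.inner x u v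

variable (m M) in
/-- A conformal structure `c`, as the conformal class of the Riemannian metrics `g = l⁻² c`,
for `l` a positive section of the weight bundle `L`. -/
structure ConformalStructure where
  metrics : Set (Metric m M)
  nonempty : metrics.Nonempty
  mem_iff : ∀ g ∈ metrics, ∀ g' : Metric m M, g' ∈ metrics ↔ ∃ f, IsRescaling g g' f

/-- Smooth sections of the weight bundle `L^k`. The choice of a metric `g = l⁻² c` in the conformal
class trivializes `L^k` by `l^k`, and `val g` is the section read in this trivialization;
replacing `g` by `e^{2f} g` replaces `l` by `e^{-f} l`. -/
structure Density (C : ConformalStructure m M) (k : ℝ) where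
  val : C.metrics → M → ℝ
  smooth : ∀ g, ContMDiff (𝓡 m) 𝓘(ℝ) ∞ (val g)
  rescale : ∀ (g g' : C.metrics) (f : M → ℝ), IsRescaling (g : Metric m M) g' f →
    ∀ x, val g' x = Real.exp (k * f x) * val g x

/-- Trace of a bilinear form on `T_x M` with respect to `g`. -/
def trg (g : Metric m M) (x : M) (B : TangentSpace (𝓡 m) x → TangentSpace (𝓡 m) x → ℝ) : ℝ :=
  traceWith (stdBasis x) (fun u v => g.inner x u v) B

/-! ### Weyl structures -/

/-- `∇ g = -2 θ ⊗ g`. Equivalently, `θ` is the connection form of the connection induced by `∇`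
on `L`, in the trivialization given by `g = l⁻² c`: `∇ l = θ ⊗ l`. -/
def IsLeeForm (g : Metric m M) (cov : ConnOp m M)
    (θ : Π x : M, TangentSpace (𝓡 m) x →L[ℝ] ℝ) : Prop :=
  ∀ (x : M) (v : TangentSpace (𝓡 m) x) (Y Z : Π y : M, TangentSpace (𝓡 m) y),
    MDifferentiableAt (𝓡 m) ((𝓡 m).prod 𝓘(ℝ, EuclideanSpace ℝ (Fin m)))
      (fun y => TotalSpace.mk' (EuclideanSpace ℝ (Fin m)) y (Y y)) x →
    MDifferentiableAt (𝓡 m) ((𝓡 m).prod 𝓘(ℝ, EuclideanSpace ℝ (Fin m)))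
      (fun y => TotalSpace.mk' (EuclideanSpace ℝ (Fin m)) y (Z y)) x →
      mvfderiv (𝓡 m) (fun y => g.inner y (Y y) (Z y)) x v =
        g.inner x (cov Y x v) (Z x) + g.inner x (Y x) (cov Z x v)
          - 2 * θ x v * g.inner x (Y x) (Z x)

/-- A Weyl structure: a smooth torsion-free connection on `TM` which preserves the
conformal structure. -/
structure WeylStructure (C : ConformalStructure m M) where
  conn : CovariantDerivative (𝓡 m) (EuclideanSpace ℝ (Fin m)) (TangentSpace (𝓡 m) : M → Type _)
  smooth : conn.ContMDiffCovariantDerivative ∞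
  torsion_free : conn.torsion = 0
  conformal : ∀ g ∈ C.metrics, ∃ θ, IsLeeForm g conn.toFun θ

open Classical in
/-- The 1-form `θ` with `∇ g = -2 θ ⊗ g` (unique if `m ≥ 1`). -/
def leeForm (g : Metric m M) (cov : ConnOp m M) (x : M) : TangentSpace (𝓡 m) x →L[ℝ] ℝ :=
  if h : ∃ θ, IsLeeForm g cov θ then h.choose x else 0

/-- Covariant derivative of a section of `L^k`, in the trivialization given by `g`. -/
def densCov (k : ℝ) (g : Metric m M) (cov : ConnOp m M) (l : M → ℝ) (x : M) :
    TangentSpace (𝓡 m) x →L[ℝ] ℝ :=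
  mvfderiv (𝓡 m) l x + (k * l x) • leeForm g cov x

/-- The Hessian `∇_u ∇_v l - ∇_{∇_u v} l` of a section of `L^k`, in the trivialization
given by `g`. -/
def hess (k : ℝ) (g : Metric m M) (cov : ConnOp m M) (l : M → ℝ) (x : M)
    (u v : TangentSpace (𝓡 m) x) : ℝ :=
  mvfderiv (𝓡 m)
      (fun y => densCov k g cov l y (extend (EuclideanSpace ℝ (Fin m)) v y)) x u
    + k * leeForm g cov x u * densCov k g cov l x v
    - densCov k g cov l x (cov (extend (EuclideanSpace ℝ (Fin m)) v) x u)

/-- The symmetric trace-free part of the Hessian. -/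
def hess₀ (k : ℝ) (g : Metric m M) (cov : ConnOp m M) (l : M → ℝ) (x : M)
    (u v : TangentSpace (𝓡 m) x) : ℝ :=
  (hess k g cov l x u v + hess k g cov l x v u) / 2
    - (1 / m : ℝ) * trg g x (hess k g cov l x) * g.inner x u v

/-! ### Curvature -/

/-- `R_{u,v} w = ∇_u ∇_v w - ∇_v ∇_u w - ∇_{[u,v]} w`. -/
def curv (cov : ConnOp m M) (x : M) (u v w : TangentSpace (𝓡 m) x) : TangentSpace (𝓡 m) x :=
  let U : Π y : M, TangentSpace (𝓡 m) y := extend (EuclideanSpace ℝ (Fin m)) u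
  let V : Π y : M, TangentSpace (𝓡 m) y := extend (EuclideanSpace ℝ (Fin m)) v
  let W : Π y : M, TangentSpace (𝓡 m) y := extend (EuclideanSpace ℝ (Fin m)) w
  cov (fun y => cov W y (V y)) x u - cov (fun y => cov W y (U y)) x v
    - cov W x (VectorField.mlieBracket (𝓡 m) U V x)

/-- The Ricci tensor `Ric(u, v) = tr (w ↦ R_{w,u} v)`. -/
def ric (cov : ConnOp m M) (x : M) (u v : TangentSpace (𝓡 m) x) : ℝ :=
  traceEnd (stdBasis x) (fun w => curv cov x w u v)

/-- The Faraday form: the identity component of the curvature, `F(u, v) = (1/m) tr R_{u,v}`. -/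
def faraday (cov : ConnOp m M) (x : M) (u v : TangentSpace (𝓡 m) x) : ℝ :=
  (1 / m : ℝ) * traceEnd (stdBasis x) (fun w => curv cov x u v w)

/-- The scalar curvature (a section of `L⁻²`), in the trivialization given by `g`. -/
def scal (g : Metric m M) (cov : ConnOp m M) (x : M) : ℝ :=
  trg g x (ric cov x)

/-- The symmetric trace-free part of the Ricci tensor. -/
def ric₀ (g : Metric m M) (cov : ConnOp m M) (x : M) (u v : TangentSpace (𝓡 m) x) : ℝ :=
  (ric cov x u v + ric cov x v u) / 2 - (1 / m : ℝ) * scal g cov x * g.inner x u v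

/-! ### Möbius and Laplace structures -/

/-- A Möbius structure: an operator `C^∞(L) → C^∞(S²₀M ⊗ L)` (`op l g` is the value at `l`
in the trivialization of `L` given by `g`) that differs from the trace-free Hessian of some Weyl
structure by a scalar operator `l ↦ A ⊗ l`, where `A ∈ C^∞(S²₀M)`. In particular `op` is a linear
second order differential operator with values in sections of `S²₀M ⊗ L`. -/
structure MobiusStructure (C : ConformalStructure m M) where
  op : Density C 1 → C.metrics → Π x : M,
    TangentSpace (𝓡 m) x → TangentSpace (𝓡 m) x → ℝ
  exists_weyl : ∃ (D : WeylStructure C)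
    (A : Π x : M, TangentSpace (𝓡 m) x →L[ℝ] TangentSpace (𝓡 m) x →L[ℝ] ℝ),
    ContMDiff (𝓡 m) ((𝓡 m).prod
        𝓘(ℝ, EuclideanSpace ℝ (Fin m) →L[ℝ] EuclideanSpace ℝ (Fin m) →L[ℝ] ℝ)) ∞
      (fun x => TotalSpace.mk' (EuclideanSpace ℝ (Fin m) →L[ℝ] EuclideanSpace ℝ (Fin m) →L[ℝ] ℝ)
        x (A x)) ∧
    (∀ x u v, A x u v = A x v u) ∧
    (∀ g ∈ C.metrics, ∀ x, trg g x (fun u v => A x u v) = 0) ∧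
    ∀ (l : Density C 1) (g : C.metrics) (x : M) (u v : TangentSpace (𝓡 m) x),
      op l g x u v = hess₀ 1 g D.conn.toFun (l.val g) x u v + l.val g x * A x u v

open Classical in
/-- The tensor `h₀^{𝓜,∇}` with `𝓜 l = Hess₀^∇ l + h₀^{𝓜,∇} l` for all sections `l` of `L`. -/
def MobiusStructure.form {C : ConformalStructure m M} (S : MobiusStructure C) (cov : ConnOp m M) :
    Π x : M, TangentSpace (𝓡 m) x → TangentSpace (𝓡 m) x → ℝ :=
  if h : ∃ A : Π x : M, TangentSpace (𝓡 m) x → TangentSpace (𝓡 m) x → ℝ,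
      ∀ (l : Density C 1) (g : C.metrics) (x : M) (u v : TangentSpace (𝓡 m) x),
        S.op l g x u v = hess₀ 1 g cov (l.val g) x u v + l.val g x * A x u v
  then h.choose else 0

/-- A Laplace structure: an operator `C^∞(L^k) → C^∞(L^{k-2})`, `k = 1 - m/2`, that differs from
the trace of the Hessian of some Weyl structure by a scalar operator, i.e. by multiplication with
a section of `L⁻²`. In particular it is a linear second order differential operator. -/
structure LaplaceStructure (C : ConformalStructure m M) where
  op : Density C (1 - m / 2) → Density C (1 - m / 2 - 2)
  exists_weyl : ∃ (D : WeylStructure C) (s : Density C (-2)),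
    ∀ (l : Density C (1 - m / 2)) (g : C.metrics) (x : M),
      (op l).val g x =
        trg g x (hess (1 - m / 2) g D.conn.toFun (l.val g) x) + s.val g x * l.val g x

open Classical in
/-- The section `σ^{𝓛,∇}` of `L⁻²` with `𝓛 l = tr(Hess^∇ l) + (1 - m/2) σ^{𝓛,∇} l` for all
sections `l` of `L^{1 - m/2}` (`m ≠ 2`). -/
def LaplaceStructure.scalar {C : ConformalStructure m M} (S : LaplaceStructure C)
    (cov : ConnOp m M) : C.metrics → M → ℝ :=
  if h : ∃ s : C.metrics → M → ℝ,
      ∀ (l : Density C (1 - m / 2)) (g : C.metrics) (x : M),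
        (S.op l).val g x =
          trg g x (hess (1 - m / 2) g cov (l.val g) x) + (1 - m / 2) * s g x * l.val g x
  then h.choose else 0

/-- The additional structure carried in low dimensions: a Möbius structure on surfaces,
a Laplace structure on curves, nothing in other dimensions. -/
structure LowDimStructure (C : ConformalStructure m M) where
  mobius : m = 2 → MobiusStructure C
  laplace : m = 1 → LaplaceStructure C

/-- The Schouten-Weyl tensor `h^∇`. The metric `g` of the conformal class serves only to write
the weightless tensors `scal · c` and `σ · c`; the value does not depend on its choice. -/
def schouten {C : ConformalStructure m M} (S : LowDimStructure C) (g : C.metrics)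
    (cov : ConnOp m M) (x : M) (u v : TangentSpace (𝓡 m) x) : ℝ :=
  if h1 : m = 1 then
    (S.laplace h1).scalar cov g x * (g : Metric m M).inner x u v
  else if h2 : m = 2 then
    (S.mobius h2).form cov x u v
      + 1 / 4 * scal (g : Metric m M) cov x * (g : Metric m M).inner x u v
      - 1 / 2 * faraday cov x u v
  else
    1 / ((m : ℝ) - 2) * ric₀ (g : Metric m M) cov x u v
      + 1 / (2 * (m : ℝ) * ((m : ℝ) - 1)) * scal (g : Metric m M) cov x
        * (g : Metric m M).inner x u v
      - 1 / 2 * faraday cov x u v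

end Intrinsic

/-! ### Submanifolds -/

section Extrinsic

variable {m n : ℕ}
  {M : Type*} [TopologicalSpace M] [ChartedSpace (EuclideanSpace ℝ (Fin m)) M]
  [IsManifold (𝓡 m) ∞ M]
  {N : Type*} [TopologicalSpace N] [ChartedSpace (EuclideanSpace ℝ (Fin n)) N]
  [IsManifold (𝓡 n) ∞ N]

/-- `φ : N → M` is an embedded submanifold, and the conformal structure of `N` is the one induced
from `M`. -/
structure IsConformalSubmanifold (C : ConformalStructure m M) (CN : ConformalStructure n N)
    (φ : N → M) : Prop where
  embedding : IsSmoothEmbedding (𝓡 n) (𝓡 m) ∞ φ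
  conformal : ∀ g ∈ C.metrics, ∃ gN ∈ CN.metrics, ∀ (x : N) (u v : TangentSpace (𝓡 n) x),
    gN.inner x u v = g.inner (φ x) (mfderiv (𝓡 n) (𝓡 m) φ x u) (mfderiv (𝓡 n) (𝓡 m) φ x v)

/-- The restriction of `g` to `TN`. -/
def pullbackForm (g : Metric m M) (φ : N → M) (x : N) (u v : TangentSpace (𝓡 n) x) : ℝ :=
  g.inner (φ x) (mfderiv (𝓡 n) (𝓡 m) φ x u) (mfderiv (𝓡 n) (𝓡 m) φ x v)

/-- The tangential part `A ↦ A^N`, `T_{φ x} M → T_x N`, of the `g`-orthogonal decomposition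
`TM|_N = TN ⊕ ν`. -/
def tanPart (g : Metric m M) (φ : N → M) (x : N) :
    TangentSpace (𝓡 m) (φ x) →L[ℝ] TangentSpace (𝓡 n) x :=
  ∑ i : Fin n, ∑ j : Fin n, (gram (stdBasis (m := n) x) (pullbackForm (n := n) g φ x))⁻¹ i j •
    (g.inner (φ x) (mfderiv (𝓡 n) (𝓡 m) φ x (stdBasis (m := n) x j))).smulRight
      (stdBasis (m := n) x i)

variable (n) in
/-- The normal part `A ↦ A^⊥` of the `g`-orthogonal decomposition `TM|_N = TN ⊕ ν`. -/
def norPart (g : Metric m M) (φ : N → M) (x : N) (A : TangentSpace (𝓡 m) (φ x)) :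
    TangentSpace (𝓡 m) (φ x) :=
  A - mfderiv (𝓡 n) (𝓡 m) φ x (tanPart (n := n) g φ x A)

/-- The covariant derivative `∇_v s` of a vector field `s` of `M` along `φ`. If `s = ∑ sⁱ (eᵢ ∘ φ)`
for the coordinate frame `e` around `φ x`, then `∇_v s = ∑ dsⁱ(v) eᵢ + sⁱ ∇_{dφ(v)} eᵢ`. -/
def covAlong (cov : ConnOp m M) (φ : N → M) (s : Π y : N, TangentSpace (𝓡 m) (φ y)) (x : N) :
    TangentSpace (𝓡 n) x →L[ℝ] TangentSpace (𝓡 m) (φ x) :=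
  let t := trivializationAt (EuclideanSpace ℝ (Fin m)) (TangentSpace (𝓡 m) : M → Type _) (φ x)
  (t.symmL ℝ (φ x)).comp
      (mvfderiv (𝓡 n) (fun y => (t (TotalSpace.mk' _ (φ y) (s y))).2) x)
    + (cov (extend (EuclideanSpace ℝ (Fin m)) (s x)) (φ x)).comp (mfderiv (𝓡 n) (𝓡 m) φ x)

/-- `∇_v Y`, where the vector field `Y` of `N` is seen as a vector field of `M` along `φ`. -/
def covTangent (cov : ConnOp m M) (φ : N → M) (Y : Π y : N, TangentSpace (𝓡 n) y) (x : N) :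
    TangentSpace (𝓡 n) x →L[ℝ] TangentSpace (𝓡 m) (φ x) :=
  covAlong cov φ (fun y => mfderiv (𝓡 n) (𝓡 m) φ y (Y y)) x

/-- The induced Weyl structure `∇^N_X Y = (∇_X Y)^N` on `N`. -/
def inducedConn (g : Metric m M) (cov : ConnOp m M) (φ : N → M) : ConnOp n N :=
  fun Y x => (tanPart g φ x).comp (covTangent cov φ Y x)

/-- The fundamental form `B(X, Y) = (∇_X Y)^⊥`. -/
def fundForm (g : Metric m M) (cov : ConnOp m M) (φ : N → M) (x : N)
    (u v : TangentSpace (𝓡 n) x) : TangentSpace (𝓡 m) (φ x) :=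
  norPart n g φ x (covTangent cov φ (extend (EuclideanSpace ℝ (Fin n)) v) x u)

variable (n) in
/-- The mean curvature, `(1/n)` times the trace of `B` along `TN`: a section of `ν ⊗ L⁻²`, in the
trivialization given by `g`. As a section of `ν*` it is `ξ ↦ g(meanCurv, ξ)`. -/
def meanCurv (g : Metric m M) (cov : ConnOp m M) (φ : N → M) (x : N) :
    TangentSpace (𝓡 m) (φ x) :=
  (1 / n : ℝ) • traceWith (stdBasis (m := n) x) (pullbackForm g φ x) (fundForm g cov φ x)

/-- The trace-free part of the fundamental form. -/
def fundForm₀ (g : Metric m M) (cov : ConnOp m M) (φ : N → M) (x : N)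
    (u v : TangentSpace (𝓡 n) x) : TangentSpace (𝓡 m) (φ x) :=
  fundForm g cov φ x u v - pullbackForm g φ x u v • meanCurv n g cov φ x

/-- The relative Schouten-Weyl tensor
`ρ(X, Y) = (h^M - h^N)(X, Y) + ½ c(H, H) c(X, Y) + H(B₀(X, Y))` computed with a Weyl structure of
`M`; the metrics `g` of `M` and `gN` of `N` in the respective conformal classes serve to write
weightless quantities. -/
def relSchouten {C : ConformalStructure m M} {CN : ConformalStructure n N}
    (SM : LowDimStructure C) (SN : LowDimStructure CN) (φ : N → M) (D : WeylStructure C)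
    (g : C.metrics) (gN : CN.metrics) (x : N) (u v : TangentSpace (𝓡 n) x) : ℝ :=
  let H := meanCurv n (g : Metric m M) D.conn.toFun φ x
  schouten SM g D.conn.toFun (φ x) (mfderiv (𝓡 n) (𝓡 m) φ x u) (mfderiv (𝓡 n) (𝓡 m) φ x v)
    - schouten SN gN (inducedConn (g : Metric m M) D.conn.toFun φ) x u v
    + 1 / 2 * (g : Metric m M).inner (φ x) H H * pullbackForm (g : Metric m M) φ x u v
    + (g : Metric m M).inner (φ x) H (fundForm₀ (g : Metric m M) D.conn.toFun φ x u v)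

end Extrinsic

end ConformalSubmanifold

end

/-!
The relative Schouten-Weyl tensor is symmetric and independent of the Weyl structure because each of
its ingredients changes in a controlled way when a `1`-form `γ` is added to the Lee form of `∇`.

*Intrinsic part.* Put `Q^γ = ∇γ - γ ⊗ γ + ½ |γ|² c` (`schoutenChange`). The curvature of a Weyl
structure changes by a Kulkarni-Nomizu type product of `c` with `Q^γ` (`IsLocalWeyl.localCurv_sub`);
taking traces, the Schouten-Weyl tensor changes by `-Q^γ`. On surfaces and curves the missing
components are supplied by the Möbius and Laplace structures: in weight `1` the trace-free Hessian
changes by the trace-free part of `Q^γ`, and in weight `1 - m/2` the trace of the Hessian changes by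
`(1 - m/2) tr Q^γ`. So `h^{∇ + γ} = h^∇ - Q^γ` in every dimension (`schouten_sub`).

*Restriction to the submanifold.* The induced connection is a Weyl structure of `N` whose Lee form
is the restriction of the Lee form of `∇` (`IsWeyl.inducedConn`, `IsWeyl.localLee_inducedConn`). By
the Gauss formula, the restriction of `Q^γ` to `TN` differs from the tensor `Q` of the restricted
form by `-γ(B) + ½ |γ^⊥|² c` (`schoutenChange_pull`). On the other hand `B` changes by
`-c ⊗ γ^⊥` and `H` by `-γ^⊥`, so that `B₀` is unchanged and `½ |H|² c + H(B₀)` changes by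
`-γ(B) + ½ |γ^⊥|² c` as well (`IsLocalWeyl.localExtrinsic_sub`). The two changes cancel in `ρ`
(`relSchouten_weyl`).

*Symmetry.* The skew part of `h^∇` is `-½ dθ`, where `θ` is the Lee form (`schouten_skew`), and `d`
commutes with the restriction to `N`; the other terms of `ρ` are symmetric (`relSchouten_symm`).

All computations are made at a point, in the preferred charts of `M` and `N`: a Weyl structure there
is a metric, a symmetric Christoffel tensor and a Lee form on an open set of a vector space
(`IsLocalWeyl`), and `HasChristoffel` links an operator on vector fields to its Christoffel symbols.
-/

namespace ConformalSubmanifold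

open Filter Topology

noncomputable section

set_option maxSynthPendingDepth 3
set_option linter.unusedSectionVars false

/-! ### Weyl structures in a vector space -/

section LocalWeyl

variable {V : Type*} [NormedAddCommGroup V] [NormedSpace ℝ V]

/-- A Weyl structure read in a chart, near the point `z`: a conformal metric `G`, the Christoffel
symbols `Γ` of a torsion-free connection, `∇_v Y = D_v Y + Γ(v, Y)`, and its Lee form `θ` with
respect to `G`. -/
structure IsLocalWeyl (G : V → V →L[ℝ] V →L[ℝ] ℝ) (Γ : V → V →L[ℝ] V →L[ℝ] V)
    (θ : V → V →L[ℝ] ℝ) (z : V) : Prop where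
  contDiffAt_metric : ContDiffAt ℝ ∞ G z
  contDiffAt_christoffel : ContDiffAt ℝ ∞ Γ z
  contDiffAt_lee : ContDiffAt ℝ ∞ θ z
  metric_symm : ∀ᶠ y in 𝓝 z, ∀ a b, G y a b = G y b a
  metric_pos : ∀ᶠ y in 𝓝 z, ∀ a, a ≠ 0 → 0 < G y a a
  christoffel_symm : ∀ᶠ y in 𝓝 z, ∀ a b, Γ y a b = Γ y b a
  compat : ∀ᶠ y in 𝓝 z, ∀ v a b,
    fderiv ℝ G y v a b = G y (Γ y v a) b + G y a (Γ y v b) - 2 * θ y v * G y a b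

/-- The curvature `R_{u,v} w` of the connection with Christoffel symbols `Γ`. -/
def localCurv (Γ : V → V →L[ℝ] V →L[ℝ] V) (z u v w : V) : V :=
  fderiv ℝ Γ z u v w - fderiv ℝ Γ z v u w + Γ z u (Γ z v w) - Γ z v (Γ z u w)

/-- The covariant derivative `(∇_u γ)(v)` of a `1`-form. -/
def covOneForm (Γ : V → V →L[ℝ] V →L[ℝ] V) (γ : V → V →L[ℝ] ℝ) (z u v : V) : ℝ :=
  fderiv ℝ γ z u v - γ z (Γ z u v)

theorem _root_.ContDiffAt.differentiableAt_infty {F W : Type*} [NormedAddCommGroup F] [NormedSpace ℝ F]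
    [NormedAddCommGroup W] [NormedSpace ℝ W] {f : W → F} {z : W} (h : ContDiffAt ℝ ∞ f z) :
    DifferentiableAt ℝ f z :=
  h.differentiableAt (by simp)

theorem _root_.ContDiffAt.eventually_differentiableAt {F W : Type*} [NormedAddCommGroup F]
    [NormedSpace ℝ F] [NormedAddCommGroup W] [NormedSpace ℝ W] {f : W → F} {z : W}
    (h : ContDiffAt ℝ ∞ f z) : ∀ᶠ y in 𝓝 z, DifferentiableAt ℝ f y := by
  have h1 : ContDiffAt ℝ 1 f z := h.of_le (by exact_mod_cast le_top)
  filter_upwards [h1.eventually (by simp)] with y hy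
  exact hy.differentiableAt (by simp)

/-- A torsion-free Weyl connection is determined by its Lee form. -/
theorem IsLocalWeyl.christoffel_sub {G : V → V →L[ℝ] V →L[ℝ] ℝ} {Γ₁ Γ₂ : V → V →L[ℝ] V →L[ℝ] V}
    {θ₁ θ₂ : V → V →L[ℝ] ℝ} {z : V} (h₁ : IsLocalWeyl G Γ₁ θ₁ z) (h₂ : IsLocalWeyl G Γ₂ θ₂ z) :
    ∀ᶠ y in 𝓝 z, ∀ a b c, G y (Γ₂ y a b - Γ₁ y a b) c =
      (θ₂ y - θ₁ y) a * G y b c + (θ₂ y - θ₁ y) b * G y a c - (θ₂ y - θ₁ y) c * G y a b := by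
  filter_upwards [h₁.metric_symm, h₁.christoffel_symm, h₂.christoffel_symm, h₁.compat, h₂.compat]
    with y hG s₁ s₂ c₁ c₂ a b c
  simp only [map_sub, _root_.sub_apply]
  have e₁ := c₁ a b c
  have e₂ := c₁ b a c
  have e₃ := c₁ c a b
  rw [c₂] at e₁ e₂ e₃
  rw [s₁ b a, s₂ b a] at e₂
  rw [s₁ c a, s₂ c a, s₁ c b, s₂ c b] at e₃
  have k₁ := hG b (Γ₂ y a c)
  have k₂ := hG b (Γ₁ y a c)
  linear_combination (1 / 2) * e₁ + (1 / 2) * e₂ - (1 / 2) * e₃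
    + (1 / 2) * hG (Γ₂ y a c) b - (1 / 2) * hG (Γ₁ y a c) b

/-- Derivative of the formula `IsLocalWeyl.christoffel_sub` for the difference of two torsion-free
Weyl connections. -/
theorem IsLocalWeyl.fderiv_christoffel_sub {G : V → V →L[ℝ] V →L[ℝ] ℝ}
    {Γ₁ Γ₂ : V → V →L[ℝ] V →L[ℝ] V}
    {θ₁ θ₂ : V → V →L[ℝ] ℝ} {z : V} (h₁ : IsLocalWeyl G Γ₁ θ₁ z) (h₂ : IsLocalWeyl G Γ₂ θ₂ z)
    (u a b c : V) :
    fderiv ℝ G z u (Γ₂ z a b - Γ₁ z a b) c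
      + G z (fderiv ℝ Γ₂ z u a b - fderiv ℝ Γ₁ z u a b) c =
    fderiv ℝ (fun y => θ₂ y - θ₁ y) z u a * G z b c + (θ₂ z - θ₁ z) a * fderiv ℝ G z u b c
    + (fderiv ℝ (fun y => θ₂ y - θ₁ y) z u b * G z a c + (θ₂ z - θ₁ z) b * fderiv ℝ G z u a c)
    - (fderiv ℝ (fun y => θ₂ y - θ₁ y) z u c * G z a b
      + (θ₂ z - θ₁ z) c * fderiv ℝ G z u a b) := by
  have hG := h₁.contDiffAt_metric.differentiableAt_infty.hasFDerivAt
  have hΓ₁ := h₁.contDiffAt_christoffel.differentiableAt_infty.hasFDerivAt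
  have hΓ₂ := h₂.contDiffAt_christoffel.differentiableAt_infty.hasFDerivAt
  have hγ := (h₂.contDiffAt_lee.sub h₁.contDiffAt_lee).differentiableAt_infty.hasFDerivAt
  have A (p q : V) := (hG.clm_apply (hasFDerivAt_const p z)).clm_apply (hasFDerivAt_const q z)
  have B (p : V) := hγ.clm_apply (hasFDerivAt_const p z)
  have C := (hG.clm_apply (((hΓ₂.clm_apply (hasFDerivAt_const a z)).clm_apply
    (hasFDerivAt_const b z)).sub ((hΓ₁.clm_apply (hasFDerivAt_const a z)).clm_apply
    (hasFDerivAt_const b z)))).clm_apply (hasFDerivAt_const c z)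
  have D := (((B a).mul (A b c)).add ((B b).mul (A a c))).sub ((B c).mul (A a b))
  have E := C.congr_of_eventuallyEq (f₁ := fun y => G y (Γ₂ y a b - Γ₁ y a b) c) (by rfl)
  have E' := D.congr_of_eventuallyEq (f₁ := fun y => G y (Γ₂ y a b - Γ₁ y a b) c) (by
    filter_upwards [h₁.christoffel_sub h₂] with y hy
    exact hy a b c)
  have := DFunLike.congr_fun (E.unique E') u
  simp only [_root_.add_apply, _root_.sub_apply, _root_.smul_apply, ContinuousLinearMap.comp_apply,
    ContinuousLinearMap.flip_apply, _root_.zero_apply, map_zero, zero_add, smul_eq_mul,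
    map_sub, Pi.sub_apply] at this
  simp only [map_sub, _root_.sub_apply]
  linear_combination this

/-- The change `Q = ∇γ - γ ⊗ γ + ½ |γ|² G` of minus the Schouten tensor when the `1`-form `γ` is
added to the Lee form of `∇`. The vector `s` is meant to be the `G`-dual of `γ`. -/
def schoutenChange (G : V → V →L[ℝ] V →L[ℝ] ℝ) (Γ : V → V →L[ℝ] V →L[ℝ] V)
    (γ : V → V →L[ℝ] ℝ) (z s u v : V) : ℝ :=
  covOneForm Γ γ z u v - γ z u * γ z v + 1 / 2 * γ z s * G z u v

theorem IsLocalWeyl.metric_ext {G : V → V →L[ℝ] V →L[ℝ] ℝ} {Γ : V → V →L[ℝ] V →L[ℝ] V}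
    {θ : V → V →L[ℝ] ℝ} {z : V} (h : IsLocalWeyl G Γ θ z) {a b : V}
    (hab : ∀ c, G z a c = G z b c) : a = b := by
  by_contra hne
  have := h.metric_pos.self_of_nhds (a - b) (sub_ne_zero.2 hne)
  simp only [map_sub, _root_.sub_apply, hab] at this
  linarith

set_option maxHeartbeats 1000000 in
/-- The curvature of a torsion-free Weyl connection changes by the Kulkarni-Nomizu type product of
the metric with `Q`, where `S` is the endomorphism with `Q(u, v) = G(S u, v)`. -/
theorem IsLocalWeyl.localCurv_sub {G : V → V →L[ℝ] V →L[ℝ] ℝ}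
    {Γ₁ Γ₂ : V → V →L[ℝ] V →L[ℝ] V}
    {θ₁ θ₂ : V → V →L[ℝ] ℝ} {z : V} (h₁ : IsLocalWeyl G Γ₁ θ₁ z) (h₂ : IsLocalWeyl G Γ₂ θ₂ z)
    {s : V} (hs : ∀ c, G z s c = (θ₂ z - θ₁ z) c) {S : V → V}
    (hS : ∀ u c, G z (S u) c = schoutenChange G Γ₁ (fun y => θ₂ y - θ₁ y) z s u c) (u v w : V) :
    localCurv Γ₂ z u v w = localCurv Γ₁ z u v w +
      ((G z (S u) v - G z (S v) u) • w + G z (S u) w • v - G z (S v) w • u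
        - G z v w • S u + G z u w • S v) := by
  refine h₁.metric_ext fun c => ?_
  have hsymm := h₁.metric_symm.self_of_nhds
  have hΓ₁ := h₁.christoffel_symm.self_of_nhds
  have hΓ₂ := h₂.christoffel_symm.self_of_nhds
  have hc := h₁.compat.self_of_nhds
  have hd := (h₁.christoffel_sub h₂).self_of_nhds
  have F₁ := h₁.fderiv_christoffel_sub h₂ u v w c
  have F₂ := h₁.fderiv_christoffel_sub h₂ v u w c
  have D₁ := hd v w
  have D₂ := hd u w
  have D₃ := hd u (Γ₂ z v w) c
  have D₄ := hd v (Γ₂ z u w) c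
  obtain ⟨d, hd'⟩ : ∃ d, Γ₂ z v w = Γ₁ z v w + d := ⟨Γ₂ z v w - Γ₁ z v w, by abel⟩
  obtain ⟨e, he'⟩ : ∃ e, Γ₂ z u w = Γ₁ z u w + e := ⟨Γ₂ z u w - Γ₁ z u w, by abel⟩
  simp only [schoutenChange, covOneForm, localCurv, hd', he', add_sub_cancel_left, hS, map_add,
    map_sub, map_smul, _root_.add_apply, _root_.sub_apply, _root_.smul_apply, smul_eq_mul, hc]
    at *
  generalize fderiv ℝ (fun y => θ₂ y - θ₁ y) z = Dγ at *
  generalize fderiv ℝ Γ₁ z = DΓ₁ at *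
  generalize fderiv ℝ Γ₂ z = DΓ₂ at *
  have E₁ := hs d
  have E₂ := hs e
  rw [hsymm, D₁] at E₁
  rw [hsymm, D₂] at E₂
  simp only [hsymm w s, hsymm v s, hsymm u s, hs] at E₁ E₂
  rw [hsymm u d, D₁ c, D₁ u] at D₃
  rw [hsymm v e, D₂ c, D₂ v] at D₄
  rw [D₁ c, D₁ (Γ₁ z u c)] at F₁
  rw [D₂ c, D₂ (Γ₁ z v c)] at F₂
  rw [hΓ₁ v u] at *
  rw [hsymm w v, hsymm w u, hsymm v u] at *
  rw [hsymm u (Γ₁ z v w)] at *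
  rw [hsymm v (Γ₁ z u w)] at *
  linear_combination F₁ - F₂ + D₃ - D₄ - G z u c * E₁ + G z v c * E₂

end LocalWeyl

section LocalWeyl
variable {V W : Type*} [NormedAddCommGroup V] [NormedSpace ℝ V]
  [NormedAddCommGroup W] [NormedSpace ℝ W]

theorem two_le_infty : (2 : WithTop ℕ∞) ≤ ∞ := by
  exact WithTop.coe_le_coe.2 (le_top : (2 : ℕ∞) ≤ ⊤)

/-- The identity component of the curvature of a Weyl connection is the exterior derivative of the
Lee form; its trace-free part is skew. -/
theorem IsLocalWeyl.localCurv_skew {G : V → V →L[ℝ] V →L[ℝ] ℝ}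
    {Γ : V → V →L[ℝ] V →L[ℝ] V} {θ : V → V →L[ℝ] ℝ} {z : V} (h : IsLocalWeyl G Γ θ z)
    (u v w c : V) :
    G z (localCurv Γ z u v w) c + G z w (localCurv Γ z u v c) =
      2 * (fderiv ℝ θ z u v - fderiv ℝ θ z v u) * G z w c := by
  have hsymm := h.metric_symm.self_of_nhds
  have hc := h.compat.self_of_nhds
  -- differentiate the compatibility with the metric; the second derivative of `G` is symmetric
  have key (u v : V) : fderiv ℝ (fderiv ℝ G) z u v w c =
      fderiv ℝ G z u (Γ z v w) c + G z (fderiv ℝ Γ z u v w) c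
      + (fderiv ℝ G z u w (Γ z v c) + G z w (fderiv ℝ Γ z u v c))
      - 2 * (fderiv ℝ θ z u v * G z w c + θ z v * fderiv ℝ G z u w c) := by
    have hG := h.contDiffAt_metric.differentiableAt_infty.hasFDerivAt
    have hΓ := h.contDiffAt_christoffel.differentiableAt_infty.hasFDerivAt
    have hθ := h.contDiffAt_lee.differentiableAt_infty.hasFDerivAt
    have hDG := (h.contDiffAt_metric.fderiv_right
      (m := ∞) (by simp)).differentiableAt_infty.hasFDerivAt
    have A := ((hDG.clm_apply (hasFDerivAt_const v z)).clm_apply (hasFDerivAt_const w z)).clm_apply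
      (hasFDerivAt_const c z)
    have X (p : V) := (hΓ.clm_apply (hasFDerivAt_const v z)).clm_apply (hasFDerivAt_const p z)
    have B := (((hG.clm_apply (X w)).clm_apply (hasFDerivAt_const c z)).add
      ((hG.clm_apply (hasFDerivAt_const w z)).clm_apply (X c))).sub
      (((hθ.clm_apply (hasFDerivAt_const v z)).const_mul 2).mul
      ((hG.clm_apply (hasFDerivAt_const w z)).clm_apply (hasFDerivAt_const c z)))
    have B' := B.congr_of_eventuallyEq (f₁ := fun y => fderiv ℝ G y v w c) (by
      filter_upwards [h.compat] with y hy
      exact hy v w c)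
    have := DFunLike.congr_fun (A.unique B') u
    simp only [_root_.add_apply, _root_.sub_apply, _root_.smul_apply,
      ContinuousLinearMap.comp_apply, ContinuousLinearMap.flip_apply, _root_.zero_apply, map_zero,
      zero_add, smul_eq_mul] at this
    linear_combination this
  have hD : fderiv ℝ (fderiv ℝ G) z u v = fderiv ℝ (fderiv ℝ G) z v u :=
    (h.contDiffAt_metric.isSymmSndFDerivAt (by simpa using two_le_infty)) u v
  have k₁ := key u v
  have k₂ := key v u
  rw [hD] at k₁
  simp only [localCurv, map_add, map_sub, _root_.add_apply, _root_.sub_apply, hc] at *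
  linear_combination k₂ - k₁

/-- Replacing `G` by `e^{2f} G` replaces the Lee form `θ` by `θ - df`. -/
theorem IsLocalWeyl.rescale {G : V → V →L[ℝ] V →L[ℝ] ℝ}
    {Γ : V → V →L[ℝ] V →L[ℝ] V} {θ : V → V →L[ℝ] ℝ} {z : V} (h : IsLocalWeyl G Γ θ z)
    {f : V → ℝ} (hf : ContDiffAt ℝ ∞ f z) :
    IsLocalWeyl (fun y => Real.exp (2 * f y) • G y) Γ (fun y => θ y - fderiv ℝ f y) z where
  contDiffAt_metric := (contDiffAt_const.mul hf).exp.smul h.contDiffAt_metric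
  contDiffAt_christoffel := h.contDiffAt_christoffel
  contDiffAt_lee := h.contDiffAt_lee.sub (hf.fderiv_right (by simp))
  metric_symm := by
    filter_upwards [h.metric_symm] with y hy a b
    simp [hy a b]
  metric_pos := by
    filter_upwards [h.metric_pos] with y hy a ha
    exact mul_pos (Real.exp_pos _) (hy a ha)
  christoffel_symm := h.christoffel_symm
  compat := by
    filter_upwards [h.compat, h.contDiffAt_metric.eventually_differentiableAt,
      hf.eventually_differentiableAt] with y hy hG hf v a b
    have A := ((hf.hasFDerivAt.const_mul 2).exp).smul hG.hasFDerivAt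
    have := A.fderiv
    erw [this]
    simp only [_root_.add_apply, _root_.sub_apply, _root_.smul_apply,
      ContinuousLinearMap.smulRight_apply, smul_eq_mul, hy]
    ring

/-! ### Submanifolds of a vector space -/

/-- The pullback of a bilinear map by a linear map. -/
def pullBilin {X : Type*} [NormedAddCommGroup X] [NormedSpace ℝ X] (B : V →L[ℝ] V →L[ℝ] X)
    (L : W →L[ℝ] V) : W →L[ℝ] W →L[ℝ] X :=
  ((ContinuousLinearMap.compL ℝ W V X).flip L).comp (B.comp L)

@[simp]
theorem pullBilin_apply {X : Type*} [NormedAddCommGroup X] [NormedSpace ℝ X]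
    (B : V →L[ℝ] V →L[ℝ] X) (L : W →L[ℝ] V) (a b : W) : pullBilin B L a b = B (L a) (L b) :=
  rfl

/-- The pullback of a metric. -/
def pullMetric (F : W → V) (G : V → V →L[ℝ] V →L[ℝ] ℝ) (y : W) : W →L[ℝ] W →L[ℝ] ℝ :=
  pullBilin (G (F y)) (fderiv ℝ F y)

/-- The pullback of a `1`-form. -/
def pullOneForm (F : W → V) (θ : V → V →L[ℝ] ℝ) (y : W) : W →L[ℝ] ℝ :=
  (θ (F y)).comp (fderiv ℝ F y)

/-- The orthogonal projection to the tangent space of the submanifold parametrized by `F`, read in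
the parameter space. -/
def tanProj (F : W → V) (G : V → V →L[ℝ] V →L[ℝ] ℝ) (y : W) : V →L[ℝ] W :=
  (pullMetric F G y).inverse.comp
    (((ContinuousLinearMap.compL ℝ W V ℝ).flip (fderiv ℝ F y)).comp (G (F y)))

/-- The covariant derivative `∇_a ∂_b` along `F`, as a bilinear map in `a` and `b`. -/
def alongDeriv (F : W → V) (Γ : V → V →L[ℝ] V →L[ℝ] V) (y : W) : W →L[ℝ] W →L[ℝ] V :=
  fderiv ℝ (fderiv ℝ F) y + pullBilin (Γ (F y)) (fderiv ℝ F y)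

/-- The Christoffel symbols of the induced connection. -/
def pullChristoffel (F : W → V) (G : V → V →L[ℝ] V →L[ℝ] ℝ) (Γ : V → V →L[ℝ] V →L[ℝ] V) (y : W) :
    W →L[ℝ] W →L[ℝ] W :=
  ((ContinuousLinearMap.compL ℝ W V W) (tanProj F G y)).comp (alongDeriv F Γ y)

theorem pullChristoffel_apply (F : W → V) (G : V → V →L[ℝ] V →L[ℝ] ℝ)
    (Γ : V → V →L[ℝ] V →L[ℝ] V) (y a b : W) :
    pullChristoffel F G Γ y a b = tanProj F G y (alongDeriv F Γ y a b) :=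
  rfl

theorem _root_.ContDiffAt.pullBilin {U X : Type*} [NormedAddCommGroup U] [NormedSpace ℝ U]
    [NormedAddCommGroup X] [NormedSpace ℝ X] {B : U → V →L[ℝ] V →L[ℝ] X} {L : U → W →L[ℝ] V}
    {z : U} (hB : ContDiffAt ℝ ∞ B z) (hL : ContDiffAt ℝ ∞ L z) :
    ContDiffAt ℝ ∞ (fun y => pullBilin (B y) (L y)) z :=
  (((ContinuousLinearMap.compL ℝ W V X).flip.contDiff.contDiffAt).comp z hL).clm_comp
    (hB.clm_comp hL)

/-- The defining property of the tangential projection. -/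
theorem pullMetric_tanProj {F : W → V} {G : V → V →L[ℝ] V →L[ℝ] ℝ} {y : W}
    (h : (pullMetric F G y).IsInvertible) (A : V) (b : W) :
    pullMetric F G y (tanProj F G y A) b = G (F y) A (fderiv ℝ F y b) := by
  simp only [tanProj, ContinuousLinearMap.comp_apply, h.self_apply_inverse]
  rfl

theorem pullMetric_isInvertible [FiniteDimensional ℝ W] {F : W → V}
    {G : V → V →L[ℝ] V →L[ℝ] ℝ} {y : W} (hG : ∀ a, a ≠ 0 → 0 < G (F y) a a)
    (hF : Function.Injective (fderiv ℝ F y)) : (pullMetric F G y).IsInvertible := by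
  have hinj : Function.Injective (pullMetric F G y) := by
    refine (injective_iff_map_eq_zero _).2 fun a ha => ?_
    by_contra hne
    have h0 : fderiv ℝ F y a ≠ 0 := fun h => hne (hF (by rw [h, map_zero]))
    have h1 := hG _ h0
    have h2 : pullMetric F G y a a = 0 := by rw [ha]; rfl
    exact h1.ne' h2
  have hdim : Module.finrank ℝ W = Module.finrank ℝ (W →L[ℝ] ℝ) := by
    rw [← (LinearMap.toContinuousLinearMap (𝕜 := ℝ) (E := W) (F' := ℝ)).finrank_eq]
    exact Subspace.dual_finrank_eq.symm
  exact ⟨(LinearEquiv.ofInjectiveOfFinrankEq (pullMetric F G y : W →ₗ[ℝ] W →L[ℝ] ℝ) hinj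
    hdim).toContinuousLinearEquiv, by ext; rfl⟩

theorem IsLocalWeyl.contDiffAt_tanProj [FiniteDimensional ℝ W] {G : V → V →L[ℝ] V →L[ℝ] ℝ}
    {Γ : V → V →L[ℝ] V →L[ℝ] V} {θ : V → V →L[ℝ] ℝ} {F : W → V} {z : W}
    (h : IsLocalWeyl G Γ θ (F z)) (hF : ContDiffAt ℝ ∞ F z)
    (hinj : Function.Injective (fderiv ℝ F z)) : ContDiffAt ℝ ∞ (tanProj F G) z := by
  have hDF : ContDiffAt ℝ ∞ (fderiv ℝ F) z := hF.fderiv_right (by simp)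
  have hG : ContDiffAt ℝ ∞ (fun y => G (F y)) z := h.contDiffAt_metric.comp z hF
  have hinv := pullMetric_isInvertible h.metric_pos.self_of_nhds hinj
  have : CompleteSpace W := FiniteDimensional.complete ℝ W
  exact ((hinv.contDiffAt_map_inverse.comp z (hG.pullBilin hDF))).clm_comp
    ((((ContinuousLinearMap.compL ℝ W V ℝ).flip.contDiff.contDiffAt).comp z hDF).clm_comp hG)

theorem fderiv_pullOneForm {F : W → V} {γ : V → V →L[ℝ] ℝ} {z : W} (hF : ContDiffAt ℝ ∞ F z)
    (hγ : ContDiffAt ℝ ∞ γ (F z)) (u v : W) :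
    fderiv ℝ (pullOneForm F γ) z u v = fderiv ℝ γ (F z) (fderiv ℝ F z u) (fderiv ℝ F z v)
      + γ (F z) (fderiv ℝ (fderiv ℝ F) z u v) := by
  have hF' := hF.differentiableAt_infty.hasFDerivAt
  have hDF := (hF.fderiv_right (m := ∞) (by simp)).differentiableAt_infty.hasFDerivAt
  have hγ' := hγ.differentiableAt_infty.hasFDerivAt
  have A := (hγ'.comp z hF').clm_comp hDF
  have B : HasFDerivAt (pullOneForm F γ) _ z := A
  rw [B.fderiv]
  simp only [_root_.add_apply, ContinuousLinearMap.comp_apply, ContinuousLinearMap.compL_apply,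
    ContinuousLinearMap.flip_apply, Function.comp_apply]
  ring

/-- A Weyl structure induces a Weyl structure on a submanifold, by tangential projection. -/
theorem IsLocalWeyl.pull [FiniteDimensional ℝ W] {G : V → V →L[ℝ] V →L[ℝ] ℝ}
    {Γ : V → V →L[ℝ] V →L[ℝ] V} {θ : V → V →L[ℝ] ℝ} {F : W → V} {z : W}
    (h : IsLocalWeyl G Γ θ (F z)) (hF : ContDiffAt ℝ ∞ F z)
    (hinj : ∀ᶠ y in 𝓝 z, Function.Injective (fderiv ℝ F y)) :
    IsLocalWeyl (pullMetric F G) (pullChristoffel F G Γ) (pullOneForm F θ) z := by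
  have hDF : ContDiffAt ℝ ∞ (fderiv ℝ F) z := hF.fderiv_right (by simp)
  have hDDF : ContDiffAt ℝ ∞ (fderiv ℝ (fderiv ℝ F)) z := hDF.fderiv_right (by simp)
  have hG : ContDiffAt ℝ ∞ (fun y => G (F y)) z := h.contDiffAt_metric.comp z hF
  have hc : Tendsto F (𝓝 z) (𝓝 (F z)) := hF.continuousAt
  have hF2 : ContDiffAt ℝ 2 F z := hF.of_le two_le_infty
  have hD2 : ∀ᶠ y in 𝓝 z, ∀ a b, fderiv ℝ (fderiv ℝ F) y a b = fderiv ℝ (fderiv ℝ F) y b a := by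
    filter_upwards [hF2.eventually (by simp)] with y hy a b
    exact hy.isSymmSndFDerivAt (by simp) a b
  have hΓ : ∀ᶠ y in 𝓝 z, ∀ a b, pullChristoffel F G Γ y a b = pullChristoffel F G Γ y b a := by
    filter_upwards [hD2, hc.eventually h.christoffel_symm] with y h1 h2 a b
    simp only [pullChristoffel_apply, alongDeriv, _root_.add_apply, pullBilin_apply, h1 a b]
    rw [h2]
  refine ⟨hG.pullBilin hDF, ?_, (h.contDiffAt_lee.comp z hF).clm_comp hDF, ?_, ?_, hΓ, ?_⟩
  · exact (((ContinuousLinearMap.compL ℝ W V W).contDiff.contDiffAt).comp z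
      (h.contDiffAt_tanProj hF hinj.self_of_nhds)).clm_comp
      (hDDF.add ((h.contDiffAt_christoffel.comp z hF).pullBilin hDF))
  · filter_upwards [hc.eventually h.metric_symm] with y hy a b
    exact hy _ _
  · filter_upwards [hc.eventually h.metric_pos, hinj] with y hy hi a ha
    exact hy _ fun h0 => ha (hi (h0.trans (map_zero _).symm))
  · filter_upwards [hc.eventually h.metric_pos, hinj, hc.eventually h.metric_symm,
      hc.eventually h.compat, hF.eventually_differentiableAt, hDF.eventually_differentiableAt,
      hc.eventually h.contDiffAt_metric.eventually_differentiableAt]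
      with y hpos hi hsymm hcompat hFy hDFy hGy v a b
    have hinv := pullMetric_isInvertible hpos hi
    have A := (hGy.hasFDerivAt.comp y hFy.hasFDerivAt)
    have B (p : W) := hDFy.hasFDerivAt.clm_apply (hasFDerivAt_const p y)
    have C := (A.clm_apply (B a)).clm_apply (B b)
    have D : fderiv ℝ (pullMetric F G) y v a b = fderiv ℝ (fun x => pullMetric F G x a b) y v := by
      have hd : DifferentiableAt ℝ (pullMetric F G) y := by
        exact (((ContinuousLinearMap.compL ℝ W V ℝ).flip.differentiableAt).comp y hDFy).clm_comp
          (A.differentiableAt.clm_comp hDFy)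
      have E := (hd.hasFDerivAt.clm_apply (hasFDerivAt_const a y)).clm_apply (hasFDerivAt_const b y)
      rw [E.fderiv]
      simp
    have C' : HasFDerivAt (fun x => pullMetric F G x a b) _ y := C
    rw [D, C'.fderiv]
    have hs : pullMetric F G y a (pullChristoffel F G Γ y v b) =
        pullMetric F G y (pullChristoffel F G Γ y v b) a := hsymm _ _
    rw [hs]
    simp only [pullChristoffel_apply, pullMetric_tanProj hinv]
    simp only [_root_.add_apply, ContinuousLinearMap.comp_apply, ContinuousLinearMap.flip_apply,
      Function.comp_apply, alongDeriv, pullBilin_apply, map_add, hcompat, _root_.zero_apply,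
      map_zero, zero_add, pullMetric, pullOneForm]
    rw [hsymm (fderiv ℝ F y a), hsymm (fderiv ℝ F y a)]
    ring

/-- Gauss formula for the change of the Schouten tensor: the changes of the Schouten tensors of a
manifold and of a submanifold differ by terms in the fundamental form `B`. -/
theorem schoutenChange_pull {G : V → V →L[ℝ] V →L[ℝ] ℝ}
    {Γ : V → V →L[ℝ] V →L[ℝ] V} {γ : V → V →L[ℝ] ℝ} {F : W → V} {z : W}
    (hF : ContDiffAt ℝ ∞ F z) (hγ : ContDiffAt ℝ ∞ γ (F z)) (s : V) (t u v : W) :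
    schoutenChange G Γ γ (F z) s (fderiv ℝ F z u) (fderiv ℝ F z v) =
      schoutenChange (pullMetric F G) (pullChristoffel F G Γ) (pullOneForm F γ) z t u v
      - γ (F z) (alongDeriv F Γ z u v - fderiv ℝ F z (tanProj F G z (alongDeriv F Γ z u v)))
      + 1 / 2 * (γ (F z) s - γ (F z) (fderiv ℝ F z t)) * pullMetric F G z u v := by
  simp only [schoutenChange, covOneForm, fderiv_pullOneForm hF hγ, pullChristoffel_apply,
    pullOneForm, ContinuousLinearMap.comp_apply, pullMetric, pullBilin_apply, map_sub]
  simp only [alongDeriv, _root_.add_apply, map_add, pullBilin_apply]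
  ring

end LocalWeyl

/-! ### Traces -/

section Traces

variable {k : ℕ} {V W : Type*} [AddCommGroup V] [Module ℝ V] [AddCommGroup W] [Module ℝ W]
  (b : Module.Basis (Fin k) ℝ V)

theorem traceEnd_add (T₁ T₂ : V → V) :
    traceEnd b (fun w => T₁ w + T₂ w) = traceEnd b T₁ + traceEnd b T₂ := by
  simp [traceEnd, Finset.sum_add_distrib]

theorem traceEnd_sub (T₁ T₂ : V → V) :
    traceEnd b (fun w => T₁ w - T₂ w) = traceEnd b T₁ - traceEnd b T₂ := by
  simp [traceEnd, Finset.sum_sub_distrib]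

theorem traceEnd_smul (c : ℝ) (T : V → V) :
    traceEnd b (fun w => c • T w) = c * traceEnd b T := by
  simp [traceEnd, Finset.mul_sum]

theorem traceEnd_id : traceEnd b (fun w => w) = k := by
  simp [traceEnd]

theorem traceEnd_smul_const (f : V →ₗ[ℝ] ℝ) (x : V) : traceEnd b (fun w => f w • x) = f x := by
  conv_rhs => rw [← b.sum_repr x, map_sum]
  simp only [traceEnd, map_smul, Finsupp.smul_apply, smul_eq_mul, mul_comm]

theorem traceWith_add (q : V → V → ℝ) (B₁ B₂ : V → V → W) :
    traceWith b q (fun u v => B₁ u v + B₂ u v) = traceWith b q B₁ + traceWith b q B₂ := by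
  simp [traceWith, Finset.sum_add_distrib]

theorem traceWith_sub (q : V → V → ℝ) (B₁ B₂ : V → V → W) :
    traceWith b q (fun u v => B₁ u v - B₂ u v) = traceWith b q B₁ - traceWith b q B₂ := by
  simp [traceWith, Finset.sum_sub_distrib, smul_sub]

theorem traceWith_mul (q : V → V → ℝ) (c : ℝ) (B : V → V → ℝ) :
    traceWith b q (fun u v => c * B u v) = c * traceWith b q B := by
  simp only [traceWith, Finset.mul_sum, smul_eq_mul]
  exact Finset.sum_congr rfl fun i _ => Finset.sum_congr rfl fun j _ => by ring

theorem traceWith_smul_const (q : V → V → ℝ) (B : V → V → ℝ) (x : W) :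
    traceWith b q (fun u v => B u v • x) = traceWith b q B • x := by
  simp [traceWith, Finset.sum_smul, smul_smul]

theorem traceWith_mul_form {c : ℝ} (hc : c ≠ 0) (q : V → V → ℝ) (B : V → V → W) :
    traceWith b (fun u v => c * q u v) B = c⁻¹ • traceWith b q B := by
  have h : gram b (fun u v => c * q u v) = c • gram b q := by
    ext i j
    simp [gram]
  have : Invertible c := invertibleOfNonzero hc
  have h' : (c • gram b q)⁻¹ = c⁻¹ • (gram b q)⁻¹ := by
    by_cases hd : IsUnit (gram b q).det
    · rw [Matrix.inv_smul _ _ hd]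
      simp
    · rw [Matrix.nonsing_inv_apply_not_isUnit _ hd, Matrix.nonsing_inv_apply_not_isUnit, smul_zero]
      rw [Matrix.det_smul, isUnit_iff_ne_zero]
      rw [isUnit_iff_ne_zero] at hd
      simp only [not_not] at hd
      simp [hd]
  simp only [traceWith, h, h', Matrix.smul_apply, smul_eq_mul, ← smul_smul, Finset.smul_sum]

theorem traceWith_swap {q : V → V → ℝ} (hq : ∀ u v, q u v = q v u) (B : V → V → W) :
    traceWith b q (fun u v => B v u) = traceWith b q B := by
  have hg : (gram b q)ᵀ = gram b q := by
    ext i j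
    exact hq _ _
  have hi (i j) : (gram b q)⁻¹ i j = (gram b q)⁻¹ j i := by
    conv_lhs => rw [← hg, ← Matrix.transpose_nonsing_inv]
    rfl
  simp only [traceWith]
  rw [Finset.sum_comm]
  simp only [hi]

/-- The Gram matrix of a definite form is invertible. -/
theorem isUnit_gram_det {q : V →ₗ[ℝ] V →ₗ[ℝ] ℝ} (hq : ∀ v, v ≠ 0 → 0 < q v v) :
    IsUnit (gram b fun u v => q u v).det := by
  rw [isUnit_iff_ne_zero]
  intro h0
  obtain ⟨c, hc, hc'⟩ := Matrix.exists_mulVec_eq_zero_iff.2 h0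
  have hne : ∑ j, c j • b j ≠ 0 := by
    intro h
    exact hc (funext fun j => Fintype.linearIndependent_iff.1 b.linearIndependent c h j)
  have h1 : q (∑ i, c i • b i) (∑ j, c j • b j) = c ⬝ᵥ (gram b fun u v => q u v) *ᵥ c := by
    simp only [map_sum, map_smul, LinearMap.sum_apply, LinearMap.smul_apply, smul_eq_mul, dotProduct,
      Matrix.mulVec, gram, Matrix.of_apply, Finset.mul_sum]
    rw [Finset.sum_comm]
    exact Finset.sum_congr rfl fun i _ => Finset.sum_congr rfl fun j _ => by ring
  have h2 := hq _ hne
  rw [h1, hc', dotProduct_zero] at h2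
  exact h2.false

/-- The `q`-trace of a bilinear form is the trace of the corresponding endomorphism. -/
theorem traceWith_eq_traceEnd {q : V →ₗ[ℝ] V →ₗ[ℝ] ℝ} (hq : ∀ v, v ≠ 0 → 0 < q v v)
    (hs : ∀ u v, q u v = q v u) (S : V →ₗ[ℝ] V) :
    traceWith b (fun u v => q u v) (fun u v => q (S u) v) = traceEnd b S := by
  have hu := isUnit_gram_det b hq
  have h1 (i j : Fin k) : q (S (b i)) (b j) =
      ∑ l, b.repr (S (b i)) l * gram b (fun u v => q u v) l j := by
    conv_lhs => rw [← b.sum_repr (S (b i)), map_sum, LinearMap.sum_apply]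
    simp only [map_smul, LinearMap.smul_apply, smul_eq_mul, gram, Matrix.of_apply]
  rw [← traceWith_swap b hs]
  simp only [traceWith, traceEnd, h1, smul_eq_mul]
  rw [Finset.sum_comm]
  refine Finset.sum_congr rfl fun i _ => ?_
  have h2 (l : Fin k) : ∑ j, gram b (fun u v => q u v) l j * (gram b fun u v => q u v)⁻¹ j i =
      (1 : Matrix (Fin k) (Fin k) ℝ) l i := by
    rw [← Matrix.mul_nonsing_inv _ hu]
    rfl
  calc ∑ j, (gram b fun u v => q u v)⁻¹ j i *
        ∑ l, b.repr (S (b i)) l * gram b (fun u v => q u v) l j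
      = ∑ l, b.repr (S (b i)) l *
        ∑ j, gram b (fun u v => q u v) l j * (gram b fun u v => q u v)⁻¹ j i := by
        simp only [Finset.mul_sum]
        rw [Finset.sum_comm]
        exact Finset.sum_congr rfl fun i _ => Finset.sum_congr rfl fun j _ => by ring
    _ = b.repr (S (b i)) i := by
        simp [h2, Matrix.one_apply]

theorem traceWith_self {q : V →ₗ[ℝ] V →ₗ[ℝ] ℝ} (hq : ∀ v, v ≠ 0 → 0 < q v v)
    (hs : ∀ u v, q u v = q v u) :
    traceWith b (fun u v => q u v) (fun u v => q u v) = k := by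
  rw [← traceEnd_id b]
  exact traceWith_eq_traceEnd b hq hs LinearMap.id

/-- A bilinear form is represented by an endomorphism. -/
theorem exists_endomorphism [FiniteDimensional ℝ V] {q : V →ₗ[ℝ] V →ₗ[ℝ] ℝ}
    (hq : ∀ v, v ≠ 0 → 0 < q v v) (B : V →ₗ[ℝ] V →ₗ[ℝ] ℝ) :
    ∃ S : V →ₗ[ℝ] V, ∀ u v, q (S u) v = B u v := by
  have hinj : Function.Injective q := by
    refine (injective_iff_map_eq_zero _).2 fun a ha => ?_
    by_contra hne
    have h1 := hq _ hne
    rw [ha] at h1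
    exact h1.false
  let e := LinearEquiv.ofInjectiveOfFinrankEq q hinj (Subspace.dual_finrank_eq (K := ℝ) (V := V)).symm
  refine ⟨e.symm.toLinearMap.comp B, fun u v => ?_⟩
  have : e (e.symm (B u)) = B u := e.apply_symm_apply _
  exact DFunLike.congr_fun this v

theorem exists_dual_vector [FiniteDimensional ℝ V] {q : V →ₗ[ℝ] V →ₗ[ℝ] ℝ}
    (hq : ∀ v, v ≠ 0 → 0 < q v v) (f : V →ₗ[ℝ] ℝ) :
    ∃ s : V, ∀ v, q s v = f v := by
  have hinj : Function.Injective q := by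
    refine (injective_iff_map_eq_zero _).2 fun a ha => ?_
    by_contra hne
    have h1 := hq _ hne
    rw [ha] at h1
    exact h1.false
  let e := LinearEquiv.ofInjectiveOfFinrankEq q hinj (Subspace.dual_finrank_eq (K := ℝ) (V := V)).symm
  exact ⟨e.symm f, fun v => DFunLike.congr_fun (e.apply_symm_apply f) v⟩

/-- On a line, every bilinear form is its trace times the metric. -/
theorem eq_traceWith_mul_of_finrank_one (b : Module.Basis (Fin 1) ℝ V) {q : V →ₗ[ℝ] V →ₗ[ℝ] ℝ}
    (hq : ∀ v, v ≠ 0 → 0 < q v v) (B : V →ₗ[ℝ] V →ₗ[ℝ] ℝ) (u v : V) :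
    B u v = traceWith b (fun u v => q u v) (fun u v => B u v) * q u v := by
  have h0 : q (b 0) (b 0) ≠ 0 := (hq _ (b.ne_zero 0)).ne'
  have hu : u = b.repr u 0 • b 0 := by conv_lhs => rw [← b.sum_repr u]; simp
  have hv : v = b.repr v 0 • b 0 := by conv_lhs => rw [← b.sum_repr v]; simp
  have ht : traceWith b (fun u v => q u v) (fun u v => B u v) =
      (q (b 0) (b 0))⁻¹ * B (b 0) (b 0) := by
    simp [traceWith, gram, Ring.inverse_eq_inv]
  rw [ht, hu, hv]
  simp only [map_smul, LinearMap.smul_apply, smul_eq_mul]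
  field_simp

end Traces

/-! ### Change of the Ricci tensor, the Faraday form and the Hessian, in coordinates -/

section LocalCurvature

variable {k : ℕ} {V : Type*} [NormedAddCommGroup V] [NormedSpace ℝ V]
  (b : Module.Basis (Fin k) ℝ V)

/-- The bilinear form underlying a continuous one. -/
def toBilin (B : V →L[ℝ] V →L[ℝ] ℝ) : V →ₗ[ℝ] V →ₗ[ℝ] ℝ :=
  LinearMap.mk₂ ℝ (fun u v => B u v) (by simp) (by simp) (by simp) (by simp)

theorem toBilin_apply (B : V →L[ℝ] V →L[ℝ] ℝ) (u v : V) : toBilin B u v = B u v :=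
  rfl

/-- The Ricci tensor of the connection with Christoffel symbols `Γ`. -/
def localRic (Γ : V → V →L[ℝ] V →L[ℝ] V) (z u v : V) : ℝ :=
  traceEnd b fun w => localCurv Γ z w u v

/-- The Faraday form of the connection with Christoffel symbols `Γ`. -/
def localFaraday (Γ : V → V →L[ℝ] V →L[ℝ] V) (z u v : V) : ℝ :=
  (1 / k : ℝ) * traceEnd b fun w => localCurv Γ z u v w

/-- The Hessian of a section `l` of `L^w`, for the connection with Christoffel symbols `Γ` and Lee
form `θ`. -/
def localHess (w : ℝ) (Γ : V → V →L[ℝ] V →L[ℝ] V) (θ : V → V →L[ℝ] ℝ) (l : V → ℝ) (z u v : V) : ℝ :=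
  fderiv ℝ (fun y => fderiv ℝ l y v + w * l y * θ y v) z u
    + w * θ z u * (fderiv ℝ l z v + w * l z * θ z v)
    - (fderiv ℝ l z (Γ z u v) + w * l z * θ z (Γ z u v))

variable {G : V → V →L[ℝ] V →L[ℝ] ℝ} {Γ Γ₁ Γ₂ : V → V →L[ℝ] V →L[ℝ] V}
  {θ θ₁ θ₂ : V → V →L[ℝ] ℝ} {z s : V}

theorem IsLocalWeyl.toBilin_pos (h : IsLocalWeyl G Γ θ z) (v : V) (hv : v ≠ 0) :
    0 < toBilin (G z) v v :=
  h.metric_pos.self_of_nhds v hv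

theorem IsLocalWeyl.toBilin_symm (h : IsLocalWeyl G Γ θ z) (u v : V) :
    toBilin (G z) u v = toBilin (G z) v u :=
  h.metric_symm.self_of_nhds u v

theorem IsLocalWeyl.traceWith_swap (h : IsLocalWeyl G Γ θ z) (B : V → V → ℝ) :
    traceWith b (fun u v => G z u v) (fun u v => B v u) =
      traceWith b (fun u v => G z u v) B :=
  ConformalSubmanifold.traceWith_swap (q := fun u v => G z u v) b h.metric_symm.self_of_nhds B

theorem IsLocalWeyl.traceWith_self (h : IsLocalWeyl G Γ θ z) :
    traceWith b (fun u v => G z u v) (fun u v => G z u v) = k := by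
  have := ConformalSubmanifold.traceWith_self b h.toBilin_pos h.toBilin_symm
  simpa only [toBilin_apply] using this

theorem IsLocalWeyl.traceWith_eq_traceEnd (h : IsLocalWeyl G Γ θ z) (S : V →ₗ[ℝ] V) :
    traceWith b (fun u v => G z u v) (fun u v => G z (S u) v) = traceEnd b S := by
  have := ConformalSubmanifold.traceWith_eq_traceEnd b h.toBilin_pos h.toBilin_symm S
  simpa only [toBilin_apply] using this

/-- `schoutenChange` as a bilinear map. -/
def schoutenChangeBilin (G : V → V →L[ℝ] V →L[ℝ] ℝ) (Γ : V → V →L[ℝ] V →L[ℝ] V)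
    (γ : V → V →L[ℝ] ℝ) (z s : V) : V →ₗ[ℝ] V →ₗ[ℝ] ℝ :=
  LinearMap.mk₂ ℝ (schoutenChange G Γ γ z s)
    (fun u v w => by simp only [schoutenChange, covOneForm, map_add, _root_.add_apply]; ring)
    (fun c u v => by
      simp only [schoutenChange, covOneForm, map_smul, _root_.smul_apply, smul_eq_mul]; ring)
    (fun u v w => by simp only [schoutenChange, covOneForm, map_add]; ring)
    (fun c u v => by simp only [schoutenChange, covOneForm, map_smul, smul_eq_mul]; ring)

theorem schoutenChangeBilin_apply (γ : V → V →L[ℝ] ℝ) (u v : V) :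
    schoutenChangeBilin G Γ γ z s u v = schoutenChange G Γ γ z s u v :=
  rfl

/-- The curvature as a linear map in its last argument. -/
def localCurvLast (Γ : V → V →L[ℝ] V →L[ℝ] V) (z u v : V) : V →ₗ[ℝ] V where
  toFun w := localCurv Γ z u v w
  map_add' w w' := by simp only [localCurv, map_add]; abel
  map_smul' c w := by simp only [localCurv, map_smul, RingHom.id_apply]; module

/-- The Faraday form is the exterior derivative of the Lee form. -/
theorem IsLocalWeyl.localFaraday_eq (h : IsLocalWeyl G Γ θ z) (hk : k ≠ 0) (u v : V) :
    localFaraday b Γ z u v = fderiv ℝ θ z u v - fderiv ℝ θ z v u := by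
  have key := h.localCurv_skew u v
  have t₁ := h.traceWith_eq_traceEnd b (localCurvLast Γ z u v)
  have t₂ := h.traceWith_swap b (fun w c => G z (localCurvLast Γ z u v w) c)
  have t₃ := h.traceWith_self b
  have t₄ := traceWith_mul b (fun u v => G z u v)
    (2 * (fderiv ℝ θ z u v - fderiv ℝ θ z v u)) (fun u v => G z u v)
  have t₅ := traceWith_add b (fun u v => G z u v)
    (fun w c => G z (localCurvLast Γ z u v w) c)
    (fun w c => G z (localCurvLast Γ z u v c) w)
  have t₆ : (fun w c => G z (localCurvLast Γ z u v w) c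
      + G z (localCurvLast Γ z u v c) w) =
      fun w c => 2 * (fderiv ℝ θ z u v - fderiv ℝ θ z v u) * G z w c := by
    funext w c
    rw [h.metric_symm.self_of_nhds (localCurvLast Γ z u v c) w]
    exact key w c
  rw [t₆, t₄, t₂, t₁, t₃] at t₅
  have hk' : (k : ℝ) ≠ 0 := by exact_mod_cast hk
  have t₇ : traceEnd b (localCurvLast Γ z u v) = traceEnd b fun w => localCurv Γ z u v w := rfl
  rw [localFaraday, ← t₇]
  field_simp
  linarith

/-- The trace of `schoutenChange` with respect to the metric. -/
def traceChange (G : V → V →L[ℝ] V →L[ℝ] ℝ) (Γ : V → V →L[ℝ] V →L[ℝ] V)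
    (γ : V → V →L[ℝ] ℝ) (z s : V) : ℝ :=
  traceWith b (fun u v => G z u v) (schoutenChange G Γ γ z s)

/-- The Ricci tensor changes by `Qᵀ - (k - 1) Q - (tr Q) G`, the trace of the change of the curvature. -/
theorem IsLocalWeyl.localRic_sub (h₁ : IsLocalWeyl G Γ₁ θ₁ z) (h₂ : IsLocalWeyl G Γ₂ θ₂ z)
    (hs : ∀ c, G z s c = (θ₂ z - θ₁ z) c) (u v : V) :
    localRic b Γ₂ z u v = localRic b Γ₁ z u v
      + schoutenChange G Γ₁ (fun y => θ₂ y - θ₁ y) z s v u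
      - (k - 1) * schoutenChange G Γ₁ (fun y => θ₂ y - θ₁ y) z s u v
      - G z u v * traceChange b G Γ₁ (fun y => θ₂ y - θ₁ y) z s := by
  have : FiniteDimensional ℝ V := b.finiteDimensional_of_finite
  have hpos := h₁.toBilin_pos
  obtain ⟨S, hS⟩ := exists_endomorphism hpos
    (schoutenChangeBilin G Γ₁ (fun y => θ₂ y - θ₁ y) z s)
  have hS' (u c : V) : G z (S u) c = schoutenChange G Γ₁ (fun y => θ₂ y - θ₁ y) z s u c := hS u c
  have hτ : traceChange b G Γ₁ (fun y => θ₂ y - θ₁ y) z s = traceEnd b S := by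
    rw [← h₁.traceWith_eq_traceEnd b S]
    simp only [hS']
    rfl
  have e₁ := traceEnd_smul_const b ((toBilin (G z)).flip u ∘ₗ S) v
  have e₂ := traceEnd_smul_const b (toBilin (G z) (S u)) v
  have e₃ := traceEnd_smul_const b ((toBilin (G z)).flip v ∘ₗ S) u
  have e₄ := traceEnd_smul_const b ((toBilin (G z)).flip v) (S u)
  have e₅ : traceEnd b (HSMul.hSMul (G z (S u) v)) = G z (S u) v * k := by
    rw [← traceEnd_id b, ← traceEnd_smul]
  simp only [LinearMap.comp_apply, LinearMap.flip_apply, toBilin_apply] at e₁ e₂ e₃ e₄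
  simp only [localRic, h₁.localCurv_sub h₂ hs hS', traceEnd_add, traceEnd_sub, traceEnd_smul,
    sub_smul, e₁, e₂, e₃, e₄]
  rw [e₅, hτ, ← hS', ← hS']
  have e₆ : traceEnd b (fun w => S w) = traceEnd b S := rfl
  rw [e₆]
  ring

theorem IsLocalWeyl.localScal_sub (h₁ : IsLocalWeyl G Γ₁ θ₁ z) (h₂ : IsLocalWeyl G Γ₂ θ₂ z)
    (hs : ∀ c, G z s c = (θ₂ z - θ₁ z) c) :
    traceWith b (fun u v => G z u v) (localRic b Γ₂ z) =
      traceWith b (fun u v => G z u v) (localRic b Γ₁ z)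
      - 2 * (k - 1) * traceChange b G Γ₁ (fun y => θ₂ y - θ₁ y) z s := by
  have e₀ : localRic b Γ₂ z = fun u v => localRic b Γ₁ z u v
      + schoutenChange G Γ₁ (fun y => θ₂ y - θ₁ y) z s v u
      - (k - 1) * schoutenChange G Γ₁ (fun y => θ₂ y - θ₁ y) z s u v
      - traceChange b G Γ₁ (fun y => θ₂ y - θ₁ y) z s * G z u v := by
    funext u v
    rw [h₁.localRic_sub b h₂ hs]
    ring
  have e₁ := h₁.traceWith_swap b (schoutenChange G Γ₁ (fun y => θ₂ y - θ₁ y) z s)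
  have e₂ := h₁.traceWith_self b
  rw [e₀, traceWith_sub, traceWith_sub, traceWith_add, traceWith_mul, traceWith_mul, e₁, e₂]
  simp only [traceChange]
  ring

/-- The Faraday form changes by twice the skew part of `Q`, that is by `dγ`. -/
theorem IsLocalWeyl.localFaraday_sub (h₁ : IsLocalWeyl G Γ₁ θ₁ z) (h₂ : IsLocalWeyl G Γ₂ θ₂ z)
    (hk : k ≠ 0) (u v : V) :
    localFaraday b Γ₂ z u v = localFaraday b Γ₁ z u v
      + schoutenChange G Γ₁ (fun y => θ₂ y - θ₁ y) z s u v
      - schoutenChange G Γ₁ (fun y => θ₂ y - θ₁ y) z s v u := by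
  have hγ : fderiv ℝ (fun y => θ₂ y - θ₁ y) z = fderiv ℝ θ₂ z - fderiv ℝ θ₁ z :=
    fderiv_fun_sub h₂.contDiffAt_lee.differentiableAt_infty h₁.contDiffAt_lee.differentiableAt_infty
  rw [h₁.localFaraday_eq b hk, h₂.localFaraday_eq b hk]
  simp only [schoutenChange, covOneForm, hγ, _root_.sub_apply]
  rw [h₁.christoffel_symm.self_of_nhds v u, h₁.metric_symm.self_of_nhds v u]
  ring

/-- The change of the Hessian of a section of `L^w`. The first order terms have the coefficient `w - 1`
or are multiples of the metric. -/
theorem IsLocalWeyl.localHess_sub (h₁ : IsLocalWeyl G Γ₁ θ₁ z) (h₂ : IsLocalWeyl G Γ₂ θ₂ z)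
    (hs : ∀ c, G z s c = (θ₂ z - θ₁ z) c) (w : ℝ) {l : V → ℝ} (hl : ContDiffAt ℝ ∞ l z) (u v : V) :
    localHess w Γ₂ θ₂ l z u v = localHess w Γ₁ θ₁ l z u v
      + w * l z * covOneForm Γ₁ (fun y => θ₂ y - θ₁ y) z u v
      + (w ^ 2 - 2 * w) * l z * ((θ₂ z - θ₁ z) u * (θ₂ z - θ₁ z) v)
      + (w - 1) * ((θ₂ z - θ₁ z) u * (fderiv ℝ l z v + w * l z * θ₁ z v)
        + (θ₂ z - θ₁ z) v * (fderiv ℝ l z u + w * l z * θ₁ z u))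
      + (fderiv ℝ l z s + w * l z * θ₁ z s + w * l z * (θ₂ z - θ₁ z) s) * G z u v := by
  have hγ : fderiv ℝ (fun y => θ₂ y - θ₁ y) z = fderiv ℝ θ₂ z - fderiv ℝ θ₁ z :=
    fderiv_fun_sub h₂.contDiffAt_lee.differentiableAt_infty h₁.contDiffAt_lee.differentiableAt_infty
  have hl' := hl.differentiableAt_infty.hasFDerivAt
  have hDl := (hl.fderiv_right (m := ∞) (by simp)).differentiableAt_infty.hasFDerivAt
  have D {θ : V → V →L[ℝ] ℝ} (hθ : ContDiffAt ℝ ∞ θ z) :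
      fderiv ℝ (fun y => fderiv ℝ l y v + w * l y * θ y v) z u =
        fderiv ℝ (fderiv ℝ l) z u v + w * (fderiv ℝ l z u * θ z v + l z * fderiv ℝ θ z u v) := by
    have hθ' := hθ.differentiableAt_infty.hasFDerivAt
    have A := (hDl.clm_apply (hasFDerivAt_const v z)).add
      ((hl'.const_mul w).mul (hθ'.clm_apply (hasFDerivAt_const v z)))
    have B : HasFDerivAt (fun y => fderiv ℝ l y v + w * l y * θ y v) _ z := A
    rw [B.fderiv]
    simp only [_root_.add_apply, _root_.smul_apply, ContinuousLinearMap.comp_apply,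
      ContinuousLinearMap.flip_apply, _root_.zero_apply, map_zero, zero_add, smul_eq_mul]
    ring
  have hΓ : Γ₂ z u v = Γ₁ z u v + ((θ₂ z - θ₁ z) u • v + (θ₂ z - θ₁ z) v • u - G z u v • s) := by
    refine h₁.metric_ext fun c => ?_
    have := (h₁.christoffel_sub h₂).self_of_nhds u v c
    simp only [map_add, map_sub, map_smul, _root_.add_apply, _root_.sub_apply, _root_.smul_apply,
      smul_eq_mul, hs] at *
    linear_combination this
  simp only [localHess, D h₁.contDiffAt_lee, D h₂.contDiffAt_lee, hΓ, covOneForm, hγ]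
  simp only [map_add, map_sub, map_smul, _root_.sub_apply, smul_eq_mul]
  ring

/-- In weight `1` the Hessian changes by `l Q`, up to multiples of the metric. -/
theorem IsLocalWeyl.localHess_one_sub (h₁ : IsLocalWeyl G Γ₁ θ₁ z) (h₂ : IsLocalWeyl G Γ₂ θ₂ z)
    (hs : ∀ c, G z s c = (θ₂ z - θ₁ z) c) {l : V → ℝ} (hl : ContDiffAt ℝ ∞ l z) :
    ∃ t : ℝ, ∀ u v, localHess 1 Γ₂ θ₂ l z u v = localHess 1 Γ₁ θ₁ l z u v
      + l z * schoutenChange G Γ₁ (fun y => θ₂ y - θ₁ y) z s u v + t * G z u v := by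
  refine ⟨fderiv ℝ l z s + l z * θ₁ z s + 1 / 2 * l z * (θ₂ z - θ₁ z) s, fun u v => ?_⟩
  rw [h₁.localHess_sub h₂ hs 1 hl, schoutenChange]
  ring

set_option maxHeartbeats 1000000 in
/-- In weight `1 - k/2`, in dimension `k`, the first order terms cancel in the trace, which changes by
a scalar operator. -/
theorem IsLocalWeyl.trace_localHess_sub (h₁ : IsLocalWeyl G Γ₁ θ₁ z) (h₂ : IsLocalWeyl G Γ₂ θ₂ z)
    (hs : ∀ c, G z s c = (θ₂ z - θ₁ z) c) {l : V → ℝ} (hl : ContDiffAt ℝ ∞ l z) :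
    traceWith b (fun u v => G z u v) (localHess (1 - k / 2) Γ₂ θ₂ l z) =
      traceWith b (fun u v => G z u v) (localHess (1 - k / 2) Γ₁ θ₁ l z)
      + (1 - k / 2) * l z * traceChange b G Γ₁ (fun y => θ₂ y - θ₁ y) z s := by
  have hpos := h₁.toBilin_pos
  have : FiniteDimensional ℝ V := b.finiteDimensional_of_finite
  -- the trace of `α ⊗ β` is `β` evaluated at the dual vector of `α`
  have hprod (β : V →L[ℝ] ℝ) : traceWith b (fun u v => G z u v)
      (fun u v => (θ₂ z - θ₁ z) v * β u) = β s := by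
    obtain ⟨p, hp⟩ := exists_dual_vector hpos (β : V →ₗ[ℝ] ℝ)
    have e₁ := h₁.traceWith_eq_traceEnd b ((toBilin (G z) p).smulRight s)
    have e₂ := traceEnd_smul_const b (toBilin (G z) p) s
    have e₃ : traceEnd b ((toBilin (G z) p).smulRight s) = traceEnd b fun w => toBilin (G z) p w • s
      := rfl
    rw [e₃, e₂, hp] at e₁
    refine Eq.trans (congrArg (traceWith b fun u v => G z u v) ?_) e₁
    funext u v
    simp only [LinearMap.smulRight_apply, map_smul, _root_.smul_apply, hp, smul_eq_mul, hs,
      ContinuousLinearMap.coe_coe]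
    ring
  have hprod' (β : V →L[ℝ] ℝ) : traceWith b (fun u v => G z u v)
      (fun u v => (θ₂ z - θ₁ z) u * β v) = β s := by
    rw [← hprod β]
    exact h₁.traceWith_swap b (fun u v => (θ₂ z - θ₁ z) v * β u)
  have hid := h₁.traceWith_self b
  set w : ℝ := 1 - k / 2 with hw
  have E : localHess w Γ₂ θ₂ l z = fun u v => localHess w Γ₁ θ₁ l z u v
      + w * l z * covOneForm Γ₁ (fun y => θ₂ y - θ₁ y) z u v
      + (w ^ 2 - 2 * w) * l z * ((θ₂ z - θ₁ z) u * (θ₂ z - θ₁ z) v)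
      + (w - 1) * ((θ₂ z - θ₁ z) u * (fderiv ℝ l z + (w * l z) • θ₁ z) v
        + (θ₂ z - θ₁ z) v * (fderiv ℝ l z + (w * l z) • θ₁ z) u)
      + (fderiv ℝ l z s + w * l z * θ₁ z s + w * l z * (θ₂ z - θ₁ z) s) * G z u v := by
    funext u v
    rw [h₁.localHess_sub h₂ hs w hl]
    simp only [_root_.add_apply, _root_.smul_apply, smul_eq_mul]
  have E' : schoutenChange G Γ₁ (fun y => θ₂ y - θ₁ y) z s = fun u v =>
      covOneForm Γ₁ (fun y => θ₂ y - θ₁ y) z u v - (θ₂ z - θ₁ z) u * (θ₂ z - θ₁ z) v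
      + 1 / 2 * (θ₂ z - θ₁ z) s * G z u v := rfl
  rw [E, traceChange, E']
  simp only [traceWith_add, traceWith_sub, traceWith_mul, hprod, hprod', hid]
  simp only [_root_.add_apply, _root_.smul_apply, smul_eq_mul]
  rw [hw]
  ring

end LocalCurvature

/-! ### Coordinate frames -/

section Charts

variable {m : ℕ} {M : Type*} [TopologicalSpace M] [ChartedSpace (EuclideanSpace ℝ (Fin m)) M]

theorem eventually_mem_source (x₀ : M) :
    ∀ᶠ y in 𝓝 x₀, y ∈ (chartAt (EuclideanSpace ℝ (Fin m)) x₀).source :=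
  (chartAt (EuclideanSpace ℝ (Fin m)) x₀).open_source.mem_nhds (mem_chart_source _ x₀)

theorem tendsto_chart {x₀ y : M} (hy : y ∈ (chartAt (EuclideanSpace ℝ (Fin m)) x₀).source) :
    Tendsto (extChartAt (𝓡 m) x₀) (𝓝 y) (𝓝 (extChartAt (𝓡 m) x₀ y)) :=
  continuousAt_extChartAt' (by rwa [extChartAt_source])

theorem eventually_right_inv (x₀ : M) :
    ∀ᶠ z in 𝓝 (extChartAt (𝓡 m) x₀ x₀), extChartAt (𝓡 m) x₀ ((extChartAt (𝓡 m) x₀).symm z) = z := by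
  filter_upwards [extChartAt_target_mem_nhds x₀] with z hz
  exact (extChartAt (𝓡 m) x₀).right_inv hz

variable [IsManifold (𝓡 m) ∞ M]

/-- The coordinate frame at `y` of the chart centred at `x₀`: it sends a vector of the model space
to the vector at `y` with these coordinates. -/
def frame (x₀ y : M) : EuclideanSpace ℝ (Fin m) →L[ℝ] TangentSpace (𝓡 m) y :=
  (trivializationAt (EuclideanSpace ℝ (Fin m)) (TangentSpace (𝓡 m) : M → Type _) x₀).symmL ℝ y

/-- The coordinates of a tangent vector at `y` in the chart centred at `x₀`. -/
def coframe (x₀ y : M) : TangentSpace (𝓡 m) y →L[ℝ] EuclideanSpace ℝ (Fin m) :=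
  (trivializationAt (EuclideanSpace ℝ (Fin m)) (TangentSpace (𝓡 m) : M → Type _)
    x₀).continuousLinearMapAt ℝ y

variable {x₀ y : M}

theorem frame_coframe (hy : y ∈ (chartAt (EuclideanSpace ℝ (Fin m)) x₀).source)
    (v : TangentSpace (𝓡 m) y) : frame x₀ y (coframe x₀ y v) = v :=
  Trivialization.symmL_continuousLinearMapAt _ hy v

theorem coframe_frame (hy : y ∈ (chartAt (EuclideanSpace ℝ (Fin m)) x₀).source)
    (a : EuclideanSpace ℝ (Fin m)) : coframe x₀ y (frame x₀ y a) = a :=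
  Trivialization.continuousLinearMapAt_symmL _ hy a

theorem coframe_self (v : EuclideanSpace ℝ (Fin m)) : coframe x₀ x₀ v = v := by
  have h := TangentBundle.continuousLinearMapAt_trivializationAt_eq_core (I := 𝓡 m)
    (mem_chart_source (EuclideanSpace ℝ (Fin m)) x₀)
  have := congrArg (fun L => L v) h
  exact this.trans ((tangentBundleCore (𝓡 m) M).coordChange_self _ _
    (mem_chart_source (EuclideanSpace ℝ (Fin m)) x₀) v)

theorem frame_self (v : EuclideanSpace ℝ (Fin m)) : frame x₀ x₀ v = v := by
  have := frame_coframe (mem_chart_source (EuclideanSpace ℝ (Fin m)) x₀) (v : TangentSpace (𝓡 m) x₀)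
  rwa [coframe_self] at this

theorem coframe_apply (hy : y ∈ (chartAt (EuclideanSpace ℝ (Fin m)) x₀).source)
    (v : TangentSpace (𝓡 m) y) : coframe x₀ y v =
      (trivializationAt (EuclideanSpace ℝ (Fin m)) (TangentSpace (𝓡 m) : M → Type _) x₀
        (TotalSpace.mk' _ y v)).2 := by
  exact Trivialization.continuousLinearMapAt_apply_of_mem ℝ _ hy v

theorem extend_eq_frame (hy : y ∈ (chartAt (EuclideanSpace ℝ (Fin m)) x₀).source)
    (v : TangentSpace (𝓡 m) x₀) :
    extend (EuclideanSpace ℝ (Fin m)) v y = frame x₀ y v := by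
  have h1 := coframe_apply (mem_chart_source (EuclideanSpace ℝ (Fin m)) x₀) v
  have h2 := coframe_self (x₀ := x₀) v
  rw [h2] at h1
  refine Eq.trans ?_ (Trivialization.symmL_apply (R := ℝ) (trivializationAt
    (EuclideanSpace ℝ (Fin m)) (TangentSpace (𝓡 m) : M → Type _) x₀) hy _).symm
  exact congrArg ((trivializationAt (EuclideanSpace ℝ (Fin m))
    (TangentSpace (𝓡 m) : M → Type _) x₀).symm y) h1.symm

theorem mfderiv_extChartAt (hy : y ∈ (chartAt (EuclideanSpace ℝ (Fin m)) x₀).source) :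
    HasMFDerivAt (𝓡 m) 𝓘(ℝ, EuclideanSpace ℝ (Fin m)) (extChartAt (𝓡 m) x₀) y (coframe x₀ y) := by
  have h := TangentBundle.continuousLinearMapAt_trivializationAt (I := 𝓡 m) hy
  have h1 : MDifferentiableAt (𝓡 m) 𝓘(ℝ, EuclideanSpace ℝ (Fin m)) (extChartAt (𝓡 m) x₀) y :=
    mdifferentiableAt_extChartAt hy
  have h2 := h1.hasMFDerivAt
  rw [← h] at h2
  exact h2

variable (x₀) in
/-- A function read in the chart centred at `x₀`. -/
def inChart {F : Type*} (f : M → F) (z : EuclideanSpace ℝ (Fin m)) : F :=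
  f ((extChartAt (𝓡 m) x₀).symm z)

theorem inChart_apply {F : Type*} (f : M → F)
    (hy : y ∈ (chartAt (EuclideanSpace ℝ (Fin m)) x₀).source) :
    inChart x₀ f (extChartAt (𝓡 m) x₀ y) = f y := by
  rw [inChart, (extChartAt (𝓡 m) x₀).left_inv (by rwa [extChartAt_source])]

theorem tendsto_symm (hy : y ∈ (chartAt (EuclideanSpace ℝ (Fin m)) x₀).source) :
    Tendsto (extChartAt (𝓡 m) x₀).symm (𝓝 (extChartAt (𝓡 m) x₀ y)) (𝓝 y) := by
  have h : y ∈ (extChartAt (𝓡 m) x₀).source := by rwa [extChartAt_source]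
  have := continuousAt_extChartAt_symm' h
  rwa [ContinuousAt, (extChartAt (𝓡 m) x₀).left_inv h] at this

variable {F : Type*} [NormedAddCommGroup F] [NormedSpace ℝ F]

theorem contDiffAt_inChart {f : M → F} {k : ℕ∞ω} (hk : k ≤ ∞)
    (hy : y ∈ (chartAt (EuclideanSpace ℝ (Fin m)) x₀).source)
    (hf : ContMDiffAt (𝓡 m) 𝓘(ℝ, F) k f y) :
    ContDiffAt ℝ k (inChart x₀ f) (extChartAt (𝓡 m) x₀ y) := by
  have h : y ∈ (extChartAt (𝓡 m) x₀).source := by rwa [extChartAt_source]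
  have h1 : ContMDiffAt 𝓘(ℝ, EuclideanSpace ℝ (Fin m)) (𝓡 m) k (extChartAt (𝓡 m) x₀).symm
      (extChartAt (𝓡 m) x₀ y) := by
    have := (contMDiffOn_extChartAt_symm (I := 𝓡 m) (n := ∞) x₀).contMDiffAt
      (extChartAt_target_mem_nhds' ((extChartAt (𝓡 m) x₀).map_source h))
    exact this.of_le hk
  have h2 : ContMDiffAt (𝓡 m) 𝓘(ℝ, F) k f ((extChartAt (𝓡 m) x₀).symm (extChartAt (𝓡 m) x₀ y)) := by
    rwa [(extChartAt (𝓡 m) x₀).left_inv h]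
  exact (h2.comp _ h1).contDiffAt

theorem differentiableAt_inChart {f : M → F}
    (hy : y ∈ (chartAt (EuclideanSpace ℝ (Fin m)) x₀).source)
    (hf : MDifferentiableAt (𝓡 m) 𝓘(ℝ, F) f y) :
    DifferentiableAt ℝ (inChart x₀ f) (extChartAt (𝓡 m) x₀ y) := by
  have h : y ∈ (extChartAt (𝓡 m) x₀).source := by rwa [extChartAt_source]
  have h1 : MDifferentiableAt 𝓘(ℝ, EuclideanSpace ℝ (Fin m)) (𝓡 m) (extChartAt (𝓡 m) x₀).symm
      (extChartAt (𝓡 m) x₀ y) := by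
    have := (contMDiffOn_extChartAt_symm (I := 𝓡 m) (n := ∞) x₀).contMDiffAt
      (extChartAt_target_mem_nhds' ((extChartAt (𝓡 m) x₀).map_source h))
    exact this.mdifferentiableAt (by simp)
  have h2 : MDifferentiableAt (𝓡 m) 𝓘(ℝ, F) f
      ((extChartAt (𝓡 m) x₀).symm (extChartAt (𝓡 m) x₀ y)) := by
    rwa [(extChartAt (𝓡 m) x₀).left_inv h]
  exact (h2.comp _ h1).differentiableAt

theorem hasMFDerivAt_of_inChart {f : M → F}
    (hy : y ∈ (chartAt (EuclideanSpace ℝ (Fin m)) x₀).source)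
    (hf : DifferentiableAt ℝ (inChart x₀ f) (extChartAt (𝓡 m) x₀ y)) :
    HasMFDerivAt (𝓡 m) 𝓘(ℝ, F) f y
      ((fderiv ℝ (inChart x₀ f) (extChartAt (𝓡 m) x₀ y)).comp (coframe x₀ y)) := by
  have h1 := HasMFDerivAt.comp y hf.hasFDerivAt.hasMFDerivAt (mfderiv_extChartAt hy)
  refine h1.congr_of_eventuallyEq ?_
  filter_upwards [(chartAt (EuclideanSpace ℝ (Fin m)) x₀).open_source.mem_nhds hy] with y' hy'
  exact (inChart_apply f hy').symm

theorem mdifferentiableAt_iff_inChart {f : M → F}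
    (hy : y ∈ (chartAt (EuclideanSpace ℝ (Fin m)) x₀).source) :
    MDifferentiableAt (𝓡 m) 𝓘(ℝ, F) f y ↔
      DifferentiableAt ℝ (inChart x₀ f) (extChartAt (𝓡 m) x₀ y) :=
  ⟨differentiableAt_inChart hy, fun h => (hasMFDerivAt_of_inChart hy h).mdifferentiableAt⟩

/-- The derivative of a function is the derivative of its coordinate expression. -/
theorem mvfderiv_frame {f : M → F}
    (hy : y ∈ (chartAt (EuclideanSpace ℝ (Fin m)) x₀).source)
    (hf : DifferentiableAt ℝ (inChart x₀ f) (extChartAt (𝓡 m) x₀ y)) (a : EuclideanSpace ℝ (Fin m)) :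
    mvfderiv (𝓡 m) f y (frame x₀ y a) = fderiv ℝ (inChart x₀ f) (extChartAt (𝓡 m) x₀ y) a := by
  have h := (hasMFDerivAt_of_inChart hy hf).mfderiv
  have h2 : mvfderiv (𝓡 m) f y (frame x₀ y a) = mfderiv (𝓡 m) 𝓘(ℝ, F) f y (frame x₀ y a) := rfl
  rw [h2, h]
  have h3 := coframe_frame hy a
  exact congrArg (fderiv ℝ (inChart x₀ f) (extChartAt (𝓡 m) x₀ y)) h3

end Charts

/-! ### Coordinate expressions of vector fields, forms and metrics -/

theorem contDiffAt_clm_of_apply {D V W : Type*} [NormedAddCommGroup D] [NormedSpace ℝ D]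
    [NormedAddCommGroup V] [NormedSpace ℝ V] [FiniteDimensional ℝ V] [NormedAddCommGroup W]
    [NormedSpace ℝ W] {k : ℕ∞ω} {f : D → V →L[ℝ] W} {z : D}
    (h : ∀ v, ContDiffAt ℝ k (fun x => f x v) z) : ContDiffAt ℝ k f z := by
  let d := Module.finrank ℝ V
  have hd : d = Module.finrank ℝ (Fin d → ℝ) := (Module.finrank_fin_fun ℝ).symm
  let e₁ := ContinuousLinearEquiv.ofFinrankEq hd
  let e₂ := (e₁.arrowCongr (1 : W ≃L[ℝ] W)).trans (ContinuousLinearEquiv.piRing (Fin d))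
  rw [← Function.id_comp f, ← e₂.symm_comp_self]
  exact e₂.symm.contDiff.contDiffAt.comp z (contDiffAt_pi.mpr fun i => h _)

section Charts
variable {m : ℕ} {M : Type*} [TopologicalSpace M] [ChartedSpace (EuclideanSpace ℝ (Fin m)) M]
  [IsManifold (𝓡 m) ∞ M] {x₀ y : M}

variable (x₀) in
/-- The coordinates of a vector field in the chart centred at `x₀`. -/
def localField (Y : Π y : M, TangentSpace (𝓡 m) y) (z : EuclideanSpace ℝ (Fin m)) :
    EuclideanSpace ℝ (Fin m) :=
  inChart x₀ (fun y => coframe x₀ y (Y y)) z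

variable (x₀) in
/-- The coordinate expression of a `1`-form in the chart centred at `x₀`. -/
def localForm (θ : Π y : M, TangentSpace (𝓡 m) y →L[ℝ] ℝ) (z : EuclideanSpace ℝ (Fin m)) :
    EuclideanSpace ℝ (Fin m) →L[ℝ] ℝ :=
  inChart x₀ (fun y => (θ y).comp (frame x₀ y)) z

variable (x₀) in
/-- The coordinate expression of a metric in the chart centred at `x₀`. -/
def localMetric (g : Metric m M) (z : EuclideanSpace ℝ (Fin m)) :
    EuclideanSpace ℝ (Fin m) →L[ℝ] EuclideanSpace ℝ (Fin m) →L[ℝ] ℝ :=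
  inChart x₀ (fun y =>
    (ContinuousLinearMap.precomp ℝ (frame x₀ y)).comp ((g.inner y).comp (frame x₀ y))) z

theorem contMDiffAt_frame (hy : y ∈ (chartAt (EuclideanSpace ℝ (Fin m)) x₀).source)
    (a : EuclideanSpace ℝ (Fin m)) :
    ContMDiffAt (𝓡 m) ((𝓡 m).prod 𝓘(ℝ, EuclideanSpace ℝ (Fin m))) ∞
      (fun y => TotalSpace.mk' (EuclideanSpace ℝ (Fin m)) y (frame x₀ y a)) y := by
  have h := (trivializationAt (EuclideanSpace ℝ (Fin m)) (TangentSpace (𝓡 m) : M → Type _)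
    x₀).contMDiffAt_section_iff (IB := 𝓡 m) (n := ∞) (s := fun y => frame x₀ y a) (x₀ := y) hy
  rw [h]
  refine (contMDiffAt_const (c := a)).congr_of_eventuallyEq ?_
  filter_upwards [(chartAt (EuclideanSpace ℝ (Fin m)) x₀).open_source.mem_nhds hy] with y' hy'
  rw [← coframe_apply hy', coframe_frame hy']

theorem mdifferentiableAt_frame (hy : y ∈ (chartAt (EuclideanSpace ℝ (Fin m)) x₀).source)
    (a : EuclideanSpace ℝ (Fin m)) :
    MDifferentiableAt (𝓡 m) ((𝓡 m).prod 𝓘(ℝ, EuclideanSpace ℝ (Fin m)))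
      (fun y => TotalSpace.mk' (EuclideanSpace ℝ (Fin m)) y (frame x₀ y a)) y :=
  (contMDiffAt_frame hy a).mdifferentiableAt (by simp)

theorem mdifferentiableAt_field_iff {Y : Π y : M, TangentSpace (𝓡 m) y}
    (hy : y ∈ (chartAt (EuclideanSpace ℝ (Fin m)) x₀).source) :
    MDifferentiableAt (𝓡 m) ((𝓡 m).prod 𝓘(ℝ, EuclideanSpace ℝ (Fin m)))
      (fun y => TotalSpace.mk' (EuclideanSpace ℝ (Fin m)) y (Y y)) y ↔
    DifferentiableAt ℝ (localField x₀ Y) (extChartAt (𝓡 m) x₀ y) := by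
  have h := (trivializationAt (EuclideanSpace ℝ (Fin m)) (TangentSpace (𝓡 m) : M → Type _)
    x₀).mdifferentiableAt_section_iff (𝓡 m) Y hy
  rw [h]
  have h2 : (fun y => (trivializationAt (EuclideanSpace ℝ (Fin m)) (TangentSpace (𝓡 m)) x₀
      (TotalSpace.mk' _ y (Y y))).2) =ᶠ[𝓝 y] fun y => coframe x₀ y (Y y) := by
    filter_upwards [(chartAt (EuclideanSpace ℝ (Fin m)) x₀).open_source.mem_nhds hy] with y' hy'
    rw [coframe_apply hy']
  exact h2.mdifferentiableAt_iff.trans (mdifferentiableAt_iff_inChart hy)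

theorem contDiffAt_localMetric (g : Metric m M) (x₀ : M) :
    ContDiffAt ℝ ∞ (localMetric x₀ g) (extChartAt (𝓡 m) x₀ x₀) := by
  have hx := mem_chart_source (EuclideanSpace ℝ (Fin m)) x₀
  refine contDiffAt_clm_of_apply fun a => contDiffAt_clm_of_apply fun b => ?_
  refine contDiffAt_inChart le_rfl hx (f := fun y => g.inner y (frame x₀ y a) (frame x₀ y b)) ?_
  have h := ContMDiffAt.clm_bundle_apply₂ (F₁ := EuclideanSpace ℝ (Fin m))
    (F₂ := EuclideanSpace ℝ (Fin m)) (F₃ := ℝ) (E₃ := fun _ : M => ℝ)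
    (g.contMDiff x₀) (contMDiffAt_frame hx a) (contMDiffAt_frame hx b)
  exact (contMDiffAt_section x₀).1 h

end Charts

/-! ### Christoffel symbols -/

section Charts
variable {m : ℕ} {M : Type*} [TopologicalSpace M] [ChartedSpace (EuclideanSpace ℝ (Fin m)) M]
  [IsManifold (𝓡 m) ∞ M] {x₀ y : M}

/-- Coordinate fields commute, being pulled back from constant vector fields by the chart. -/
theorem mlieBracket_frame (hy : y ∈ (chartAt (EuclideanSpace ℝ (Fin m)) x₀).source)
    (a b : EuclideanSpace ℝ (Fin m)) :
    VectorField.mlieBracket (𝓡 m) (fun y => frame x₀ y a) (fun y => frame x₀ y b) y = 0 := by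
  have key : ∀ c : EuclideanSpace ℝ (Fin m), (fun y => frame x₀ y c) =ᶠ[𝓝 y]
      VectorField.mpullback (𝓡 m) 𝓘(ℝ, EuclideanSpace ℝ (Fin m)) (extChartAt (𝓡 m) x₀)
        (fun _ => c) := by
    intro c
    filter_upwards [(chartAt (EuclideanSpace ℝ (Fin m)) x₀).open_source.mem_nhds hy] with y' hy'
    have e1 := (mfderiv_extChartAt (M := M) (x₀ := x₀) hy').mfderiv
    have : (coframe (m := m) x₀ y').inverse = frame x₀ y' := by
      refine ContinuousLinearMap.inverse_eq ?_ ?_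
      · ext1 v; exact coframe_frame hy' v
      · ext1 v; exact frame_coframe hy' v
    have e2 : (mfderiv (𝓡 m) 𝓘(ℝ, EuclideanSpace ℝ (Fin m)) (extChartAt (𝓡 m) x₀) y').inverse =
        frame x₀ y' := (congrArg ContinuousLinearMap.inverse e1).trans this
    exact (congrArg (fun L => L c) e2).symm
  rw [Filter.EventuallyEq.mlieBracket_vectorField_eq (key a) (key b)]
  have hc : ∀ c : EuclideanSpace ℝ (Fin m), ContMDiffAt 𝓘(ℝ, EuclideanSpace ℝ (Fin m))
      (𝓘(ℝ, EuclideanSpace ℝ (Fin m)).prod 𝓘(ℝ, EuclideanSpace ℝ (Fin m))) ∞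
      (fun z => (TotalSpace.mk' (EuclideanSpace ℝ (Fin m)) z c :
        TangentBundle 𝓘(ℝ, EuclideanSpace ℝ (Fin m)) (EuclideanSpace ℝ (Fin m))))
      (extChartAt (𝓡 m) x₀ y) := by
    intro c
    exact contMDiffAt_vectorSpace_iff_contDiffAt.2 contDiffAt_const
  have : IsManifold (𝓡 m) (minSmoothness ℝ 2) M :=
    IsManifold.of_le (n := ∞) (by rw [minSmoothness_of_isRCLikeNormedField]; exact two_le_infty)
  rw [← VectorField.mpullback_mlieBracket (n := ∞)
    ((hc a).mdifferentiableAt (by simp)) ((hc b).mdifferentiableAt (by simp))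
    (contMDiffAt_extChartAt' hy)
    (by rw [minSmoothness_of_isRCLikeNormedField]; exact two_le_infty)]
  have hb : ∀ V W : Π z : EuclideanSpace ℝ (Fin m),
      TangentSpace 𝓘(ℝ, EuclideanSpace ℝ (Fin m)) z, ∀ z,
      VectorField.mlieBracket 𝓘(ℝ, EuclideanSpace ℝ (Fin m)) V W z =
        VectorField.lieBracketWithin ℝ V W Set.univ z := fun V W z => by
    rw [← VectorField.mlieBracketWithin_univ, VectorField.mlieBracketWithin_eq_lieBracketWithin]
  have h0 : VectorField.lieBracketWithin ℝ (fun _ : EuclideanSpace ℝ (Fin m) => a) (fun _ => b)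
      Set.univ (extChartAt (𝓡 m) x₀ y) = 0 := by
    simp [VectorField.lieBracket]
  exact (congrArg (mfderiv (𝓡 m) 𝓘(ℝ, EuclideanSpace ℝ (Fin m)) (extChartAt (𝓡 m) x₀) y).inverse
    ((hb _ _ _).trans h0)).trans (map_zero _)

/-- The local extension of a tangent vector used in the definition of the curvature is, near `x₀`, the
vector field with constant coordinates. -/
theorem extend_eventuallyEq_frame (x₀ : M) (v : TangentSpace (𝓡 m) x₀) :
    (extend (x := x₀) (EuclideanSpace ℝ (Fin m)) v : Π y : M, TangentSpace (𝓡 m) y) =ᶠ[𝓝 x₀]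
      fun y => frame x₀ y v := by
  filter_upwards [eventually_mem_source (m := m) x₀] with y hy
    using extend_eq_frame hy v

/-- The Christoffel symbols of an operator on vector fields, in the chart centred at `x₀`: near `x₀`
it is given by `(∂_a Yⁱ) + Γ(a, Y)ⁱ`, where `Γ` is smooth and symmetric. -/
structure HasChristoffel (cov : ConnOp m M) (x₀ : M)
    (Γ : EuclideanSpace ℝ (Fin m) → EuclideanSpace ℝ (Fin m) →L[ℝ]
      EuclideanSpace ℝ (Fin m) →L[ℝ] EuclideanSpace ℝ (Fin m)) : Prop where
  contDiffAt : ContDiffAt ℝ ∞ Γ (extChartAt (𝓡 m) x₀ x₀)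
  symm : ∀ᶠ z in 𝓝 (extChartAt (𝓡 m) x₀ x₀), ∀ a b, Γ z a b = Γ z b a
  eq : ∀ᶠ y in 𝓝 x₀, ∀ Y : Π y : M, TangentSpace (𝓡 m) y,
    MDifferentiableAt (𝓡 m) ((𝓡 m).prod 𝓘(ℝ, EuclideanSpace ℝ (Fin m)))
      (fun y => TotalSpace.mk' (EuclideanSpace ℝ (Fin m)) y (Y y)) y →
    ∀ a, coframe x₀ y (cov Y y (frame x₀ y a)) =
      fderiv ℝ (localField x₀ Y) (extChartAt (𝓡 m) x₀ y) a
        + Γ (extChartAt (𝓡 m) x₀ y) a (coframe x₀ y (Y y))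

theorem localField_eventuallyEq {Y : Π y : M, TangentSpace (𝓡 m) y}
    {W : M → EuclideanSpace ℝ (Fin m)}
    (hy : y ∈ (chartAt (EuclideanSpace ℝ (Fin m)) x₀).source)
    (h : ∀ᶠ y' in 𝓝 y, coframe x₀ y' (Y y') = W y') :
    localField x₀ Y =ᶠ[𝓝 (extChartAt (𝓡 m) x₀ y)] inChart x₀ W :=
  (tendsto_symm hy).eventually h

theorem localField_frame_eventuallyEq {Y : Π y : M, TangentSpace (𝓡 m) y}
    (hy : y ∈ (chartAt (EuclideanSpace ℝ (Fin m)) x₀).source) {b : EuclideanSpace ℝ (Fin m)}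
    (h : ∀ᶠ y' in 𝓝 y, Y y' = frame x₀ y' b) :
    localField x₀ Y =ᶠ[𝓝 (extChartAt (𝓡 m) x₀ y)] fun _ => b := by
  refine localField_eventuallyEq (W := fun _ => b) hy ?_
  filter_upwards [h, (chartAt (EuclideanSpace ℝ (Fin m)) x₀).open_source.mem_nhds hy] with y' h1 h2
  rw [h1, coframe_frame h2]

variable {cov : ConnOp m M} {Γ : EuclideanSpace ℝ (Fin m) → EuclideanSpace ℝ (Fin m) →L[ℝ]
      EuclideanSpace ℝ (Fin m) →L[ℝ] EuclideanSpace ℝ (Fin m)}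

/-- Covariant derivatives of the coordinate frame. -/
theorem HasChristoffel.cov_frame (h : HasChristoffel cov x₀ Γ) :
    ∀ᶠ y in 𝓝 x₀, ∀ (Y : Π y : M, TangentSpace (𝓡 m) y) (b : EuclideanSpace ℝ (Fin m)),
      (∀ᶠ y' in 𝓝 y, Y y' = frame x₀ y' b) → ∀ a,
      coframe x₀ y (cov Y y (frame x₀ y a)) = Γ (extChartAt (𝓡 m) x₀ y) a b := by
  filter_upwards [h.eq, eventually_mem_source (m := m) x₀] with y hy hs Y b hb a
  have hY := localField_frame_eventuallyEq hs hb
  rw [hy Y ((mdifferentiableAt_field_iff hs).2 (hY.differentiableAt_iff.2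
    (differentiableAt_const b))) a, hY.fderiv_eq, hb.self_of_nhds, coframe_frame hs]
  simp

/-- The covariant derivative of `∇_v w` for coordinate fields `v` and `w`. -/
theorem HasChristoffel.cov_cov (h : HasChristoffel cov x₀ Γ) (u v w : EuclideanSpace ℝ (Fin m))
    {V W : Π y : M, TangentSpace (𝓡 m) y} (hV : ∀ᶠ y in 𝓝 x₀, V y = frame x₀ y v)
    (hW : ∀ᶠ y in 𝓝 x₀, W y = frame x₀ y w) :
    cov (fun y => cov W y (V y)) x₀ u =
      fderiv ℝ Γ (extChartAt (𝓡 m) x₀ x₀) u v w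
        + Γ (extChartAt (𝓡 m) x₀ x₀) u (Γ (extChartAt (𝓡 m) x₀ x₀) v w) := by
  have hx := mem_chart_source (EuclideanSpace ℝ (Fin m)) x₀
  have h1 : localField x₀ (fun y => cov W y (V y)) =ᶠ[𝓝 (extChartAt (𝓡 m) x₀ x₀)]
      fun z => Γ z v w := by
    have h2 : ∀ᶠ y in 𝓝 x₀, coframe x₀ y (cov W y (V y)) = Γ (extChartAt (𝓡 m) x₀ y) v w := by
      filter_upwards [h.cov_frame, hV, hW.eventually_nhds] with y h1 h2 h3
      rw [h2]
      exact h1 W w h3 v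
    filter_upwards [localField_eventuallyEq hx h2, eventually_right_inv x₀] with z h3 h4
    rw [h3, inChart, h4]
  have h3 := h.contDiffAt.differentiableAt_infty
  have h4 := h.eq.self_of_nhds (fun y => cov W y (V y)) ((mdifferentiableAt_field_iff hx).2
    (h1.differentiableAt_iff.2 ((h3.clm_apply (differentiableAt_const v)).clm_apply
      (differentiableAt_const w)))) u
  have h5 : frame x₀ x₀ u = u := frame_self u
  have h7 : coframe x₀ x₀ (cov (fun y => cov W y (V y)) x₀ (frame x₀ x₀ u)) =
      cov (fun y => cov W y (V y)) x₀ u :=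
    (coframe_self _).trans (congrArg (cov (fun y => cov W y (V y)) x₀) h5)
  refine (h7.symm.trans h4).trans ?_
  rw [h1.fderiv_eq]
  have h6 := h.cov_frame.self_of_nhds W w hW v
  rw [← hV.self_of_nhds] at h6
  rw [h6, fderiv_clm_apply (h3.clm_apply (differentiableAt_const v)) (differentiableAt_const w),
    fderiv_clm_apply h3 (differentiableAt_const v)]
  simp

theorem curv_eq_localCurv (h : HasChristoffel cov x₀ Γ) (u v w : EuclideanSpace ℝ (Fin m)) :
    curv cov x₀ u v w = localCurv Γ (extChartAt (𝓡 m) x₀ x₀) u v w := by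
  have hx := mem_chart_source (EuclideanSpace ℝ (Fin m)) x₀
  have e := extend_eventuallyEq_frame (m := m) x₀
  simp only [curv]
  rw [Filter.EventuallyEq.mlieBracket_vectorField_eq (e u) (e v), mlieBracket_frame hx, map_zero,
    sub_zero]
  refine (congrArg₂ (· - ·) (h.cov_cov u v w (e v) (e w)) (h.cov_cov v u w (e u) (e w))).trans ?_
  simp only [localCurv]
  abel

theorem ric_eq_localRic (h : HasChristoffel cov x₀ Γ) (u v : EuclideanSpace ℝ (Fin m)) :
    ric cov x₀ u v = localRic (EuclideanSpace.basisFun (Fin m) ℝ).toBasis Γ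
      (extChartAt (𝓡 m) x₀ x₀) u v := by
  simp only [ric, localRic]
  exact congrArg (traceEnd (EuclideanSpace.basisFun (Fin m) ℝ).toBasis)
    (funext fun w => curv_eq_localCurv h w u v)

theorem faraday_eq_localFaraday (h : HasChristoffel cov x₀ Γ) (u v : EuclideanSpace ℝ (Fin m)) :
    faraday cov x₀ u v = localFaraday (EuclideanSpace.basisFun (Fin m) ℝ).toBasis Γ
      (extChartAt (𝓡 m) x₀ x₀) u v := by
  simp only [faraday, localFaraday]
  exact congrArg (fun T => (1 / m : ℝ) * traceEnd (EuclideanSpace.basisFun (Fin m) ℝ).toBasis T)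
    (funext fun w => curv_eq_localCurv h u v w)

theorem localMetric_self (g : Metric m M) (u v : EuclideanSpace ℝ (Fin m)) :
    localMetric x₀ g (extChartAt (𝓡 m) x₀ x₀) u v = g.inner x₀ u v := by
  have h := inChart_apply (fun y => g.inner y (frame x₀ y u) (frame x₀ y v))
    (mem_chart_source (EuclideanSpace ℝ (Fin m)) x₀)
  refine Eq.trans h ?_
  exact congrArg₂ (fun a b => g.inner x₀ a b) (frame_self u) (frame_self v)

theorem trg_eq (g : Metric m M) (B : EuclideanSpace ℝ (Fin m) → EuclideanSpace ℝ (Fin m) → ℝ) :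
    trg g x₀ B = traceWith (EuclideanSpace.basisFun (Fin m) ℝ).toBasis
      (fun u v => localMetric x₀ g (extChartAt (𝓡 m) x₀ x₀) u v) B := by
  simp only [localMetric_self]
  rfl

theorem scal_eq (h : HasChristoffel cov x₀ Γ) (g : Metric m M) :
    scal g cov x₀ = traceWith (EuclideanSpace.basisFun (Fin m) ℝ).toBasis
      (fun u v => localMetric x₀ g (extChartAt (𝓡 m) x₀ x₀) u v)
      (localRic (EuclideanSpace.basisFun (Fin m) ℝ).toBasis Γ (extChartAt (𝓡 m) x₀ x₀)) := by
  refine (trg_eq g _).trans ?_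
  congr 1
  funext u v
  exact ric_eq_localRic h u v

theorem localForm_self (θ : Π y : M, TangentSpace (𝓡 m) y →L[ℝ] ℝ) (u : EuclideanSpace ℝ (Fin m)) :
    localForm x₀ θ (extChartAt (𝓡 m) x₀ x₀) u = θ x₀ u := by
  have h := inChart_apply (fun y => θ y (frame x₀ y u))
    (mem_chart_source (EuclideanSpace ℝ (Fin m)) x₀)
  refine Eq.trans h ?_
  exact congrArg (θ x₀) (frame_self u)

theorem contDiffAt_localForm_apply {θ : Π y : M, TangentSpace (𝓡 m) y →L[ℝ] ℝ}
    (hθ : ContDiffAt ℝ ∞ (localForm x₀ θ) (extChartAt (𝓡 m) x₀ x₀)) (v : EuclideanSpace ℝ (Fin m)) :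
    DifferentiableAt ℝ (fun z => localForm x₀ θ z v) (extChartAt (𝓡 m) x₀ x₀) :=
  hθ.differentiableAt_infty.clm_apply (differentiableAt_const v)

/-- The Hessian is given by the usual coordinate formula. -/
theorem hess_eq_localHess (h : HasChristoffel cov x₀ Γ) (k : ℝ) (g : Metric m M) {l : M → ℝ}
    (hl : ContMDiff (𝓡 m) 𝓘(ℝ) ∞ l)
    (hθ : ContDiffAt ℝ ∞ (localForm x₀ (leeForm g cov)) (extChartAt (𝓡 m) x₀ x₀))
    (u v : EuclideanSpace ℝ (Fin m)) :
    hess k g cov l x₀ u v = localHess k Γ (localForm x₀ (leeForm g cov)) (inChart x₀ l)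
      (extChartAt (𝓡 m) x₀ x₀) u v := by
  have hx := mem_chart_source (EuclideanSpace ℝ (Fin m)) x₀
  have hl' : ContDiffAt ℝ ∞ (inChart x₀ l) (extChartAt (𝓡 m) x₀ x₀) :=
    contDiffAt_inChart le_rfl hx (hl x₀)
  have e := extend_eventuallyEq_frame (m := m) x₀
  have hd : ∀ w : EuclideanSpace ℝ (Fin m), densCov k g cov l x₀ w =
      fderiv ℝ (inChart x₀ l) (extChartAt (𝓡 m) x₀ x₀) w + k * inChart x₀ l (extChartAt (𝓡 m) x₀ x₀)
        * localForm x₀ (leeForm g cov) (extChartAt (𝓡 m) x₀ x₀) w := by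
    intro w
    have h1 := mvfderiv_frame hx hl'.differentiableAt_infty w
    have h2 : mvfderiv (𝓡 m) l x₀ w = fderiv ℝ (inChart x₀ l) (extChartAt (𝓡 m) x₀ x₀) w :=
      (congrArg (mvfderiv (𝓡 m) l x₀) (frame_self w)).symm.trans h1
    rw [localForm_self, inChart_apply l hx, ← h2]
    rfl
  have hD : inChart x₀ (fun y => densCov k g cov l y
        ((extend (x := x₀) (EuclideanSpace ℝ (Fin m)) v : Π y : M, TangentSpace (𝓡 m) y) y))
      =ᶠ[𝓝 (extChartAt (𝓡 m) x₀ x₀)] fun z => fderiv ℝ (inChart x₀ l) z v + k * inChart x₀ l z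
        * localForm x₀ (leeForm g cov) z v := by
    have h1 : ∀ᶠ y in 𝓝 x₀, densCov k g cov l y
        ((extend (x := x₀) (EuclideanSpace ℝ (Fin m)) v : Π y : M, TangentSpace (𝓡 m) y) y) =
        fderiv ℝ (inChart x₀ l) (extChartAt (𝓡 m) x₀ y) v + k * l y *
          leeForm g cov y (frame x₀ y v) := by
      filter_upwards [eventually_mem_source (m := m) x₀, e v] with y hy h1
      have h2 := mvfderiv_frame hy ((contDiffAt_inChart le_rfl hy (hl y)).differentiableAt_infty) v
      rw [h1, ← h2]
      rfl
    filter_upwards [(tendsto_symm hx).eventually h1, eventually_right_inv x₀] with z h3 h4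
    rw [inChart, h3, h4]
    rfl
  have hdiff : DifferentiableAt ℝ (fun z => fderiv ℝ (inChart x₀ l) z v + k * inChart x₀ l z
        * localForm x₀ (leeForm g cov) z v) (extChartAt (𝓡 m) x₀ x₀) := by
    have h1 := (hl'.fderiv_right (m := ∞) (by simp)).differentiableAt_infty.clm_apply
      (differentiableAt_const v)
    exact h1.add ((hl'.differentiableAt_infty.const_mul k).mul (contDiffAt_localForm_apply hθ v))
  have h1 := mvfderiv_frame hx (hD.differentiableAt_iff.2 hdiff) u
  have h2 := h.cov_frame.self_of_nhds _ v (e v) u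
  have h3 : cov (extend (x := x₀) (EuclideanSpace ℝ (Fin m)) v) x₀ u =
      Γ (extChartAt (𝓡 m) x₀ x₀) u v :=
    ((congrArg (cov (extend (x := x₀) (EuclideanSpace ℝ (Fin m)) v) x₀) (frame_self u)).symm.trans
      (coframe_self _).symm).trans h2
  rw [hD.fderiv_eq] at h1
  have h4 := (congrArg (mvfderiv (𝓡 m) (fun y => densCov k g cov l y
        ((extend (x := x₀) (EuclideanSpace ℝ (Fin m)) v : Π y : M, TangentSpace (𝓡 m) y) y)) x₀)
        (frame_self u)).symm.trans h1
  simp only [hess, localHess]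
  refine congrArg₂ (· - ·) (congrArg₂ (· + ·) h4 ?_) ?_
  · exact congrArg₂ (fun a b => k * a * b) (localForm_self _ u).symm (hd v)
  · exact (congrArg (densCov k g cov l x₀) h3).trans (hd _)

end Charts

/-! ### Torsion-free connections in charts -/

section Charts
variable {m : ℕ} {M : Type*} [TopologicalSpace M] [ChartedSpace (EuclideanSpace ℝ (Fin m)) M]
  [IsManifold (𝓡 m) ∞ M] {x₀ y : M}

theorem contMDiffAt_coframe_apply {Y : Π y : M, TangentSpace (𝓡 m) y}
    (hy : y ∈ (chartAt (EuclideanSpace ℝ (Fin m)) x₀).source)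
    (hY : ContMDiffAt (𝓡 m) ((𝓡 m).prod 𝓘(ℝ, EuclideanSpace ℝ (Fin m))) ∞
      (fun y => TotalSpace.mk' (EuclideanSpace ℝ (Fin m)) y (Y y)) y) :
    ContMDiffAt (𝓡 m) 𝓘(ℝ, EuclideanSpace ℝ (Fin m)) ∞ (fun y => coframe x₀ y (Y y)) y := by
  have h := ((trivializationAt (EuclideanSpace ℝ (Fin m)) (TangentSpace (𝓡 m) : M → Type _)
    x₀).contMDiffAt_section_iff (IB := 𝓡 m) (n := ∞) (s := Y) (x₀ := y) hy).1 hY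
  refine h.congr_of_eventuallyEq ?_
  filter_upwards [(chartAt (EuclideanSpace ℝ (Fin m)) x₀).open_source.mem_nhds hy] with y' hy'
  exact coframe_apply hy' _

/-- A coordinate field can be extended to a global smooth vector field. -/
theorem exists_contMDiff_eventuallyEq_frame [T2Space M] (x₀ : M) (a : EuclideanSpace ℝ (Fin m)) :
    ∃ Y : Π y : M, TangentSpace (𝓡 m) y,
      ContMDiff (𝓡 m) ((𝓡 m).prod 𝓘(ℝ, EuclideanSpace ℝ (Fin m))) ∞
        (fun y => TotalSpace.mk' (EuclideanSpace ℝ (Fin m)) y (Y y)) ∧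
      ∀ᶠ y in 𝓝 x₀, Y y = frame x₀ y a := by
  obtain ⟨f⟩ : Nonempty (SmoothBumpFunction (𝓡 m) x₀) := inferInstance
  refine ⟨(f : M → ℝ) • fun y => frame x₀ y a, ?_, ?_⟩
  · refine ContMDiffOn.smul_section_of_tsupport (f.contMDiff.contMDiffOn)
      (chartAt (EuclideanSpace ℝ (Fin m)) x₀).open_source f.tsupport_subset_chartAt_source ?_
    intro y hy
    exact (contMDiffAt_frame hy a).contMDiffWithinAt
  · filter_upwards [f.eventuallyEq_one] with y hy
    rw [Pi.smul_apply', hy, Pi.one_apply, one_smul]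

theorem sum_frame (hy : y ∈ (chartAt (EuclideanSpace ℝ (Fin m)) x₀).source)
    (v : TangentSpace (𝓡 m) y) :
    v = ∑ i, (coframe x₀ y v) i • frame x₀ y (EuclideanSpace.basisFun (Fin m) ℝ i) := by
  have h := (EuclideanSpace.basisFun (Fin m) ℝ).sum_repr (coframe x₀ y v)
  conv_lhs => rw [← frame_coframe hy v, ← h, map_sum]
  simp

/-- The Leibniz rule for a combination of vector fields. -/
theorem cov_sum {cov : CovariantDerivative (𝓡 m) (EuclideanSpace ℝ (Fin m))
      (TangentSpace (𝓡 m) : M → Type _)} {ι : Type*} (s : Finset ι) {f : ι → M → ℝ}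
    {Y : ι → Π y : M, TangentSpace (𝓡 m) y}
    (hf : ∀ i, MDifferentiableAt (𝓡 m) 𝓘(ℝ) (f i) y)
    (hY : ∀ i, MDifferentiableAt (𝓡 m) ((𝓡 m).prod 𝓘(ℝ, EuclideanSpace ℝ (Fin m)))
      (fun y => TotalSpace.mk' (EuclideanSpace ℝ (Fin m)) y (Y i y)) y) :
    MDifferentiableAt (𝓡 m) ((𝓡 m).prod 𝓘(ℝ, EuclideanSpace ℝ (Fin m)))
      (fun y => TotalSpace.mk' (EuclideanSpace ℝ (Fin m)) y ((∑ i ∈ s, f i • Y i) y)) y ∧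
    ∀ v, cov (∑ i ∈ s, f i • Y i) y v =
      ∑ i ∈ s, (f i y • cov (Y i) y v + mvfderiv (𝓡 m) (f i) y v • Y i y) := by
  classical
  induction s using Finset.induction_on with
  | empty =>
    refine ⟨?_, fun v => ?_⟩
    · exact (mdifferentiable_zeroSection ℝ (TangentSpace (𝓡 m) : M → Type _)) y
    · simp [cov.zero]
  | insert i s hi ih =>
    have h1 := (hf i).smul_section (hY i)
    simp only [Finset.sum_insert hi]
    refine ⟨mdifferentiableAt_add_section h1 ih.1, fun v => ?_⟩
    rw [cov.isCovariantDerivativeOnUniv.add h1 ih.1,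
      cov.isCovariantDerivativeOnUniv.leibniz (hY i) (hf i)]
    have := ih.2 v
    simp [this]

/-- The Christoffel symbols of a connection, in the chart centred at `x₀`. -/
def christoffel (cov : ConnOp m M) (x₀ : M) (z : EuclideanSpace ℝ (Fin m)) :
    EuclideanSpace ℝ (Fin m) →L[ℝ] EuclideanSpace ℝ (Fin m) →L[ℝ] EuclideanSpace ℝ (Fin m) :=
  inChart x₀ (fun y => ContinuousLinearMap.flip (∑ i, (EuclideanSpace.proj i).smulRight
    ((coframe x₀ y).comp ((cov (fun y => frame x₀ y (EuclideanSpace.basisFun (Fin m) ℝ i)) y).comp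
      (frame x₀ y))))) z

theorem christoffel_apply (cov : ConnOp m M)
    (hy : y ∈ (chartAt (EuclideanSpace ℝ (Fin m)) x₀).source) (a b : EuclideanSpace ℝ (Fin m)) :
    christoffel cov x₀ (extChartAt (𝓡 m) x₀ y) a b = ∑ i, b i • coframe x₀ y
      (cov (fun y => frame x₀ y (EuclideanSpace.basisFun (Fin m) ℝ i)) y (frame x₀ y a)) := by
  rw [christoffel, inChart_apply _ hy, ContinuousLinearMap.flip_apply, _root_.sum_apply,
    _root_.sum_apply]
  rfl

/-- A smooth torsion-free connection has smooth symmetric Christoffel symbols in every chart. -/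
theorem hasChristoffel_of_torsion_eq_zero [T2Space M] (cov : CovariantDerivative (𝓡 m)
      (EuclideanSpace ℝ (Fin m)) (TangentSpace (𝓡 m) : M → Type _))
    (hs : cov.ContMDiffCovariantDerivative ∞) (ht : cov.torsion = 0) (x₀ : M) :
    HasChristoffel cov.toFun x₀ (christoffel cov.toFun x₀) := by
  have hx := mem_chart_source (EuclideanSpace ℝ (Fin m)) x₀
  have heq : ∀ y ∈ (chartAt (EuclideanSpace ℝ (Fin m)) x₀).source,
      ∀ Y : Π y : M, TangentSpace (𝓡 m) y,
      MDifferentiableAt (𝓡 m) ((𝓡 m).prod 𝓘(ℝ, EuclideanSpace ℝ (Fin m)))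
        (fun y => TotalSpace.mk' (EuclideanSpace ℝ (Fin m)) y (Y y)) y →
      ∀ a, coframe x₀ y (cov.toFun Y y (frame x₀ y a)) =
        fderiv ℝ (localField x₀ Y) (extChartAt (𝓡 m) x₀ y) a
          + christoffel cov.toFun x₀ (extChartAt (𝓡 m) x₀ y) a (coframe x₀ y (Y y)) := by
    intro y hy Y hY a
    have hY' := (mdifferentiableAt_field_iff hy).1 hY
    let f : Fin m → M → ℝ := fun i y => (coframe x₀ y (Y y)) i
    have hfi : ∀ i, inChart x₀ (f i) = fun z => EuclideanSpace.proj (𝕜 := ℝ) i (localField x₀ Y z) :=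
      fun i => rfl
    have hfd : ∀ i, DifferentiableAt ℝ (inChart x₀ (f i)) (extChartAt (𝓡 m) x₀ y) := by
      intro i
      rw [hfi]
      exact (EuclideanSpace.proj (𝕜 := ℝ) i).differentiableAt.comp _ hY'
    have hf : ∀ i, MDifferentiableAt (𝓡 m) 𝓘(ℝ) (f i) y := fun i =>
      (mdifferentiableAt_iff_inChart hy).2 (hfd i)
    obtain ⟨h1, h2⟩ := cov_sum (cov := cov) Finset.univ hf
      (fun i => mdifferentiableAt_frame hy (EuclideanSpace.basisFun (Fin m) ℝ i))
    -- expand `Y` in the coordinate frame and use the Leibniz rule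
    have h3 : ∀ᶠ y' in 𝓝 y, Y y' =
        (∑ i, f i • fun y => frame x₀ y (EuclideanSpace.basisFun (Fin m) ℝ i)) y' := by
      filter_upwards [(chartAt (EuclideanSpace ℝ (Fin m)) x₀).open_source.mem_nhds hy] with y' hy'
      rw [Finset.sum_apply]
      exact sum_frame hy' (Y y')
    have h4 : cov.toFun Y y = cov.toFun
        (∑ i, f i • fun y => frame x₀ y (EuclideanSpace.basisFun (Fin m) ℝ i)) y :=
      cov.isCovariantDerivativeOnUniv.congr_of_eventuallyEq hY h1 univ_mem h3
    rw [h4]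
    have h5 := congrArg (coframe x₀ y) (h2 (frame x₀ y a))
    refine h5.trans ?_
    rw [christoffel_apply _ hy, map_sum, add_comm, ← (EuclideanSpace.basisFun (Fin m) ℝ).sum_repr
      (fderiv ℝ (localField x₀ Y) (extChartAt (𝓡 m) x₀ y) a), ← Finset.sum_add_distrib]
    refine Finset.sum_congr rfl fun i _ => ?_
    rw [map_add, map_smul, map_smul, coframe_frame hy, mvfderiv_frame hy (hfd i)]
    congr 2
    rw [hfi]
    have := ((EuclideanSpace.proj (𝕜 := ℝ) i).hasFDerivAt.comp _ hY'.hasFDerivAt).fderiv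
    exact congrArg (fun L => L a) this
  have hframe : ∀ y ∈ (chartAt (EuclideanSpace ℝ (Fin m)) x₀).source, ∀ a b,
      coframe x₀ y (cov.toFun (fun y => frame x₀ y b) y (frame x₀ y a)) =
        christoffel cov.toFun x₀ (extChartAt (𝓡 m) x₀ y) a b := by
    intro y hy a b
    have := heq y hy _ (mdifferentiableAt_frame hy b) a
    rw [this, (localField_frame_eventuallyEq hy (b := b) (Eventually.of_forall fun _ => rfl)).fderiv_eq,
      coframe_frame hy]
    simp
  refine ⟨?_, ?_, ?_⟩
  · refine contDiffAt_clm_of_apply fun a => contDiffAt_clm_of_apply fun b => ?_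
    -- the coordinate field is only smooth near `x₀`: replace it by a global smooth field
    obtain ⟨Y, hY, hYe⟩ := exists_contMDiff_eventuallyEq_frame x₀ b
    have h1 : ContMDiffAt (𝓡 m) 𝓘(ℝ, EuclideanSpace ℝ (Fin m)) ∞
        (fun y => coframe x₀ y (cov.toFun Y y (frame x₀ y a))) x₀ := by
      refine contMDiffAt_coframe_apply hx ?_
      have h2 := hs.contMDiff.contMDiff (σ := Y) (by simpa using hY.contMDiffOn)
      exact ContMDiffAt.clm_bundle_apply (F₁ := EuclideanSpace ℝ (Fin m))
        (F₂ := EuclideanSpace ℝ (Fin m)) (h2.contMDiffAt univ_mem) (contMDiffAt_frame hx a)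
    refine (contDiffAt_inChart le_rfl hx h1).congr_of_eventuallyEq ?_
    have h3 : ∀ᶠ y in 𝓝 x₀, christoffel cov.toFun x₀ (extChartAt (𝓡 m) x₀ y) a b =
        coframe x₀ y (cov.toFun Y y (frame x₀ y a)) := by
      filter_upwards [eventually_mem_source (m := m) x₀, hYe.eventually_nhds] with y hy hY'
      rw [← hframe y hy]
      have : cov.toFun (fun y => frame x₀ y b) y = cov.toFun Y y :=
        cov.isCovariantDerivativeOnUniv.congr_of_eventuallyEq (mdifferentiableAt_frame hy b)
          ((hY y).mdifferentiableAt (by simp)) univ_mem (hY'.mono fun _ h => h.symm)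
      rw [this]
    filter_upwards [(tendsto_symm hx).eventually h3, eventually_right_inv x₀] with z h4 h5
    rw [h5] at h4
    exact h4
  · have h1 : ∀ᶠ y in 𝓝 x₀, ∀ a b, christoffel cov.toFun x₀ (extChartAt (𝓡 m) x₀ y) a b =
        christoffel cov.toFun x₀ (extChartAt (𝓡 m) x₀ y) b a := by
      filter_upwards [eventually_mem_source (m := m) x₀] with y hy a b
      have h2 := (cov.torsion_eq_zero_iff.1 ht) (mdifferentiableAt_frame hy a)
        (mdifferentiableAt_frame hy b)
      rw [mlieBracket_frame hy, sub_eq_zero] at h2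
      rw [← hframe y hy, ← hframe y hy]
      exact congrArg (coframe x₀ y) h2
    filter_upwards [(tendsto_symm hx).eventually h1, eventually_right_inv x₀] with z h4 h5
    rw [h5] at h4
    exact h4
  · filter_upwards [eventually_mem_source (m := m) x₀] with y hy using heq y hy

end Charts

/-! ### Weyl structures in charts -/

/-- The Lee form is determined by the metric and the connection. -/
theorem IsLocalWeyl.lee_unique {V : Type*} [NormedAddCommGroup V] [NormedSpace ℝ V] [Nontrivial V]
    {G G' : V → V →L[ℝ] V →L[ℝ] ℝ} {Γ : V → V →L[ℝ] V →L[ℝ] V} {θ θ' : V → V →L[ℝ] ℝ} {z : V}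
    (h : IsLocalWeyl G Γ θ z) (h' : IsLocalWeyl G' Γ θ' z) (hG : G' =ᶠ[𝓝 z] G) :
    θ' =ᶠ[𝓝 z] θ := by
  obtain ⟨e, he⟩ := exists_ne (0 : V)
  filter_upwards [h.metric_pos, h.compat, h'.compat, hG, hG.fderiv (𝕜 := ℝ)] with y h1 h2 h3 h4 h5
  ext v
  have h6 := h2 v e e
  have h7 := h3 v e e
  rw [h4, h5] at h7
  have h8 := (h1 e he).ne'
  have h9 : (θ' y v - θ y v) * G y e e = 0 := by linarith
  have := (mul_eq_zero.1 h9).resolve_right h8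
  linarith

section Charts
variable {m : ℕ} {M : Type*} [TopologicalSpace M] [ChartedSpace (EuclideanSpace ℝ (Fin m)) M]
  [IsManifold (𝓡 m) ∞ M] {x₀ y : M} {cov : ConnOp m M}
  {Γ : EuclideanSpace ℝ (Fin m) → EuclideanSpace ℝ (Fin m) →L[ℝ]
      EuclideanSpace ℝ (Fin m) →L[ℝ] EuclideanSpace ℝ (Fin m)}

/-- The Christoffel symbols are determined by the connection. -/
theorem HasChristoffel.christoffel_eventuallyEq (h : HasChristoffel cov x₀ Γ) :
    christoffel cov x₀ =ᶠ[𝓝 (extChartAt (𝓡 m) x₀ x₀)] Γ := by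
  have hx := mem_chart_source (EuclideanSpace ℝ (Fin m)) x₀
  have h1 : ∀ᶠ y in 𝓝 x₀, christoffel cov x₀ (extChartAt (𝓡 m) x₀ y) =
      Γ (extChartAt (𝓡 m) x₀ y) := by
    filter_upwards [h.cov_frame, eventually_mem_source (m := m) x₀] with y h1 hy
    ext1 a
    ext1 b
    rw [christoffel_apply cov hy]
    conv_rhs => rw [← (EuclideanSpace.basisFun (Fin m) ℝ).sum_repr b, map_sum]
    refine Finset.sum_congr rfl fun i _ => ?_
    rw [map_smul]
    congr 1
    exact h1 _ _ (Eventually.of_forall fun _ => rfl) a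
  filter_upwards [(tendsto_symm hx).eventually h1, eventually_right_inv x₀] with z h4 h5
  rwa [h5] at h4

theorem HasChristoffel.christoffel (h : HasChristoffel cov x₀ Γ) :
    HasChristoffel cov x₀ (christoffel cov x₀) where
  contDiffAt := h.contDiffAt.congr_of_eventuallyEq h.christoffel_eventuallyEq
  symm := by
    filter_upwards [h.symm, h.christoffel_eventuallyEq] with z h1 h2
    rwa [h2]
  eq := by
    filter_upwards [h.eq, (tendsto_chart (mem_chart_source _ x₀)).eventually
      h.christoffel_eventuallyEq] with y h1 h2
    rwa [h2]

/-- A connection preserving the conformal structure gives a Weyl structure in every chart. A Lee form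
is not assumed to be smooth: this follows from its equation. -/
theorem HasChristoffel.isLocalWeyl (h : HasChristoffel cov x₀ Γ) (hm : m ≠ 0) {g : Metric m M}
    {θ : Π y : M, TangentSpace (𝓡 m) y →L[ℝ] ℝ} (hθ : IsLeeForm g cov θ) :
    IsLocalWeyl (localMetric x₀ g) Γ (localForm x₀ θ) (extChartAt (𝓡 m) x₀ x₀) := by
  have hx := mem_chart_source (EuclideanSpace ℝ (Fin m)) x₀
  have hG := contDiffAt_localMetric g x₀
  have hcompat : ∀ᶠ z in 𝓝 (extChartAt (𝓡 m) x₀ x₀), ∀ v a b,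
      fderiv ℝ (localMetric x₀ g) z v a b = localMetric x₀ g z (Γ z v a) b
        + localMetric x₀ g z a (Γ z v b) - 2 * localForm x₀ θ z v * localMetric x₀ g z a b := by
    have h1 : ∀ᶠ y in 𝓝 x₀, ∀ v a b,
        fderiv ℝ (localMetric x₀ g) (extChartAt (𝓡 m) x₀ y) v a b =
          g.inner y (frame x₀ y (Γ (extChartAt (𝓡 m) x₀ y) v a)) (frame x₀ y b)
          + g.inner y (frame x₀ y a) (frame x₀ y (Γ (extChartAt (𝓡 m) x₀ y) v b))
          - 2 * θ y (frame x₀ y v) * g.inner y (frame x₀ y a) (frame x₀ y b) := by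
      filter_upwards [h.cov_frame, eventually_mem_source (m := m) x₀,
        (tendsto_chart hx).eventually hG.eventually_differentiableAt] with y h1 hy hd v a b
      have h2 := hθ y (frame x₀ y v) _ _ (mdifferentiableAt_frame hy a) (mdifferentiableAt_frame hy b)
      have h3 : ∀ a, cov (fun y => frame x₀ y a) y (frame x₀ y v) =
          frame x₀ y (Γ (extChartAt (𝓡 m) x₀ y) v a) := fun a => by
        rw [← h1 _ a (Eventually.of_forall fun _ => rfl) v, frame_coframe hy]
      rw [h3, h3] at h2
      rw [← h2]
      have h4 : DifferentiableAt ℝ (fun z => localMetric x₀ g z a b) (extChartAt (𝓡 m) x₀ y) :=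
        (hd.clm_apply (differentiableAt_const a)).clm_apply (differentiableAt_const b)
      have h5 := mvfderiv_frame (f := fun y => g.inner y (frame x₀ y a) (frame x₀ y b)) hy h4 v
      refine Eq.trans ?_ h5.symm
      change _ = fderiv ℝ (fun z => localMetric x₀ g z a b) (extChartAt (𝓡 m) x₀ y) v
      rw [fderiv_clm_apply (hd.clm_apply (differentiableAt_const a)) (differentiableAt_const b),
        fderiv_clm_apply hd (differentiableAt_const a)]
      simp
    filter_upwards [(tendsto_symm hx).eventually h1, eventually_right_inv x₀] with z h4 h5
    rw [h5] at h4
    exact h4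
  have hpos : ∀ᶠ z in 𝓝 (extChartAt (𝓡 m) x₀ x₀), ∀ a, a ≠ 0 → 0 < localMetric x₀ g z a a := by
    filter_upwards [(tendsto_symm hx).eventually (eventually_mem_source (m := m) x₀)] with z hz a ha
    exact g.pos _ _ fun h0 => ha
      ((coframe_frame hz a).symm.trans ((congrArg (coframe x₀ _) h0).trans (map_zero _)))
  refine ⟨hG, h.contDiffAt, ?_, ?_, hpos, h.symm, hcompat⟩
  · refine contDiffAt_clm_of_apply fun v => ?_
    let e : EuclideanSpace ℝ (Fin m) := EuclideanSpace.basisFun (Fin m) ℝ ⟨0, Nat.pos_of_ne_zero hm⟩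
    have he : e ≠ 0 := (EuclideanSpace.basisFun (Fin m) ℝ).toBasis.ne_zero _
    -- the compatibility with the metric, at `(e, e)`, expresses `θ(v)` by smooth functions
    have h1 : (fun z => localForm x₀ θ z v) =ᶠ[𝓝 (extChartAt (𝓡 m) x₀ x₀)] fun z =>
        (localMetric x₀ g z (Γ z v e) e + localMetric x₀ g z e (Γ z v e)
          - fderiv ℝ (localMetric x₀ g) z v e e) / (2 * localMetric x₀ g z e e) := by
      filter_upwards [hcompat, hpos] with z h1 h2
      rw [eq_div_iff (by have := h2 e he; positivity), h1 v e e]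
      ring
    refine ContDiffAt.congr_of_eventuallyEq ?_ h1
    have hΓ : ContDiffAt ℝ ∞ (fun z => Γ z v e) (extChartAt (𝓡 m) x₀ x₀) :=
      (h.contDiffAt.clm_apply contDiffAt_const).clm_apply contDiffAt_const
    have hDG := ((hG.fderiv_right (m := ∞) (by simp)).clm_apply
      (contDiffAt_const (c := v))).clm_apply (contDiffAt_const (c := e))
    refine ContDiffAt.div ((((hG.clm_apply hΓ).clm_apply contDiffAt_const).add
      ((hG.clm_apply contDiffAt_const).clm_apply hΓ)).sub (hDG.clm_apply contDiffAt_const))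
      (contDiffAt_const.mul ((hG.clm_apply contDiffAt_const).clm_apply contDiffAt_const)) ?_
    have := hpos.self_of_nhds e he
    positivity
  · exact Eventually.of_forall fun z a b => g.symm _ _ _

/-- The Lee form of a connection, in the chart centred at `x₀`. -/
def localLee (g : Metric m M) (cov : ConnOp m M) (x₀ : M) :
    EuclideanSpace ℝ (Fin m) → EuclideanSpace ℝ (Fin m) →L[ℝ] ℝ :=
  localForm x₀ (leeForm g cov)

/-- An operator on vector fields that is a Weyl structure: torsion-free with smooth Christoffel
symbols, and preserving the conformal structure. -/
structure IsWeyl (C : ConformalStructure m M) (cov : ConnOp m M) : Prop where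
  hasChristoffel : ∀ x, HasChristoffel cov x (christoffel cov x)
  conformal : ∀ g ∈ C.metrics, ∃ θ, IsLeeForm g cov θ

theorem WeylStructure.isWeyl [T2Space M] {C : ConformalStructure m M} (D : WeylStructure C) :
    IsWeyl C D.conn.toFun :=
  ⟨hasChristoffel_of_torsion_eq_zero D.conn D.smooth D.torsion_free, D.conformal⟩

variable {C : ConformalStructure m M} {g g' : Metric m M}

theorem IsWeyl.isLeeForm (h : IsWeyl C cov) (hg : g ∈ C.metrics) : IsLeeForm g cov (leeForm g cov) := by
  have h1 := h.conformal g hg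
  have h2 : leeForm g cov = h1.choose := by
    funext x
    rw [leeForm, dif_pos h1]
  rw [h2]
  exact h1.choose_spec

theorem IsWeyl.isLocalWeyl (h : IsWeyl C cov) (hm : m ≠ 0) (hg : g ∈ C.metrics) (x : M) :
    IsLocalWeyl (localMetric x g) (christoffel cov x) (localLee g cov x) (extChartAt (𝓡 m) x x) :=
  (h.hasChristoffel x).isLocalWeyl hm (h.isLeeForm hg)

theorem localMetric_rescale {f : M → ℝ} (h : IsRescaling g g' f) (x : M) :
    localMetric x g' = fun z => Real.exp (2 * inChart x f z) • localMetric x g z := by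
  funext z
  ext a b
  exact h.2 _ _ _

theorem nontrivial_of_ne_zero (hm : m ≠ 0) : Nontrivial (EuclideanSpace ℝ (Fin m)) := by
  have : Nonempty (Fin m) := ⟨⟨0, Nat.pos_of_ne_zero hm⟩⟩
  infer_instance

/-- Rescaling the metric by `e^{2f}` changes the Lee form by `-df`. -/
theorem IsWeyl.localLee_rescale (h : IsWeyl C cov) (hm : m ≠ 0) (hg : g ∈ C.metrics)
    (hg' : g' ∈ C.metrics) {f : M → ℝ} (hf : IsRescaling g g' f) (x : M) :
    localLee g' cov x =ᶠ[𝓝 (extChartAt (𝓡 m) x x)]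
      fun z => localLee g cov x z - fderiv ℝ (inChart x f) z := by
  have := nontrivial_of_ne_zero hm
  have h1 := (h.isLocalWeyl hm hg x).rescale (contDiffAt_inChart le_rfl (mem_chart_source _ x) (hf.1 x))
  have h2 := h.isLocalWeyl hm hg' x
  refine h1.lee_unique h2 ?_
  rw [localMetric_rescale hf]

/-- The difference of the Lee forms of two connections. -/
def leeDiff (g : Metric m M) (cov₁ cov₂ : ConnOp m M) (x : M) (z : EuclideanSpace ℝ (Fin m)) :
    EuclideanSpace ℝ (Fin m) →L[ℝ] ℝ :=
  localLee g cov₂ x z - localLee g cov₁ x z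

/-- The vector dual to the difference of the Lee forms of two connections. -/
def leeDiffVec (g : Metric m M) (cov₁ cov₂ : ConnOp m M) (x : M) : EuclideanSpace ℝ (Fin m) :=
  (localMetric x g (extChartAt (𝓡 m) x x)).inverse (leeDiff g cov₁ cov₂ x (extChartAt (𝓡 m) x x))

variable {cov₁ cov₂ : ConnOp m M}

theorem localMetric_isInvertible (g : Metric m M) (x : M) :
    (localMetric x g (extChartAt (𝓡 m) x x)).IsInvertible := by
  have h := pullMetric_isInvertible (F := fun z : EuclideanSpace ℝ (Fin m) => z)
    (G := fun _ => localMetric x g (extChartAt (𝓡 m) x x)) (y := extChartAt (𝓡 m) x x)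
    (fun a ha => by rw [localMetric_self]; exact g.pos x a ha)
    (by simpa using Function.injective_id)
  have h2 : pullMetric (fun z : EuclideanSpace ℝ (Fin m) => z)
    (fun _ => localMetric x g (extChartAt (𝓡 m) x x)) (extChartAt (𝓡 m) x x) =
      localMetric x g (extChartAt (𝓡 m) x x) := by
    ext a b
    simp [pullMetric]
  rwa [h2] at h

theorem localMetric_leeDiffVec (g : Metric m M) (cov₁ cov₂ : ConnOp m M) (x : M)
    (c : EuclideanSpace ℝ (Fin m)) :
    localMetric x g (extChartAt (𝓡 m) x x) (leeDiffVec g cov₁ cov₂ x) c =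
      leeDiff g cov₁ cov₂ x (extChartAt (𝓡 m) x x) c := by
  rw [leeDiffVec, (localMetric_isInvertible g x).self_apply_inverse]

/-- The tensor `Q = ∇γ - γ ⊗ γ + ½ |γ|² c`, where `γ` is the difference of the Lee forms of `cov₂` and
`cov₁`, and `∇` is `cov₁`. -/
def weylChange (g : Metric m M) (cov₁ cov₂ : ConnOp m M) (x : M)
    (u v : EuclideanSpace ℝ (Fin m)) : ℝ :=
  schoutenChange (localMetric x g) (christoffel cov₁ x) (leeDiff g cov₁ cov₂ x)
    (extChartAt (𝓡 m) x x) (leeDiffVec g cov₁ cov₂ x) u v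

theorem leeDiff_rescale (h₁ : IsWeyl C cov₁) (h₂ : IsWeyl C cov₂) (hm : m ≠ 0)
    (hg : g ∈ C.metrics) (hg' : g' ∈ C.metrics) (x : M) :
    leeDiff g' cov₁ cov₂ x =ᶠ[𝓝 (extChartAt (𝓡 m) x x)] leeDiff g cov₁ cov₂ x := by
  obtain ⟨f, hf⟩ := (C.mem_iff g hg g').1 hg'
  filter_upwards [h₁.localLee_rescale hm hg hg' hf x, h₂.localLee_rescale hm hg hg' hf x] with z h1 h2
  rw [leeDiff, h1, h2, leeDiff]
  abel

theorem weylChange_rescale (h₁ : IsWeyl C cov₁) (h₂ : IsWeyl C cov₂) (hm : m ≠ 0)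
    (hg : g ∈ C.metrics) (hg' : g' ∈ C.metrics) (x : M) :
    weylChange g' cov₁ cov₂ x = weylChange g cov₁ cov₂ x := by
  obtain ⟨f, hf⟩ := (C.mem_iff g hg g').1 hg'
  have h := leeDiff_rescale h₁ h₂ hm hg hg' x
  have h0 := h.self_of_nhds
  have h3 : Real.exp (2 * f x) * Real.exp (-2 * f x) = 1 := by
    rw [← Real.exp_add]; simp
  have h1 : leeDiffVec g' cov₁ cov₂ x = Real.exp (-2 * f x) • leeDiffVec g cov₁ cov₂ x := by
    have h2 := localMetric_isInvertible g' x
    rw [leeDiffVec, h0]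
    apply h2.injective
    rw [h2.self_apply_inverse, map_smul, localMetric_rescale hf]
    ext c
    simp only [_root_.smul_apply, localMetric_leeDiffVec, inChart_apply f (mem_chart_source _ x),
      smul_eq_mul]
    linear_combination (-leeDiff g cov₁ cov₂ x (extChartAt (𝓡 m) x x) c) * h3
  funext u v
  simp only [weylChange, schoutenChange, covOneForm]
  rw [h.fderiv_eq, h0, h1, localMetric_rescale hf]
  simp only [_root_.smul_apply, map_smul, inChart_apply f (mem_chart_source _ x), smul_eq_mul]
  linear_combination (1 / 2 * leeDiff g cov₁ cov₂ x (extChartAt (𝓡 m) x x)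
    (leeDiffVec g cov₁ cov₂ x) * localMetric x g (extChartAt (𝓡 m) x x) u v) * h3

end Charts

/-! ### Bilinear forms on tangent spaces -/

/-- A real valued function of two vectors is a bilinear form. The curvature tensors are defined as
plain functions of vectors, whose bilinearity is a property to be proved. -/
def IsBilin {V : Type*} [AddCommGroup V] [Module ℝ V] (B : V → V → ℝ) : Prop :=
  ∃ L : V →ₗ[ℝ] V →ₗ[ℝ] ℝ, ∀ u v, L u v = B u v

namespace IsBilin
variable {V W : Type*} [AddCommGroup V] [Module ℝ V] [AddCommGroup W] [Module ℝ W]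
  {B B' : V → V → ℝ}

theorem add (h : IsBilin B) (h' : IsBilin B') : IsBilin fun u v => B u v + B' u v := by
  obtain ⟨L, hL⟩ := h
  obtain ⟨L', hL'⟩ := h'
  exact ⟨L + L', fun u v => by simp [hL, hL']⟩

theorem sub (h : IsBilin B) (h' : IsBilin B') : IsBilin fun u v => B u v - B' u v := by
  obtain ⟨L, hL⟩ := h
  obtain ⟨L', hL'⟩ := h'
  exact ⟨L - L', fun u v => by simp [hL, hL']⟩

theorem const_mul (h : IsBilin B) (c : ℝ) : IsBilin fun u v => c * B u v := by
  obtain ⟨L, hL⟩ := h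
  exact ⟨c • L, fun u v => by simp [hL]⟩

theorem swap (h : IsBilin B) : IsBilin fun u v => B v u := by
  obtain ⟨L, hL⟩ := h
  exact ⟨L.flip, fun u v => by simp [hL]⟩

theorem comp (h : IsBilin B) (f : W →ₗ[ℝ] V) : IsBilin fun u v => B (f u) (f v) := by
  obtain ⟨L, hL⟩ := h
  exact ⟨L.compl₁₂ f f, fun u v => by simp [hL]⟩

theorem sum {ι : Type*} (s : Finset ι) {B : ι → V → V → ℝ} (h : ∀ i, IsBilin (B i)) :
    IsBilin fun u v => ∑ i ∈ s, B i u v := by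
  choose L hL using h
  exact ⟨∑ i ∈ s, L i, fun u v => by simp [hL]⟩

end IsBilin

section Charts
variable {m : ℕ} {M : Type*} [TopologicalSpace M] [ChartedSpace (EuclideanSpace ℝ (Fin m)) M]
  [IsManifold (𝓡 m) ∞ M] {x : M} {cov cov₁ cov₂ : ConnOp m M} {C : ConformalStructure m M}
  {g g' : Metric m M}

/-- The symmetric trace-free part of a bilinear form. -/
def symTraceFree (g : Metric m M) (x : M) (B : EuclideanSpace ℝ (Fin m) → EuclideanSpace ℝ (Fin m) → ℝ)
    (u v : EuclideanSpace ℝ (Fin m)) : ℝ :=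
  (B u v + B v u) / 2 - (1 / m : ℝ) * trg g x B * g.inner x u v

theorem trg_rescale {f : M → ℝ} (hf : IsRescaling g g' f)
    (B : EuclideanSpace ℝ (Fin m) → EuclideanSpace ℝ (Fin m) → ℝ) :
    trg g' x B = Real.exp (-2 * f x) * trg g x B := by
  have h := traceWith_mul_form (stdBasis x) (Real.exp_ne_zero (2 * f x)) (fun u v => g.inner x u v) B
  rw [← Real.exp_neg, ← neg_mul, smul_eq_mul] at h
  refine Eq.trans ?_ h
  refine congrArg (fun q => traceWith (stdBasis x) q B) ?_
  funext u v
  exact hf.2 x u v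

theorem trg_add (g : Metric m M) (x : M)
    (B B' : EuclideanSpace ℝ (Fin m) → EuclideanSpace ℝ (Fin m) → ℝ) :
    trg g x (fun u v => B u v + B' u v) = trg g x B + trg g x B' :=
  traceWith_add _ _ _ _

theorem trg_const_mul (g : Metric m M) (x : M) (c : ℝ)
    (B : EuclideanSpace ℝ (Fin m) → EuclideanSpace ℝ (Fin m) → ℝ) :
    trg g x (fun u v => c * B u v) = c * trg g x B :=
  traceWith_mul _ _ _ _

theorem trg_mul_inner_rescale {f : M → ℝ} (hf : IsRescaling g g' f)
    (B : EuclideanSpace ℝ (Fin m) → EuclideanSpace ℝ (Fin m) → ℝ) (u v : EuclideanSpace ℝ (Fin m)) :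
    trg g' x B * g'.inner x u v = trg g x B * g.inner x u v := by
  have h3 : Real.exp (2 * f x) * Real.exp (-2 * f x) = 1 := by
    rw [← Real.exp_add]; simp
  have h := hf.2 x u v
  rw [trg_rescale hf, h]
  linear_combination (trg g x B * g.inner x u v) * h3

theorem symTraceFree_rescale (hg : g ∈ C.metrics) (hg' : g' ∈ C.metrics)
    (B : EuclideanSpace ℝ (Fin m) → EuclideanSpace ℝ (Fin m) → ℝ) :
    symTraceFree g' x B = symTraceFree g x B := by
  obtain ⟨f, hf⟩ := (C.mem_iff g hg g').1 hg'
  funext u v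
  rw [symTraceFree, symTraceFree, mul_assoc, trg_mul_inner_rescale hf, mul_assoc]

theorem isBilin_weylChange : IsBilin (weylChange g cov₁ cov₂ x) :=
  ⟨schoutenChangeBilin _ _ _ _ _, fun _ _ => rfl⟩

theorem isBilin_inner (g : Metric m M) (x : M) :
    IsBilin (V := EuclideanSpace ℝ (Fin m)) fun u v => g.inner x u v :=
  ⟨toBilin (V := EuclideanSpace ℝ (Fin m)) (g.inner x), fun _ _ => rfl⟩

theorem isBilin_symTraceFree {B : EuclideanSpace ℝ (Fin m) → EuclideanSpace ℝ (Fin m) → ℝ}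
    (h : IsBilin B) : IsBilin (symTraceFree g x B) := by
  have h1 := ((h.add h.swap).const_mul (1 / 2)).sub
    ((isBilin_inner g x).const_mul ((1 / m : ℝ) * trg g x B))
  convert h1 using 3
  rw [symTraceFree]
  ring

theorem symTraceFree_symm (B : EuclideanSpace ℝ (Fin m) → EuclideanSpace ℝ (Fin m) → ℝ)
    (u v : EuclideanSpace ℝ (Fin m)) : symTraceFree g x B u v = symTraceFree g x B v u := by
  rw [symTraceFree, symTraceFree, add_comm]
  congr 2
  exact g.symm _ _ _

theorem trg_inner (g : Metric m M) (x : M) :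
    trg g x (fun u v : EuclideanSpace ℝ (Fin m) => g.inner x u v) = m := by
  have h := traceWith_self (EuclideanSpace.basisFun (Fin m) ℝ).toBasis
    (q := toBilin (V := EuclideanSpace ℝ (Fin m)) (g.inner x)) (fun v hv => g.pos x v hv)
    (fun u v => g.symm x u v)
  exact h

/-- Adding a multiple of the metric does not change the symmetric trace-free part. -/
theorem symTraceFree_add {B B₁ B₂ : EuclideanSpace ℝ (Fin m) → EuclideanSpace ℝ (Fin m) → ℝ} {a t : ℝ}
    (hm : m ≠ 0) (h : ∀ u v, B u v = B₁ u v + a * B₂ u v + t * g.inner x u v)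
    (u v : EuclideanSpace ℝ (Fin m)) :
    symTraceFree g x B u v = symTraceFree g x B₁ u v + a * symTraceFree g x B₂ u v := by
  have h1 : trg g x B = trg g x B₁ + a * trg g x B₂ + t * m := by
    let I : EuclideanSpace ℝ (Fin m) → EuclideanSpace ℝ (Fin m) → ℝ := fun u v => g.inner x u v
    have h2 : B = fun u v => B₁ u v + a * B₂ u v + t * I u v := by
      funext u v
      exact h u v
    have h3 : trg g x I = m := trg_inner g x
    rw [← h3, h2]
    exact (trg_add g x (fun u v => B₁ u v + a * B₂ u v) (fun u v => t * I u v)).trans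
      (congrArg₂ (· + ·) ((trg_add g x B₁ fun u v => a * B₂ u v).trans
        (congrArg (trg g x B₁ + ·) (trg_const_mul g x a B₂))) (trg_const_mul g x t I))
  have hs : g.inner x v u = g.inner x u v := g.symm _ _ _
  have hm' : (m : ℝ) ≠ 0 := by exact_mod_cast hm
  rw [symTraceFree, symTraceFree, symTraceFree, h1, h, h, hs]
  field_simp
  ring

/-! ### Möbius and Laplace structures under a change of the Weyl structure -/

/-- The trace-free Hessian in weight `1` changes by a scalar operator. -/
theorem hess₀_one_sub (h₁ : IsWeyl C cov₁) (h₂ : IsWeyl C cov₂) (hm : m ≠ 0)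
    (hg : g ∈ C.metrics) {l : M → ℝ} (hl : ContMDiff (𝓡 m) 𝓘(ℝ) ∞ l) (x : M)
    (u v : EuclideanSpace ℝ (Fin m)) :
    hess₀ 1 g cov₂ l x u v =
      hess₀ 1 g cov₁ l x u v + l x * symTraceFree g x (weylChange g cov₁ cov₂ x) u v := by
  have hl' := contDiffAt_inChart le_rfl (mem_chart_source _ x) (hl x)
  obtain ⟨t, ht⟩ := (h₁.isLocalWeyl hm hg x).localHess_one_sub (h₂.isLocalWeyl hm hg x)
    (localMetric_leeDiffVec g cov₁ cov₂ x) hl'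
  refine symTraceFree_add (t := t) hm (fun u v => ?_) u v
  have e₁ := hess_eq_localHess (h₁.hasChristoffel x) 1 g hl (h₁.isLocalWeyl hm hg x).contDiffAt_lee u v
  have e₂ := hess_eq_localHess (h₂.hasChristoffel x) 1 g hl (h₂.isLocalWeyl hm hg x).contDiffAt_lee u v
  have h3 := ht u v
  rw [localMetric_self, inChart_apply l (mem_chart_source _ x)] at h3
  exact e₂.trans (h3.trans (congrArg₂ (· + ·) (congrArg₂ (· + ·) e₁.symm rfl) rfl))

/-- The trace of the Hessian in weight `1 - m/2` changes by a scalar operator. -/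
theorem trg_hess_sub (h₁ : IsWeyl C cov₁) (h₂ : IsWeyl C cov₂) (hm : m ≠ 0)
    (hg : g ∈ C.metrics) {l : M → ℝ} (hl : ContMDiff (𝓡 m) 𝓘(ℝ) ∞ l) (x : M) :
    trg g x (hess (1 - m / 2) g cov₂ l x) = trg g x (hess (1 - m / 2) g cov₁ l x)
      + (1 - m / 2) * l x * trg g x (weylChange g cov₁ cov₂ x) := by
  have hl' := contDiffAt_inChart le_rfl (mem_chart_source _ x) (hl x)
  have ht := (h₁.isLocalWeyl hm hg x).trace_localHess_sub (EuclideanSpace.basisFun (Fin m) ℝ).toBasis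
    (h₂.isLocalWeyl hm hg x) (localMetric_leeDiffVec g cov₁ cov₂ x) hl'
  have e : ∀ {cov}, IsWeyl C cov → hess (1 - m / 2) g cov l x =
      localHess (1 - m / 2) (christoffel cov x) (localLee g cov x) (inChart x l)
        (extChartAt (𝓡 m) x x) := fun h => by
    funext u v
    exact hess_eq_localHess (h.hasChristoffel x) _ g hl (h.isLocalWeyl hm hg x).contDiffAt_lee u v
  rw [inChart_apply l (mem_chart_source _ x)] at ht
  refine (congrArg (trg g x) (e h₂)).trans (((trg_eq g _).trans ht).trans ?_)
  refine congrArg₂ (· + ·) ((trg_eq g _).symm.trans (congrArg (trg g x) (e h₁)).symm) ?_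
  exact congrArg (fun t => (1 - m / 2) * l x * t) (trg_eq g _).symm

/-- The weight bundle has a positive section: fix a metric `g₀` of the conformal class, and take
`e^{k f}` in the trivialization given by `e^{2f} g₀`. -/
theorem exists_density_pos (hm : m ≠ 0) (C : ConformalStructure m M) (k : ℝ) :
    ∃ l : Density C k, ∀ g x, 0 < l.val g x := by
  obtain ⟨g₀, h₀⟩ := C.nonempty
  have h : ∀ g : C.metrics, ∃ f, IsRescaling g₀ (g : Metric m M) f := fun g =>
    (C.mem_iff g₀ h₀ g).1 g.2
  choose f hf using h
  have := nontrivial_of_ne_zero hm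
  obtain ⟨e, he⟩ := exists_ne (0 : EuclideanSpace ℝ (Fin m))
  refine ⟨⟨fun g x => Real.exp (k * f g x), fun g => ?_, fun g g' φ hφ x => ?_⟩, fun g x =>
    Real.exp_pos _⟩
  · exact (Real.contDiff_exp.comp (contDiff_const.mul contDiff_id)).contMDiff.comp (hf g).1
  · have h1 : f g' x = φ x + f g x := by
      have h2 := hφ.2 x e e
      have h3 := (hf g).2 x e e
      have h4 := (hf g').2 x e e
      have h5 : 0 < g₀.inner x e e := g₀.pos x e he
      rw [h3, h4, ← mul_assoc, ← Real.exp_add] at h2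
      have := Real.exp_injective (mul_right_cancel₀ h5.ne' h2)
      linarith
    rw [← Real.exp_add, h1, mul_add]

/-- The tensor `h₀` of a Möbius structure exists for every Weyl structure, so that `MobiusStructure.form`
is never the default value. -/
theorem MobiusStructure.form_spec [T2Space M] (S : MobiusStructure C) (h : IsWeyl C cov) (hm : m ≠ 0)
    (l : Density C 1) (g : C.metrics) (x : M) (u v : TangentSpace (𝓡 m) x) :
    S.op l g x u v = hess₀ 1 (g : Metric m M) cov (l.val g) x u v + l.val g x * S.form cov x u v := by
  have hex : ∃ A : Π x : M, TangentSpace (𝓡 m) x → TangentSpace (𝓡 m) x → ℝ,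
      ∀ (l : Density C 1) (g : C.metrics) (x : M) (u v : TangentSpace (𝓡 m) x),
        S.op l g x u v = hess₀ 1 (g : Metric m M) cov (l.val g) x u v + l.val g x * A x u v := by
    obtain ⟨D, A, -, -, -, hA⟩ := S.exists_weyl
    obtain ⟨g₀, h₀⟩ := C.nonempty
    refine ⟨fun x u v => A x u v - symTraceFree g₀ x (weylChange g₀ D.conn.toFun cov x) u v, ?_⟩
    intro l g x u v
    have h1 := hess₀_one_sub D.isWeyl h hm g.2 (l.smooth g) x u v
    rw [weylChange_rescale D.isWeyl h hm h₀ g.2, symTraceFree_rescale h₀ g.2] at h1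
    rw [hA]
    linear_combination -h1
  rw [MobiusStructure.form, dif_pos hex]
  exact hex.choose_spec l g x u v

/-- The tensor of a Möbius structure is a symmetric bilinear form, for every Weyl structure. -/
theorem MobiusStructure.exists_form_eq [T2Space M] (S : MobiusStructure C) (h : IsWeyl C cov)
    (hm : m ≠ 0) (hg : g ∈ C.metrics) (x : M) :
    ∃ A : EuclideanSpace ℝ (Fin m) → EuclideanSpace ℝ (Fin m) → ℝ, IsBilin A ∧
      (∀ u v, A u v = A v u) ∧ ∀ u v, S.form cov x u v = A u v := by
  obtain ⟨D, A, -, hs, -, hA⟩ := S.exists_weyl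
  obtain ⟨l, hl⟩ := exists_density_pos hm C 1
  refine ⟨fun u v => A x u v - symTraceFree g x (weylChange g D.conn.toFun cov x) u v,
    IsBilin.sub ⟨toBilin (V := EuclideanSpace ℝ (Fin m)) (A x), fun _ _ => rfl⟩
      (isBilin_symTraceFree isBilin_weylChange),
    fun u v => congrArg₂ (· - ·) (hs x u v) (symTraceFree_symm _ u v), fun u v => ?_⟩
  have h1 := hess₀_one_sub D.isWeyl h hm hg (l.smooth ⟨g, hg⟩) x u v
  have h2 := S.form_spec h hm l ⟨g, hg⟩ x u v
  have h3 := hA l ⟨g, hg⟩ x u v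
  have h4 := (hl ⟨g, hg⟩ x).ne'
  have h5 : l.val ⟨g, hg⟩ x * (S.form cov x u v - (A x u v -
      symTraceFree g x (weylChange g D.conn.toFun cov x) u v)) = 0 := by
    linear_combination h3 - h2 - h1
  exact sub_eq_zero.1 ((mul_eq_zero.1 h5).resolve_left h4)

theorem MobiusStructure.form_sub [T2Space M] (S : MobiusStructure C) (h₁ : IsWeyl C cov₁)
    (h₂ : IsWeyl C cov₂) (hm : m ≠ 0) (hg : g ∈ C.metrics) (x : M) (u v : EuclideanSpace ℝ (Fin m)) :
    S.form cov₂ x u v = S.form cov₁ x u v - symTraceFree g x (weylChange g cov₁ cov₂ x) u v := by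
  obtain ⟨l, hl⟩ := exists_density_pos hm C 1
  have h1 := hess₀_one_sub h₁ h₂ hm hg (l.smooth ⟨g, hg⟩) x u v
  have h2 := S.form_spec h₂ hm l ⟨g, hg⟩ x u v
  have h3 := S.form_spec h₁ hm l ⟨g, hg⟩ x u v
  have h4 := (hl ⟨g, hg⟩ x).ne'
  have h5 : l.val ⟨g, hg⟩ x * (S.form cov₂ x u v - (S.form cov₁ x u v -
      symTraceFree g x (weylChange g cov₁ cov₂ x) u v)) = 0 := by
    linear_combination h3 - h2 - h1
  exact sub_eq_zero.1 ((mul_eq_zero.1 h5).resolve_left h4)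

/-- The scalar `σ` of a Laplace structure exists for every Weyl structure, so that
`LaplaceStructure.scalar` is never the default value. -/
theorem LaplaceStructure.scalar_spec [T2Space M] (S : LaplaceStructure C) (h : IsWeyl C cov)
    (hm : m = 1) (l : Density C (1 - m / 2)) (g : C.metrics) (x : M) :
    (S.op l).val g x = trg (g : Metric m M) x (hess (1 - m / 2) (g : Metric m M) cov (l.val g) x)
      + (1 - m / 2) * S.scalar cov g x * l.val g x := by
  have hex : ∃ s : C.metrics → M → ℝ,
      ∀ (l : Density C (1 - m / 2)) (g : C.metrics) (x : M),
        (S.op l).val g x =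
          trg (g : Metric m M) x (hess (1 - m / 2) (g : Metric m M) cov (l.val g) x)
            + (1 - m / 2) * s g x * l.val g x := by
    obtain ⟨D, s, hs⟩ := S.exists_weyl
    refine ⟨fun g x => 2 * s.val g x - trg (g : Metric m M) x (weylChange g D.conn.toFun cov x), ?_⟩
    intro l g x
    have h1 := trg_hess_sub D.isWeyl h (by omega) g.2 (l.smooth g) x
    have hm' : (m : ℝ) = 1 := by exact_mod_cast hm
    rw [hs, h1]
    simp only [hm']
    ring
  rw [LaplaceStructure.scalar, dif_pos hex]
  exact hex.choose_spec l g x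

theorem LaplaceStructure.scalar_sub [T2Space M] (S : LaplaceStructure C) (h₁ : IsWeyl C cov₁)
    (h₂ : IsWeyl C cov₂) (hm : m = 1) (g : C.metrics) (x : M) :
    S.scalar cov₂ g x = S.scalar cov₁ g x - trg (g : Metric m M) x (weylChange g cov₁ cov₂ x) := by
  obtain ⟨l, hl⟩ := exists_density_pos (by omega) C (1 - m / 2)
  have h1 := trg_hess_sub h₁ h₂ (by omega) g.2 (l.smooth g) x
  have h2 := S.scalar_spec h₂ hm l g x
  have h3 := S.scalar_spec h₁ hm l g x
  have h4 := (hl g x).ne'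
  have hm' : (m : ℝ) = 1 := by exact_mod_cast hm
  have h6 : (1 - m / 2 : ℝ) ≠ 0 := by rw [hm']; norm_num
  have h5 : ((1 - m / 2) * l.val g x) * (S.scalar cov₂ g x - (S.scalar cov₁ g x -
      trg (g : Metric m M) x (weylChange g cov₁ cov₂ x))) = 0 := by
    linear_combination h3 - h2 - h1
  exact sub_eq_zero.1 ((mul_eq_zero.1 h5).resolve_left (mul_ne_zero h6 h4))

/-- The scalar of a Laplace structure is a section of `L⁻²`. -/
theorem LaplaceStructure.scalar_rescale [T2Space M] (S : LaplaceStructure C) (h : IsWeyl C cov)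
    (hm : m = 1) (g g' : C.metrics) {f : M → ℝ} (hf : IsRescaling (g : Metric m M) g' f) (x : M) :
    S.scalar cov g' x = Real.exp (-2 * f x) * S.scalar cov g x := by
  obtain ⟨D, s, hs⟩ := S.exists_weyl
  obtain ⟨l, hl⟩ := exists_density_pos (by omega) C (1 - m / 2)
  have hm' : (m : ℝ) = 1 := by exact_mod_cast hm
  have h6 : (1 - m / 2 : ℝ) ≠ 0 := by rw [hm']; norm_num
  have key : ∀ g : C.metrics, S.scalar cov g x = 2 * s.val g x
      - trg (g : Metric m M) x (weylChange g D.conn.toFun cov x) := by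
    intro g
    have h1 := trg_hess_sub D.isWeyl h (by omega) g.2 (l.smooth g) x
    have h2 := S.scalar_spec h hm l g x
    have h3 := hs l g x
    have h4 := (hl g x).ne'
    have h5 : ((1 - m / 2) * l.val g x) * (S.scalar cov g x - (2 * s.val g x
        - trg (g : Metric m M) x (weylChange g D.conn.toFun cov x))) = 0 := by
      have : (1 - m / 2 : ℝ) * 2 = 1 := by rw [hm']; norm_num
      linear_combination h3 - h2 - h1 - (s.val g x * l.val g x) * this
    exact sub_eq_zero.1 ((mul_eq_zero.1 h5).resolve_left (mul_ne_zero h6 h4))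
  rw [key, key, s.rescale g g' f hf, weylChange_rescale D.isWeyl h (by omega) g.2 g'.2,
    trg_rescale hf]
  ring

end Charts

/-! ### The Schouten-Weyl tensor -/

section Charts
variable {m : ℕ} {M : Type*} [TopologicalSpace M] [ChartedSpace (EuclideanSpace ℝ (Fin m)) M]
  [IsManifold (𝓡 m) ∞ M] {x : M} {cov cov₁ cov₂ : ConnOp m M} {C : ConformalStructure m M}
  {g g' : Metric m M}

/-- On a curve, every bilinear form is its trace times the metric. -/
theorem IsBilin.eq_trg_mul (hm : m = 1) {B : EuclideanSpace ℝ (Fin m) → EuclideanSpace ℝ (Fin m) → ℝ}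
    (hB : IsBilin B) (g : Metric m M) (x : M) (u v : EuclideanSpace ℝ (Fin m)) :
    B u v = trg g x B * g.inner x u v := by
  subst hm
  obtain ⟨L, hL⟩ := hB
  have h := eq_traceWith_mul_of_finrank_one (EuclideanSpace.basisFun (Fin 1) ℝ).toBasis
    (q := toBilin (V := EuclideanSpace ℝ (Fin 1)) (g.inner x)) (fun v hv => g.pos x v hv) L u v
  have hL' : (fun u v => L u v) = B := by
    funext u v
    exact hL u v
  rw [hL'] at h
  exact (hL u v).symm.trans h

theorem ric_sub (h₁ : IsWeyl C cov₁) (h₂ : IsWeyl C cov₂) (hm : m ≠ 0)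
    (hg : g ∈ C.metrics) (x : M) (u v : EuclideanSpace ℝ (Fin m)) :
    ric cov₂ x u v = ric cov₁ x u v + weylChange g cov₁ cov₂ x v u
      - (m - 1) * weylChange g cov₁ cov₂ x u v
      - g.inner x u v * trg g x (weylChange g cov₁ cov₂ x) := by
  have h := (h₁.isLocalWeyl hm hg x).localRic_sub (EuclideanSpace.basisFun (Fin m) ℝ).toBasis
    (h₂.isLocalWeyl hm hg x) (localMetric_leeDiffVec g cov₁ cov₂ x) u v
  rw [localMetric_self] at h
  rw [ric_eq_localRic (h₁.hasChristoffel x), ric_eq_localRic (h₂.hasChristoffel x)]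
  refine h.trans ?_
  exact congrArg (fun t => localRic (EuclideanSpace.basisFun (Fin m) ℝ).toBasis (christoffel cov₁ x)
      (extChartAt (𝓡 m) x x) u v + weylChange g cov₁ cov₂ x v u
      - (m - 1) * weylChange g cov₁ cov₂ x u v - g.inner x u v * t) (trg_eq g _).symm

theorem scal_sub (h₁ : IsWeyl C cov₁) (h₂ : IsWeyl C cov₂) (hm : m ≠ 0)
    (hg : g ∈ C.metrics) (x : M) :
    scal g cov₂ x = scal g cov₁ x - 2 * (m - 1) * trg g x (weylChange g cov₁ cov₂ x) := by
  have h := (h₁.isLocalWeyl hm hg x).localScal_sub (EuclideanSpace.basisFun (Fin m) ℝ).toBasis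
    (h₂.isLocalWeyl hm hg x) (localMetric_leeDiffVec g cov₁ cov₂ x)
  rw [scal_eq (h₁.hasChristoffel x), scal_eq (h₂.hasChristoffel x)]
  refine h.trans ?_
  exact congrArg₂ (· - ·) rfl (congrArg (2 * ((m : ℝ) - 1) * ·) (trg_eq (x₀ := x) g _).symm)

theorem faraday_sub (h₁ : IsWeyl C cov₁) (h₂ : IsWeyl C cov₂) (hm : m ≠ 0)
    (hg : g ∈ C.metrics) (x : M) (u v : EuclideanSpace ℝ (Fin m)) :
    faraday cov₂ x u v = faraday cov₁ x u v + weylChange g cov₁ cov₂ x u v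
      - weylChange g cov₁ cov₂ x v u := by
  have h := (h₁.isLocalWeyl hm hg x).localFaraday_sub (EuclideanSpace.basisFun (Fin m) ℝ).toBasis
    (s := leeDiffVec g cov₁ cov₂ x) (h₂.isLocalWeyl hm hg x) hm u v
  rw [faraday_eq_localFaraday (h₁.hasChristoffel x), faraday_eq_localFaraday (h₂.hasChristoffel x)]
  exact h

theorem ric₀_sub (h₁ : IsWeyl C cov₁) (h₂ : IsWeyl C cov₂) (hm : m ≠ 0)
    (hg : g ∈ C.metrics) (x : M) (u v : EuclideanSpace ℝ (Fin m)) :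
    ric₀ g cov₂ x u v = ric₀ g cov₁ x u v
      - (m - 2) * symTraceFree g x (weylChange g cov₁ cov₂ x) u v := by
  have hm' : (m : ℝ) ≠ 0 := by exact_mod_cast hm
  have hs : g.inner x v u = g.inner x u v := g.symm _ _ _
  have e : ∀ cov : ConnOp m M, ric₀ g cov x u v =
      (ric cov x u v + ric cov x v u) / 2 - (1 / m : ℝ) * scal g cov x * g.inner x u v := fun _ => rfl
  have hinv : (1 / m : ℝ) * m = 1 := by field_simp
  rw [e, e, symTraceFree]
  linear_combination (1 / 2) * ric_sub h₁ h₂ hm hg x u v + (1 / 2) * ric_sub h₁ h₂ hm hg x v u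
    - (1 / m : ℝ) * g.inner x u v * scal_sub h₁ h₂ hm hg x
    - 1 / 2 * trg g x (weylChange g cov₁ cov₂ x) * hs
    + (trg g x (weylChange g cov₁ cov₂ x) * g.inner x u v) * hinv

/-- In every dimension, a change of the Weyl structure changes the Schouten-Weyl tensor by `-Q`. -/
theorem schouten_sub [T2Space M] (S : LowDimStructure C) (h₁ : IsWeyl C cov₁) (h₂ : IsWeyl C cov₂)
    (hm : m ≠ 0) (g : C.metrics) (x : M) (u v : EuclideanSpace ℝ (Fin m)) :
    schouten S g cov₂ x u v =
      schouten S g cov₁ x u v - weylChange (g : Metric m M) cov₁ cov₂ x u v := by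
  unfold schouten
  have hm' : (m : ℝ) ≠ 0 := by exact_mod_cast hm
  by_cases hm1 : m = 1
  · rw [dif_pos hm1, dif_pos hm1, (S.laplace hm1).scalar_sub h₁ h₂ hm1]
    have h := (isBilin_weylChange (g := (g : Metric m M)) (cov₁ := cov₁) (cov₂ := cov₂)
      (x := x)).eq_trg_mul hm1 g x u v
    linear_combination h
  rw [dif_neg hm1, dif_neg hm1]
  have hm1' : (m : ℝ) - 1 ≠ 0 := by
    intro h
    exact hm1 (by exact_mod_cast sub_eq_zero.1 h)
  have hF := faraday_sub h₁ h₂ hm g.2 x u v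
  have hs := scal_sub h₁ h₂ hm g.2 x
  by_cases hm2 : m = 2
  · rw [dif_pos hm2, dif_pos hm2, (S.mobius hm2).form_sub h₁ h₂ hm g.2 x u v, hF, hs, symTraceFree]
    have : (m : ℝ) = 2 := by exact_mod_cast hm2
    rw [this]
    ring
  · rw [dif_neg hm2, dif_neg hm2, ric₀_sub h₁ h₂ hm g.2 x u v, hF, hs, symTraceFree]
    have hm2' : (m : ℝ) - 2 ≠ 0 := by
      intro h
      exact hm2 (by exact_mod_cast sub_eq_zero.1 h)
    field_simp
    ring

theorem scal_mul_inner_rescale (hg : g ∈ C.metrics) (hg' : g' ∈ C.metrics) (x : M)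
    (u v : EuclideanSpace ℝ (Fin m)) :
    scal g' cov x * g'.inner x u v = scal g cov x * g.inner x u v := by
  obtain ⟨f, hf⟩ := (C.mem_iff g hg g').1 hg'
  exact trg_mul_inner_rescale hf _ u v

/-- The Schouten tensor does not depend on the metric used to write it. -/
theorem schouten_rescale [T2Space M] (S : LowDimStructure C) (h : IsWeyl C cov)
    (g g' : C.metrics) (x : M) (u v : EuclideanSpace ℝ (Fin m)) :
    schouten S g' cov x u v = schouten S g cov x u v := by
  unfold schouten
  have hs := scal_mul_inner_rescale (cov := cov) g.2 g'.2 x u v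
  by_cases hm1 : m = 1
  · obtain ⟨f, hf⟩ := (C.mem_iff g g.2 g').1 g'.2
    rw [dif_pos hm1, dif_pos hm1, (S.laplace hm1).scalar_rescale h hm1 g g' hf]
    have hi := hf.2 x u v
    have h3 : Real.exp (2 * f x) * Real.exp (-2 * f x) = 1 := by
      rw [← Real.exp_add]; simp
    linear_combination ((S.laplace hm1).scalar cov g x * (g : Metric m M).inner x u v) * h3
      + (Real.exp (-2 * f x) * (S.laplace hm1).scalar cov g x) * hi
  rw [dif_neg hm1, dif_neg hm1]
  by_cases hm2 : m = 2
  · rw [dif_pos hm2, dif_pos hm2]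
    linear_combination (1 / 4) * hs
  · rw [dif_neg hm2, dif_neg hm2]
    have h1 : ric₀ (g' : Metric m M) cov x u v = ric₀ (g : Metric m M) cov x u v :=
      congrFun (congrFun (symTraceFree_rescale g.2 g'.2 (x := x) (ric cov x)) u) v
    linear_combination 1 / ((m : ℝ) - 2) * h1 + 1 / (2 * (m : ℝ) * ((m : ℝ) - 1)) * hs

/-- The skew part of the Schouten tensor is `-½ dθ`. -/
theorem schouten_skew [T2Space M] (S : LowDimStructure C) (h : IsWeyl C cov)
    (hm : m ≠ 0) (g : C.metrics) (x : M) (u v : EuclideanSpace ℝ (Fin m)) :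
    schouten S g cov x u v - schouten S g cov x v u =
      -(fderiv ℝ (localLee (g : Metric m M) cov x) (extChartAt (𝓡 m) x x) u v
        - fderiv ℝ (localLee (g : Metric m M) cov x) (extChartAt (𝓡 m) x x) v u) := by
  unfold schouten
  have hi : (g : Metric m M).inner x v u = (g : Metric m M).inner x u v := g.1.symm _ _ _
  by_cases hm1 : m = 1
  · rw [dif_pos hm1, dif_pos hm1, hi]
    have hB : IsBilin fun u v => fderiv ℝ (localLee (g : Metric m M) cov x) (extChartAt (𝓡 m) x x) u v :=
      ⟨toBilin _, fun _ _ => rfl⟩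
    have h1 := hB.eq_trg_mul hm1 g x u v
    have h2 := hB.eq_trg_mul hm1 g x v u
    rw [hi] at h2
    linear_combination h1 - h2
  rw [dif_neg hm1, dif_neg hm1]
  have hF : ∀ u v : EuclideanSpace ℝ (Fin m), faraday cov x u v =
      fderiv ℝ (localLee (g : Metric m M) cov x) (extChartAt (𝓡 m) x x) u v
        - fderiv ℝ (localLee (g : Metric m M) cov x) (extChartAt (𝓡 m) x x) v u := fun u v =>
    (faraday_eq_localFaraday (h.hasChristoffel x) u v).trans
      ((h.isLocalWeyl hm g.2 x).localFaraday_eq _ hm u v)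
  have hF1 := hF u v
  have hF2 := hF v u
  by_cases hm2 : m = 2
  · rw [dif_pos hm2, dif_pos hm2, hi]
    obtain ⟨A, -, hs, hA⟩ := (S.mobius hm2).exists_form_eq h hm g.2 x
    have h1 := hA u v
    have h2 := hA v u
    have h3 := hs u v
    linear_combination h1 - h2 + h3 - 1 / 2 * hF1 + 1 / 2 * hF2
  · rw [dif_neg hm2, dif_neg hm2, hi]
    have h3 : ric₀ (g : Metric m M) cov x u v = ric₀ (g : Metric m M) cov x v u :=
      symTraceFree_symm (ric cov x) u v
    rw [h3]
    linear_combination - 1 / 2 * hF1 + 1 / 2 * hF2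

theorem isBilin_localCurv_apply {V : Type*} [NormedAddCommGroup V] [NormedSpace ℝ V]
    (Γ : V → V →L[ℝ] V →L[ℝ] V) (z w : V) (f : V →ₗ[ℝ] ℝ) :
    IsBilin fun u v => f (localCurv Γ z u v w) :=
  ⟨LinearMap.mk₂ ℝ (fun u v => f (localCurv Γ z u v w))
    (fun u u' v => by simp only [localCurv, map_add, _root_.add_apply, map_sub]; ring)
    (fun c u v => by simp only [localCurv, map_smul, _root_.smul_apply, map_add, map_sub, smul_eq_mul]; ring)
    (fun u u' v => by simp only [localCurv, map_add, _root_.add_apply, map_sub]; ring)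
    (fun c u v => by simp only [localCurv, map_smul, _root_.smul_apply, map_add, map_sub, smul_eq_mul]; ring),
    fun _ _ => rfl⟩

theorem isBilin_localCurv_apply' {V : Type*} [NormedAddCommGroup V] [NormedSpace ℝ V]
    (Γ : V → V →L[ℝ] V →L[ℝ] V) (z w : V) (f : V →ₗ[ℝ] ℝ) :
    IsBilin fun u v => f (localCurv Γ z w u v) :=
  ⟨LinearMap.mk₂ ℝ (fun u v => f (localCurv Γ z w u v))
    (fun u u' v => by simp only [localCurv, map_add, _root_.add_apply, map_sub]; ring)
    (fun c u v => by simp only [localCurv, map_smul, _root_.smul_apply, map_add, map_sub, smul_eq_mul]; ring)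
    (fun u u' v => by simp only [localCurv, map_add, map_sub]; ring)
    (fun c u v => by simp only [localCurv, map_smul, map_add, map_sub, smul_eq_mul]; ring),
    fun _ _ => rfl⟩

theorem IsWeyl.isBilin_ric (h : IsWeyl C cov) (x : M) :
    IsBilin (V := EuclideanSpace ℝ (Fin m)) (ric cov x) := by
  have h1 := IsBilin.sum Finset.univ fun i => isBilin_localCurv_apply' (christoffel cov x)
    (extChartAt (𝓡 m) x x) ((EuclideanSpace.basisFun (Fin m) ℝ).toBasis i)
    ((EuclideanSpace.basisFun (Fin m) ℝ).toBasis.coord i)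
  obtain ⟨L, hL⟩ := h1
  exact ⟨L, fun u v => (hL u v).trans (ric_eq_localRic (h.hasChristoffel x) u v).symm⟩

theorem IsWeyl.isBilin_faraday (h : IsWeyl C cov) (x : M) :
    IsBilin (V := EuclideanSpace ℝ (Fin m)) (faraday cov x) := by
  have h1 := (IsBilin.sum Finset.univ fun i => isBilin_localCurv_apply (christoffel cov x)
    (extChartAt (𝓡 m) x x) ((EuclideanSpace.basisFun (Fin m) ℝ).toBasis i)
    ((EuclideanSpace.basisFun (Fin m) ℝ).toBasis.coord i)).const_mul (1 / m)
  obtain ⟨L, hL⟩ := h1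
  exact ⟨L, fun u v => (hL u v).trans (faraday_eq_localFaraday (h.hasChristoffel x) u v).symm⟩

theorem isBilin_schouten [T2Space M] (S : LowDimStructure C) (h : IsWeyl C cov)
    (hm : m ≠ 0) (g : C.metrics) (x : M) :
    IsBilin (V := EuclideanSpace ℝ (Fin m)) (schouten S g cov x) := by
  unfold schouten
  by_cases hm1 : m = 1
  · simp only [dif_pos hm1]
    exact (isBilin_inner (g : Metric m M) x).const_mul _
  simp only [dif_neg hm1]
  by_cases hm2 : m = 2
  · simp only [dif_pos hm2]
    obtain ⟨A, ⟨L, hL⟩, -, hA⟩ := (S.mobius hm2).exists_form_eq h hm g.2 x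
    have hF : IsBilin (V := EuclideanSpace ℝ (Fin m)) ((S.mobius hm2).form cov x) :=
      ⟨L, fun u v => (hL u v).trans (hA u v).symm⟩
    exact (hF.add ((isBilin_inner (g : Metric m M) x).const_mul _)).sub
      ((h.isBilin_faraday x).const_mul _)
  · simp only [dif_neg hm2]
    exact (((isBilin_symTraceFree (h.isBilin_ric x)).const_mul _).add
      ((isBilin_inner (g : Metric m M) x).const_mul _)).sub ((h.isBilin_faraday x).const_mul _)

end Charts

/-! ### The tangential projection and immersions -/

section LinearAlgebra
variable {k : ℕ} {V : Type*} [AddCommGroup V] [Module ℝ V]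

/-- The vector with components `q^{ij} f(b_j)` is dual to `f`. -/
theorem sum_gram_inv_smul (b : Module.Basis (Fin k) ℝ V) {q : V →ₗ[ℝ] V →ₗ[ℝ] ℝ}
    (hq : ∀ v, v ≠ 0 → 0 < q v v) (hs : ∀ u v, q u v = q v u) (f : V →ₗ[ℝ] ℝ) (w : V) :
    q (∑ i, ∑ j, ((gram b fun u v => q u v)⁻¹ i j * f (b j)) • b i) w = f w := by
  have hU := isUnit_gram_det b hq
  have key : ∀ l, q (∑ i, ∑ j, ((gram b fun u v => q u v)⁻¹ i j * f (b j)) • b i) (b l) = f (b l) := by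
    intro l
    have h1 : ∀ i j, (gram b fun u v => q u v) i j = q (b i) (b j) := fun _ _ => rfl
    have h2 : ∑ i, ∑ j, (gram b fun u v => q u v) l i *
        ((gram b fun u v => q u v)⁻¹ i j * f (b j)) = f (b l) := by
      rw [Finset.sum_comm]
      have h3 := Matrix.mul_nonsing_inv _ hU
      have h4 : ∀ j, ∑ i, (gram b fun u v => q u v) l i * (gram b fun u v => q u v)⁻¹ i j
          = (1 : Matrix (Fin k) (Fin k) ℝ) l j := fun j => by
        rw [← h3, Matrix.mul_apply]
      calc _ = ∑ j, (∑ i, (gram b fun u v => q u v) l i * (gram b fun u v => q u v)⁻¹ i j) * f (b j) := by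
            refine Finset.sum_congr rfl fun j _ => ?_
            rw [Finset.sum_mul]
            exact Finset.sum_congr rfl fun i _ => by ring
        _ = f (b l) := by
            simp only [h4, Matrix.one_apply, ite_mul, one_mul, zero_mul]
            simp
    rw [← h2]
    simp only [map_sum, LinearMap.sum_apply, map_smul, LinearMap.smul_apply, smul_eq_mul, h1, hs (b l)]
    refine Finset.sum_congr rfl fun i _ => Finset.sum_congr rfl fun j _ => by ring
  have h := b.ext (f₁ := q (∑ i, ∑ j, ((gram b fun u v => q u v)⁻¹ i j * f (b j)) • b i)) (f₂ := f) key
  rw [h]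
end LinearAlgebra

section Immersion
variable {m n : ℕ}
  {M : Type*} [TopologicalSpace M] [ChartedSpace (EuclideanSpace ℝ (Fin m)) M]
  [IsManifold (𝓡 m) ∞ M]
  {N : Type*} [TopologicalSpace N] [ChartedSpace (EuclideanSpace ℝ (Fin n)) N]
  [IsManifold (𝓡 n) ∞ N] {φ : N → M}

/-- The differential of an immersion is injective. -/
theorem mfderiv_injective_of_isImmersionAt {x : N} (h : IsImmersionAt (𝓡 n) (𝓡 m) ∞ φ x) :
    Function.Injective (mfderiv (𝓡 n) (𝓡 m) φ x) := by
  let r : M → N := fun p => (h.domChart.extend (𝓡 n)).symm (h.equiv.symm (h.codChart.extend (𝓡 m) p)).1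
  have hsrc : h.domChart.source ∈ 𝓝 x := h.domChart.open_source.mem_nhds h.mem_domChart_source
  have hr : r ∘ φ =ᶠ[𝓝 x] id := by
    filter_upwards [hsrc] with y hy
    have hy' : y ∈ (h.domChart.extend (𝓡 n)).source := by
      rwa [OpenPartialHomeomorph.extend_source]
    have h1 := h.writtenInCharts ((h.domChart.extend (𝓡 n)).map_source hy')
    simp only [Function.comp_apply, (h.domChart.extend (𝓡 n)).left_inv hy'] at h1
    simp only [r, Function.comp_apply, h1, ContinuousLinearEquiv.symm_apply_apply, id]
    exact (h.domChart.extend (𝓡 n)).left_inv hy'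
  have hφ : MDifferentiableAt (𝓡 n) (𝓡 m) φ x := h.contMDiffAt.mdifferentiableAt (by simp)
  have hx : x ∈ (h.domChart.extend (𝓡 n)).source := by
    rw [OpenPartialHomeomorph.extend_source]; exact h.mem_domChart_source
  have hval : (h.equiv.symm (h.codChart.extend (𝓡 m) (φ x))).1 = h.domChart.extend (𝓡 n) x := by
    have h1 := h.writtenInCharts ((h.domChart.extend (𝓡 n)).map_source hx)
    simp only [Function.comp_apply, (h.domChart.extend (𝓡 n)).left_inv hx] at h1
    rw [h1, ContinuousLinearEquiv.symm_apply_apply]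
  have hrd : MDifferentiableAt (𝓡 m) (𝓡 n) r (φ x) := by
    have h1 : ContMDiffAt (𝓡 m) 𝓘(ℝ, EuclideanSpace ℝ (Fin m)) ∞ (h.codChart.extend (𝓡 m)) (φ x) :=
      (OpenPartialHomeomorph.contMDiffOn_extend h.codChart_mem_maximalAtlas).contMDiffAt
        (h.codChart.open_source.mem_nhds h.mem_codChart_source)
    let L : EuclideanSpace ℝ (Fin m) →L[ℝ] EuclideanSpace ℝ (Fin n) :=
      (ContinuousLinearMap.fst ℝ (EuclideanSpace ℝ (Fin n)) h.complement).comp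
        (h.equiv.symm : EuclideanSpace ℝ (Fin m) →L[ℝ] EuclideanSpace ℝ (Fin n) × h.complement)
    have h2 : MDifferentiableAt (𝓡 m) 𝓘(ℝ, EuclideanSpace ℝ (Fin n))
        (fun p => (h.equiv.symm (h.codChart.extend (𝓡 m) p)).1) (φ x) :=
      L.differentiableAt.mdifferentiableAt.comp (φ x) (h1.mdifferentiableAt (by simp))
    have h3 : ContMDiffAt 𝓘(ℝ, EuclideanSpace ℝ (Fin n)) (𝓡 n) ∞ (h.domChart.extend (𝓡 n)).symm
        (h.equiv.symm (h.codChart.extend (𝓡 m) (φ x))).1 := by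
      rw [hval]
      exact (contMDiffOn_extend_symm h.domChart_mem_maximalAtlas).contMDiffAt (by
        simp only [modelWithCornersSelf_coe, Set.image_id]
        exact h.domChart.open_target.mem_nhds (h.domChart.map_source h.mem_domChart_source))
    exact MDifferentiableAt.comp (f := fun p => (h.equiv.symm (h.codChart.extend (𝓡 m) p)).1) (φ x)
      (h3.mdifferentiableAt (by simp)) h2
  have hcomp := (mfderiv_comp x hrd hφ).symm.trans hr.mfderiv_eq
  rw [mfderiv_id] at hcomp
  intro v w hvw
  have h1 := congrArg (fun L => L v) hcomp
  have h2 := congrArg (fun L => L w) hcomp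
  exact h1.symm.trans ((congrArg (mfderiv (𝓡 m) (𝓡 n) r (φ x)) hvw).trans h2)

end Immersion

/-! ### Submanifolds in charts -/

section Submanifold
variable {m n : ℕ}
  {M : Type*} [TopologicalSpace M] [ChartedSpace (EuclideanSpace ℝ (Fin m)) M]
  [IsManifold (𝓡 m) ∞ M]
  {N : Type*} [TopologicalSpace N] [ChartedSpace (EuclideanSpace ℝ (Fin n)) N]
  [IsManifold (𝓡 n) ∞ N] {φ : N → M} {x₀ y : N}

variable (φ x₀) in
/-- A map read in the charts centred at `x₀` and `φ x₀`. -/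
def mapInCharts : EuclideanSpace ℝ (Fin n) → EuclideanSpace ℝ (Fin m) :=
  inChart x₀ fun y => extChartAt (𝓡 m) (φ x₀) (φ y)

theorem mapInCharts_apply (hy : y ∈ (chartAt (EuclideanSpace ℝ (Fin n)) x₀).source) :
    mapInCharts φ x₀ (extChartAt (𝓡 n) x₀ y) = extChartAt (𝓡 m) (φ x₀) (φ y) :=
  inChart_apply _ hy

theorem contDiffAt_mapInCharts (hφ : ContMDiff (𝓡 n) (𝓡 m) ∞ φ)
    (hy : y ∈ (chartAt (EuclideanSpace ℝ (Fin n)) x₀).source)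
    (hy' : φ y ∈ (chartAt (EuclideanSpace ℝ (Fin m)) (φ x₀)).source) :
    ContDiffAt ℝ ∞ (mapInCharts (m := m) φ x₀) (extChartAt (𝓡 n) x₀ y) :=
  contDiffAt_inChart le_rfl hy ((contMDiffAt_extChartAt' hy').comp y (hφ y))

theorem eventually_map_mem_source (hφ : ContMDiff (𝓡 n) (𝓡 m) ∞ φ) (x₀ : N) :
    ∀ᶠ y in 𝓝 x₀, φ y ∈ (chartAt (EuclideanSpace ℝ (Fin m)) (φ x₀)).source :=
  hφ.continuous.continuousAt.eventually (eventually_mem_source (m := m) (φ x₀))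

theorem coframe_mfderiv (hφ : ContMDiff (𝓡 n) (𝓡 m) ∞ φ)
    (hy : y ∈ (chartAt (EuclideanSpace ℝ (Fin n)) x₀).source)
    (hy' : φ y ∈ (chartAt (EuclideanSpace ℝ (Fin m)) (φ x₀)).source) (a : EuclideanSpace ℝ (Fin n)) :
    coframe (φ x₀) (φ y) (mfderiv (𝓡 n) (𝓡 m) φ y (frame x₀ y a)) =
      fderiv ℝ (mapInCharts φ x₀) (extChartAt (𝓡 n) x₀ y) a := by
  have h1 := (mfderiv_extChartAt hy').comp y ((hφ y).mdifferentiableAt (by simp)).hasMFDerivAt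
  have h2 := hasMFDerivAt_of_inChart (f := fun y => extChartAt (𝓡 m) (φ x₀) (φ y)) hy
    (contDiffAt_mapInCharts hφ hy hy').differentiableAt_infty
  have h3 := hasMFDerivAt_unique h1 h2
  have h4 := congrArg (fun L => L (frame x₀ y a)) h3
  refine h4.trans ?_
  exact congrArg (fderiv ℝ (mapInCharts φ x₀) (extChartAt (𝓡 n) x₀ y)) (coframe_frame hy a)

theorem mfderiv_frame (hφ : ContMDiff (𝓡 n) (𝓡 m) ∞ φ)
    (hy : y ∈ (chartAt (EuclideanSpace ℝ (Fin n)) x₀).source)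
    (hy' : φ y ∈ (chartAt (EuclideanSpace ℝ (Fin m)) (φ x₀)).source) (a : EuclideanSpace ℝ (Fin n)) :
    mfderiv (𝓡 n) (𝓡 m) φ y (frame x₀ y a) =
      frame (φ x₀) (φ y) (fderiv ℝ (mapInCharts φ x₀) (extChartAt (𝓡 n) x₀ y) a) := by
  rw [← coframe_mfderiv hφ hy hy', frame_coframe hy']

theorem localMetric_apply_chart {p₀ p : M} (g : Metric m M)
    (hp : p ∈ (chartAt (EuclideanSpace ℝ (Fin m)) p₀).source) (a b : EuclideanSpace ℝ (Fin m)) :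
    localMetric p₀ g (extChartAt (𝓡 m) p₀ p) a b = g.inner p (frame p₀ p a) (frame p₀ p b) :=
  inChart_apply (fun y => g.inner y (frame p₀ y a) (frame p₀ y b)) hp

theorem pullMetric_mapInCharts (hφ : ContMDiff (𝓡 n) (𝓡 m) ∞ φ) (g : Metric m M)
    (hy : y ∈ (chartAt (EuclideanSpace ℝ (Fin n)) x₀).source)
    (hy' : φ y ∈ (chartAt (EuclideanSpace ℝ (Fin m)) (φ x₀)).source)
    (a b : EuclideanSpace ℝ (Fin n)) :
    pullMetric (mapInCharts φ x₀) (localMetric (φ x₀) g) (extChartAt (𝓡 n) x₀ y) a b =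
      pullbackForm g φ y (frame x₀ y a) (frame x₀ y b) := by
  rw [pullMetric, pullBilin_apply, mapInCharts_apply hy, localMetric_apply_chart g hy',
    pullbackForm, mfderiv_frame hφ hy hy', mfderiv_frame hφ hy hy']

theorem fderiv_mapInCharts_injective (hφ : ContMDiff (𝓡 n) (𝓡 m) ∞ φ)
    (hinj : Function.Injective (mfderiv (𝓡 n) (𝓡 m) φ y))
    (hy : y ∈ (chartAt (EuclideanSpace ℝ (Fin n)) x₀).source)
    (hy' : φ y ∈ (chartAt (EuclideanSpace ℝ (Fin m)) (φ x₀)).source) :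
    Function.Injective (fderiv ℝ (mapInCharts (m := m) φ x₀) (extChartAt (𝓡 n) x₀ y)) := by
  intro a b hab
  have h1 : mfderiv (𝓡 n) (𝓡 m) φ y (frame x₀ y a) = mfderiv (𝓡 n) (𝓡 m) φ y (frame x₀ y b) := by
    rw [mfderiv_frame hφ hy hy', mfderiv_frame hφ hy hy', hab]
  exact (coframe_frame hy a).symm.trans ((congrArg (coframe x₀ y) (hinj h1)).trans (coframe_frame hy b))

/-- The tangential part is characterized by its inner products with tangent vectors. -/
theorem pullbackForm_tanPart (g : Metric m M)
    (hinj : Function.Injective (mfderiv (𝓡 n) (𝓡 m) φ y)) (A : TangentSpace (𝓡 m) (φ y))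
    (w : TangentSpace (𝓡 n) y) :
    pullbackForm g φ y (tanPart (n := n) g φ y A) w = g.inner (φ y) A (mfderiv (𝓡 n) (𝓡 m) φ y w) := by
  let D : EuclideanSpace ℝ (Fin n) →L[ℝ] EuclideanSpace ℝ (Fin m) := mfderiv (𝓡 n) (𝓡 m) φ y
  let G : EuclideanSpace ℝ (Fin m) →L[ℝ] EuclideanSpace ℝ (Fin m) →L[ℝ] ℝ := g.inner (φ y)
  have h := sum_gram_inv_smul (EuclideanSpace.basisFun (Fin n) ℝ).toBasis
    (q := toBilin (pullBilin G D)) (fun v hv => g.pos (φ y) (D v) fun h0 => hv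
      (hinj (h0.trans (map_zero D).symm))) (fun u v => g.symm _ _ _)
    (((G A).comp D : EuclideanSpace ℝ (Fin n) →L[ℝ] ℝ) : EuclideanSpace ℝ (Fin n) →ₗ[ℝ] ℝ) w
  refine Eq.trans ?_ h
  refine congrArg (fun s => pullbackForm g φ y s w) ?_
  refine (_root_.sum_apply _ _ _).trans (Finset.sum_congr rfl fun i _ => ?_)
  refine (_root_.sum_apply _ _ _).trans (Finset.sum_congr rfl fun j _ => ?_)
  refine Eq.trans ?_ (smul_smul _ _ _)
  refine congrArg (fun t : ℝ => (gram (stdBasis (m := n) y) (pullbackForm (n := n) g φ y))⁻¹ i j •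
    t • stdBasis (m := n) y i) ?_
  exact g.symm _ _ _

theorem coframe_tanPart (hφ : ContMDiff (𝓡 n) (𝓡 m) ∞ φ) (g : Metric m M)
    (hinj : Function.Injective (mfderiv (𝓡 n) (𝓡 m) φ y))
    (hy : y ∈ (chartAt (EuclideanSpace ℝ (Fin n)) x₀).source)
    (hy' : φ y ∈ (chartAt (EuclideanSpace ℝ (Fin m)) (φ x₀)).source) (A : TangentSpace (𝓡 m) (φ y)) :
    coframe x₀ y (tanPart (n := n) g φ y A) =
      tanProj (mapInCharts φ x₀) (localMetric (φ x₀) g) (extChartAt (𝓡 n) x₀ y)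
        (coframe (φ x₀) (φ y) A) := by
  have hI : (pullMetric (mapInCharts φ x₀) (localMetric (φ x₀) g)
      (extChartAt (𝓡 n) x₀ y)).IsInvertible := by
    refine pullMetric_isInvertible (fun a ha => ?_) (fderiv_mapInCharts_injective hφ hinj hy hy')
    rw [mapInCharts_apply hy, localMetric_apply_chart g hy']
    exact g.pos _ _ fun h0 => ha
      ((coframe_frame hy' a).symm.trans ((congrArg (coframe (φ x₀) (φ y)) h0).trans (map_zero _)))
  apply hI.injective
  ext c
  rw [pullMetric_tanProj hI, pullMetric_mapInCharts hφ g hy hy', frame_coframe hy,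
    pullbackForm_tanPart g hinj, mapInCharts_apply hy, localMetric_apply_chart g hy',
    frame_coframe hy', mfderiv_frame hφ hy hy']

end Submanifold

/-! ### Covariant derivatives along a map -/

section Transition
variable {m : ℕ}
  {M : Type*} [TopologicalSpace M] [ChartedSpace (EuclideanSpace ℝ (Fin m)) M]
  [IsManifold (𝓡 m) ∞ M] {p₀ p q : M}

/-- The change of coordinates of tangent vectors from the chart centred at `p₀` to the chart centred
at `p`, as a function of the coordinates of the base point in the chart centred at `p₀`. -/
def transition (p₀ p : M) : EuclideanSpace ℝ (Fin m) →
    EuclideanSpace ℝ (Fin m) →L[ℝ] EuclideanSpace ℝ (Fin m) :=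
  inChart p₀ fun q => (coframe p q).comp (frame p₀ q)

theorem transition_apply (hq : q ∈ (chartAt (EuclideanSpace ℝ (Fin m)) p₀).source)
    (a : EuclideanSpace ℝ (Fin m)) :
    transition p₀ p (extChartAt (𝓡 m) p₀ q) a = coframe p q (frame p₀ q a) := by
  rw [transition, inChart_apply _ hq]
  rfl

theorem contDiffAt_transition (hp : p ∈ (chartAt (EuclideanSpace ℝ (Fin m)) p₀).source) :
    ContDiffAt ℝ ∞ (transition p₀ p) (extChartAt (𝓡 m) p₀ p) :=
  contDiffAt_clm_of_apply fun a => contDiffAt_inChart (f := fun q => coframe p q (frame p₀ q a))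
    le_rfl hp (contMDiffAt_coframe_apply (mem_chart_source _ p) (contMDiffAt_frame hp a))

/-- The derivative of the coordinates of a vector field that is constant in the chart centred
at `p`. -/
theorem fderiv_transition (hp : p ∈ (chartAt (EuclideanSpace ℝ (Fin m)) p₀).source)
    (w : TangentSpace (𝓡 m) p) (b : EuclideanSpace ℝ (Fin m)) :
    frame p₀ p (fderiv ℝ (localField p₀ (extend (EuclideanSpace ℝ (Fin m)) w))
      (extChartAt (𝓡 m) p₀ p) b) =
      -fderiv ℝ (transition p₀ p) (extChartAt (𝓡 m) p₀ p) b (coframe p₀ p w) := by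
  have hpp := mem_chart_source (EuclideanSpace ℝ (Fin m)) p
  have hT := (contDiffAt_transition hp).differentiableAt_infty
  have hW : DifferentiableAt ℝ (localField p₀ (extend (EuclideanSpace ℝ (Fin m)) w))
      (extChartAt (𝓡 m) p₀ p) :=
    (mdifferentiableAt_field_iff hp).1 (mdifferentiableAt_extend (𝓡 m) (EuclideanSpace ℝ (Fin m)) w)
  let w' : EuclideanSpace ℝ (Fin m) := w
  have hc : (fun z => transition p₀ p z (localField p₀ (extend (EuclideanSpace ℝ (Fin m)) w) z))
      =ᶠ[𝓝 (extChartAt (𝓡 m) p₀ p)] fun _ => w' := by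
    have h1 : ∀ᶠ q in 𝓝 p, coframe p q (frame p₀ q (coframe p₀ q
        ((extend (EuclideanSpace ℝ (Fin m)) w : Π q, TangentSpace (𝓡 m) q) q))) = w' := by
      filter_upwards [eventually_mem_source (m := m) p,
        (chartAt (EuclideanSpace ℝ (Fin m)) p₀).open_source.mem_nhds hp] with q hq hq'
      rw [frame_coframe hq', extend_eq_frame hq]
      exact coframe_frame hq w'
    exact (tendsto_symm hp).eventually h1
  have h1 := hc.fderiv_eq (𝕜 := ℝ)
  rw [fderiv_clm_apply hT hW] at h1
  have h2 := congrArg (fun L => L b) h1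
  simp only [_root_.add_apply, ContinuousLinearMap.comp_apply, ContinuousLinearMap.flip_apply,
    fderiv_fun_const, Pi.zero_apply, _root_.zero_apply] at h2
  rw [transition_apply hp] at h2
  have h3 : localField p₀ (extend (EuclideanSpace ℝ (Fin m)) w) (extChartAt (𝓡 m) p₀ p) =
      coframe p₀ p w := by
    refine (inChart_apply _ hp).trans ?_
    rw [extend_eq_frame hpp]
    exact congrArg (coframe p₀ p) (frame_self w)
  rw [h3] at h2
  have h4 := (coframe_self (x₀ := p) (frame p₀ p (fderiv ℝ (localField p₀
    (extend (EuclideanSpace ℝ (Fin m)) w)) (extChartAt (𝓡 m) p₀ p) b))).symm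
  exact h4.trans (eq_neg_of_add_eq_zero_left h2)

end Transition

section Submanifold
variable {m n : ℕ}
  {M : Type*} [TopologicalSpace M] [ChartedSpace (EuclideanSpace ℝ (Fin m)) M]
  [IsManifold (𝓡 m) ∞ M]
  {N : Type*} [TopologicalSpace N] [ChartedSpace (EuclideanSpace ℝ (Fin n)) N]
  [IsManifold (𝓡 n) ∞ N] {φ : N → M} {x₀ y : N} {cov : ConnOp m M}
  {Γ : EuclideanSpace ℝ (Fin m) → EuclideanSpace ℝ (Fin m) →L[ℝ]
      EuclideanSpace ℝ (Fin m) →L[ℝ] EuclideanSpace ℝ (Fin m)}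

variable (φ x₀) in
/-- The coordinates of a vector field along `φ`. -/
def localFieldAlong (s : Π y : N, TangentSpace (𝓡 m) (φ y)) :
    EuclideanSpace ℝ (Fin n) → EuclideanSpace ℝ (Fin m) :=
  inChart x₀ fun y => coframe (φ x₀) (φ y) (s y)

/-- The covariant derivative along `φ` at `y` is defined by the chart centred at `φ y`; it has the same
expression in the chart centred at `φ x₀`. -/
theorem HasChristoffel.coframe_covAlong (h : HasChristoffel cov (φ x₀) Γ)
    (hφ : ContMDiff (𝓡 n) (𝓡 m) ∞ φ) :
    ∀ᶠ y in 𝓝 x₀, ∀ s : Π y : N, TangentSpace (𝓡 m) (φ y),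
      DifferentiableAt ℝ (localFieldAlong φ x₀ s) (extChartAt (𝓡 n) x₀ y) → ∀ a,
      coframe (φ x₀) (φ y) (covAlong (n := n) cov φ s y (frame x₀ y a)) =
        fderiv ℝ (localFieldAlong φ x₀ s) (extChartAt (𝓡 n) x₀ y) a
          + Γ (extChartAt (𝓡 m) (φ x₀) (φ y))
            (fderiv ℝ (mapInCharts φ x₀) (extChartAt (𝓡 n) x₀ y) a)
            (coframe (φ x₀) (φ y) (s y)) := by
  filter_upwards [hφ.continuous.continuousAt.eventually h.eq, eventually_mem_source (m := n) x₀,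
    eventually_map_mem_source hφ x₀] with y hcov hy hy' s hs a
  have hyy := mem_chart_source (EuclideanSpace ℝ (Fin n)) y
  have hF := (contDiffAt_mapInCharts hφ hy hy').differentiableAt_infty
  have hT : DifferentiableAt ℝ (transition (m := m) (φ x₀) (φ y)) (mapInCharts φ x₀ (extChartAt (𝓡 n) x₀ y)) := by
    rw [mapInCharts_apply hy]
    exact (contDiffAt_transition hy').differentiableAt_infty
  have hsy : localFieldAlong φ x₀ s (extChartAt (𝓡 n) x₀ y) = coframe (φ x₀) (φ y) (s y) :=
    inChart_apply _ hy
  -- the coordinates of `s` in the chart centred at `φ y`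
  have hS : inChart x₀ (fun y' => (trivializationAt (EuclideanSpace ℝ (Fin m))
        (TangentSpace (𝓡 m) : M → Type _) (φ y) (TotalSpace.mk' _ (φ y') (s y'))).2)
      =ᶠ[𝓝 (extChartAt (𝓡 n) x₀ y)] fun z =>
        transition (φ x₀) (φ y) (mapInCharts φ x₀ z) (localFieldAlong φ x₀ s z) := by
    have h1 : ∀ᶠ y' in 𝓝 y, (trivializationAt (EuclideanSpace ℝ (Fin m))
        (TangentSpace (𝓡 m) : M → Type _) (φ y) (TotalSpace.mk' _ (φ y') (s y'))).2 =
        transition (φ x₀) (φ y) (extChartAt (𝓡 m) (φ x₀) (φ y'))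
          (coframe (φ x₀) (φ y') (s y')) := by
      filter_upwards [eventually_map_mem_source hφ y, hφ.continuous.continuousAt.eventually
        ((chartAt (EuclideanSpace ℝ (Fin m)) (φ x₀)).open_source.mem_nhds hy')] with y' h1 h2
      rw [transition_apply h2, frame_coframe h2, coframe_apply h1]
    exact (tendsto_symm hy).eventually h1
  have hTF := hT.comp _ hF
  have h1 := mvfderiv_frame hy (hS.differentiableAt_iff.2 (hTF.clm_apply hs)) a
  rw [hS.fderiv_eq] at h1
  have h2 : fderiv ℝ (fun z => transition (φ x₀) (φ y) (mapInCharts φ x₀ z)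
      (localFieldAlong φ x₀ s z)) (extChartAt (𝓡 n) x₀ y) a =
      fderiv ℝ (transition (φ x₀) (φ y)) (extChartAt (𝓡 m) (φ x₀) (φ y))
        (fderiv ℝ (mapInCharts φ x₀) (extChartAt (𝓡 n) x₀ y) a) (coframe (φ x₀) (φ y) (s y))
      + transition (φ x₀) (φ y) (extChartAt (𝓡 m) (φ x₀) (φ y))
        (fderiv ℝ (localFieldAlong φ x₀ s) (extChartAt (𝓡 n) x₀ y) a) := by
    have h3 := fderiv_clm_apply hTF hs
    have h4 := congrArg (fun L => L a) h3
    refine h4.trans ?_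
    rw [fderiv_comp _ hT hF]
    simp only [_root_.add_apply, ContinuousLinearMap.comp_apply, ContinuousLinearMap.flip_apply,
      Function.comp_apply, hsy]
    rw [mapInCharts_apply hy, add_comm]
  have h5 := hcov (extend (EuclideanSpace ℝ (Fin m)) (s y))
    (mdifferentiableAt_extend (𝓡 m) (EuclideanSpace ℝ (Fin m)) (s y))
    (fderiv ℝ (mapInCharts φ x₀) (extChartAt (𝓡 n) x₀ y) a)
  have h6 : (extend (EuclideanSpace ℝ (Fin m)) (s y) : Π q, TangentSpace (𝓡 m) q) (φ y) = s y :=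
    (extend_eq_frame (mem_chart_source _ _) (s y)).trans (frame_self (s y))
  rw [h6] at h5
  have h7 : covAlong (n := n) cov φ s y (frame x₀ y a) =
      (frame (φ y) (φ y) (mvfderiv (𝓡 n) (fun y' => (trivializationAt (EuclideanSpace ℝ (Fin m))
        (TangentSpace (𝓡 m) : M → Type _) (φ y) (TotalSpace.mk' _ (φ y') (s y'))).2) y
          (frame x₀ y a)) : TangentSpace (𝓡 m) (φ y))
      + cov (extend (EuclideanSpace ℝ (Fin m)) (s y)) (φ y)
        (mfderiv (𝓡 n) (𝓡 m) φ y (frame x₀ y a)) := rfl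
  have h8 : (frame (φ y) (φ y) (mvfderiv (𝓡 n) (fun y' => (trivializationAt (EuclideanSpace ℝ (Fin m))
        (TangentSpace (𝓡 m) : M → Type _) (φ y) (TotalSpace.mk' _ (φ y') (s y'))).2) y
          (frame x₀ y a)) : TangentSpace (𝓡 m) (φ y)) =
      -frame (φ x₀) (φ y) (fderiv ℝ (localField (φ x₀) (extend (EuclideanSpace ℝ (Fin m)) (s y)))
        (extChartAt (𝓡 m) (φ x₀) (φ y)) (fderiv ℝ (mapInCharts φ x₀) (extChartAt (𝓡 n) x₀ y) a))
      + frame (φ x₀) (φ y) (fderiv ℝ (localFieldAlong φ x₀ s) (extChartAt (𝓡 n) x₀ y) a) := by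
    refine (frame_self _).trans ((h1.trans h2).trans ?_)
    refine congrArg₂ (· + ·) ?_ ((transition_apply hy' _).trans (coframe_self _))
    exact neg_eq_iff_eq_neg.1 (fderiv_transition hy' (s y) _).symm
  rw [h7, h8, map_add, map_add, map_neg, coframe_frame hy', coframe_frame hy',
    mfderiv_frame hφ hy hy', h5]
  abel

/-- The covariant derivative, along `φ`, of a vector field of `N`. -/
theorem HasChristoffel.coframe_covTangent (h : HasChristoffel cov (φ x₀) Γ)
    (hφ : ContMDiff (𝓡 n) (𝓡 m) ∞ φ) :
    ∀ᶠ y in 𝓝 x₀, ∀ Y : Π y : N, TangentSpace (𝓡 n) y,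
      MDifferentiableAt (𝓡 n) ((𝓡 n).prod 𝓘(ℝ, EuclideanSpace ℝ (Fin n)))
        (fun y => TotalSpace.mk' (EuclideanSpace ℝ (Fin n)) y (Y y)) y → ∀ a,
      coframe (φ x₀) (φ y) (covTangent cov φ Y y (frame x₀ y a)) =
        fderiv ℝ (mapInCharts φ x₀) (extChartAt (𝓡 n) x₀ y)
          (fderiv ℝ (localField x₀ Y) (extChartAt (𝓡 n) x₀ y) a)
        + alongDeriv (mapInCharts φ x₀) Γ (extChartAt (𝓡 n) x₀ y) a (coframe x₀ y (Y y)) := by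
  filter_upwards [h.coframe_covAlong hφ, eventually_mem_source (m := n) x₀,
    eventually_map_mem_source hφ x₀] with y hcov hy hy' Y hY a
  have hF := contDiffAt_mapInCharts hφ hy hy'
  have hDF := (hF.fderiv_right (m := ∞) (by simp)).differentiableAt_infty
  have hY' := (mdifferentiableAt_field_iff hy).1 hY
  have hs : localFieldAlong φ x₀ (fun y => mfderiv (𝓡 n) (𝓡 m) φ y (Y y))
      =ᶠ[𝓝 (extChartAt (𝓡 n) x₀ y)] fun z => fderiv ℝ (mapInCharts φ x₀) z (localField x₀ Y z) := by
    have h1 : ∀ᶠ y' in 𝓝 y, coframe (φ x₀) (φ y') (mfderiv (𝓡 n) (𝓡 m) φ y' (Y y')) =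
        fderiv ℝ (mapInCharts φ x₀) (extChartAt (𝓡 n) x₀ y') (coframe x₀ y' (Y y')) := by
      filter_upwards [(chartAt (EuclideanSpace ℝ (Fin n)) x₀).open_source.mem_nhds hy,
        hφ.continuous.continuousAt.eventually
        ((chartAt (EuclideanSpace ℝ (Fin m)) (φ x₀)).open_source.mem_nhds hy')] with y' h1 h2
      rw [← coframe_mfderiv hφ h1 h2, frame_coframe h1]
    filter_upwards [(tendsto_symm hy).eventually h1,
      extChartAt_target_mem_nhds' (x := x₀) ((extChartAt (𝓡 n) x₀).map_source
        (by rwa [extChartAt_source]))] with z h3 h4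
    rw [(extChartAt (𝓡 n) x₀).right_inv h4] at h3
    exact h3
  have h2 := hcov _ (hs.differentiableAt_iff.2 (hDF.clm_apply hY')) a
  refine h2.trans ?_
  have hYy : localField x₀ Y (extChartAt (𝓡 n) x₀ y) = coframe x₀ y (Y y) := inChart_apply _ hy
  have h3 : coframe (φ x₀) (φ y) (mfderiv (𝓡 n) (𝓡 m) φ y (Y y)) =
      fderiv ℝ (mapInCharts φ x₀) (extChartAt (𝓡 n) x₀ y) (coframe x₀ y (Y y)) := by
    rw [← coframe_mfderiv hφ hy hy', frame_coframe hy]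
  rw [hs.fderiv_eq, fderiv_clm_apply hDF hY', h3, alongDeriv, mapInCharts_apply hy]
  simp only [_root_.add_apply, ContinuousLinearMap.comp_apply, ContinuousLinearMap.flip_apply, hYy,
    pullBilin_apply]
  abel

theorem mapInCharts_self (φ : N → M) (x₀ : N) :
    mapInCharts (m := m) φ x₀ (extChartAt (𝓡 n) x₀ x₀) = extChartAt (𝓡 m) (φ x₀) (φ x₀) :=
  mapInCharts_apply (mem_chart_source _ x₀)

theorem eventually_fderiv_mapInCharts_injective (hφ : ContMDiff (𝓡 n) (𝓡 m) ∞ φ)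
    (hinj : ∀ y, Function.Injective (mfderiv (𝓡 n) (𝓡 m) φ y)) (x₀ : N) :
    ∀ᶠ z in 𝓝 (extChartAt (𝓡 n) x₀ x₀),
      Function.Injective (fderiv ℝ (mapInCharts (m := m) φ x₀) z) := by
  have h1 : ∀ᶠ y in 𝓝 x₀, Function.Injective
      (fderiv ℝ (mapInCharts (m := m) φ x₀) (extChartAt (𝓡 n) x₀ y)) := by
    filter_upwards [eventually_mem_source (m := n) x₀, eventually_map_mem_source hφ x₀] with y hy hy'
    exact fderiv_mapInCharts_injective hφ (hinj y) hy hy'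
  filter_upwards [(tendsto_symm (mem_chart_source _ x₀)).eventually h1, eventually_right_inv x₀]
    with z h2 h3
  rwa [h3] at h2

theorem IsLocalWeyl.pull_mapInCharts {g : Metric m M}
    {θ : EuclideanSpace ℝ (Fin m) → EuclideanSpace ℝ (Fin m) →L[ℝ] ℝ}
    (h : IsLocalWeyl (localMetric (φ x₀) g) Γ θ (extChartAt (𝓡 m) (φ x₀) (φ x₀)))
    (hφ : ContMDiff (𝓡 n) (𝓡 m) ∞ φ)
    (hinj : ∀ y, Function.Injective (mfderiv (𝓡 n) (𝓡 m) φ y)) :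
    IsLocalWeyl (pullMetric (mapInCharts φ x₀) (localMetric (φ x₀) g))
      (pullChristoffel (mapInCharts φ x₀) (localMetric (φ x₀) g) Γ)
      (pullOneForm (mapInCharts φ x₀) θ) (extChartAt (𝓡 n) x₀ x₀) := by
  refine IsLocalWeyl.pull ?_ (contDiffAt_mapInCharts hφ (mem_chart_source _ x₀)
    (mem_chart_source _ (φ x₀))) (eventually_fderiv_mapInCharts_injective hφ hinj x₀)
  rwa [mapInCharts_self]

/-- The Christoffel symbols of the induced connection. -/
theorem HasChristoffel.inducedConn (h : HasChristoffel cov (φ x₀) Γ) {g : Metric m M}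
    {θ : EuclideanSpace ℝ (Fin m) → EuclideanSpace ℝ (Fin m) →L[ℝ] ℝ}
    (hW : IsLocalWeyl (localMetric (φ x₀) g) Γ θ (extChartAt (𝓡 m) (φ x₀) (φ x₀)))
    (hφ : ContMDiff (𝓡 n) (𝓡 m) ∞ φ)
    (hinj : ∀ y, Function.Injective (mfderiv (𝓡 n) (𝓡 m) φ y)) :
    HasChristoffel (inducedConn (n := n) g cov φ) x₀
      (pullChristoffel (mapInCharts φ x₀) (localMetric (φ x₀) g) Γ) := by
  have hP := hW.pull_mapInCharts hφ hinj
  refine ⟨hP.contDiffAt_christoffel, hP.christoffel_symm, ?_⟩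
  have hpos : ∀ᶠ y in 𝓝 x₀, (pullMetric (mapInCharts φ x₀) (localMetric (φ x₀) g)
      (extChartAt (𝓡 n) x₀ y)).IsInvertible := by
    filter_upwards [eventually_mem_source (m := n) x₀, eventually_map_mem_source hφ x₀] with y hy hy'
    refine pullMetric_isInvertible (fun a ha => ?_) (fderiv_mapInCharts_injective hφ (hinj y) hy hy')
    rw [mapInCharts_apply hy, localMetric_apply_chart g hy']
    exact g.pos _ _ fun h0 => ha
      ((coframe_frame hy' a).symm.trans ((congrArg (coframe (φ x₀) (φ y)) h0).trans (map_zero _)))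
  filter_upwards [h.coframe_covTangent hφ, eventually_mem_source (m := n) x₀,
    eventually_map_mem_source hφ x₀, hpos] with y hcov hy hy' hI Y hY a
  have h1 : ConformalSubmanifold.inducedConn (n := n) g cov φ Y y (frame x₀ y a) =
    tanPart (n := n) g φ y (covTangent cov φ Y y (frame x₀ y a)) := rfl
  rw [h1, coframe_tanPart hφ g (hinj y) hy hy', hcov Y hY a, map_add, pullChristoffel_apply]
  congr 1
  -- the tangential projection is the identity on tangent vectors
  apply hI.injective
  ext c
  rw [pullMetric_tanProj hI]
  rfl

end Submanifold

/-! ### The induced Weyl structure -/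

theorem IsLocalWeyl.congr {V : Type*} [NormedAddCommGroup V] [NormedSpace ℝ V]
    {G G' : V → V →L[ℝ] V →L[ℝ] ℝ} {Γ Γ' : V → V →L[ℝ] V →L[ℝ] V} {θ θ' : V → V →L[ℝ] ℝ} {z : V}
    (h : IsLocalWeyl G Γ θ z) (hG : G' =ᶠ[𝓝 z] G) (hΓ : Γ' =ᶠ[𝓝 z] Γ) (hθ : θ' =ᶠ[𝓝 z] θ) :
    IsLocalWeyl G' Γ' θ' z where
  contDiffAt_metric := h.contDiffAt_metric.congr_of_eventuallyEq hG
  contDiffAt_christoffel := h.contDiffAt_christoffel.congr_of_eventuallyEq hΓ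
  contDiffAt_lee := h.contDiffAt_lee.congr_of_eventuallyEq hθ
  metric_symm := by
    filter_upwards [h.metric_symm, hG] with y h1 h2
    rwa [h2]
  metric_pos := by
    filter_upwards [h.metric_pos, hG] with y h1 h2
    rwa [h2]
  christoffel_symm := by
    filter_upwards [h.christoffel_symm, hΓ] with y h1 h2
    rwa [h2]
  compat := by
    filter_upwards [h.compat, hG, hΓ, hθ, hG.fderiv (𝕜 := ℝ)] with y h1 h2 h3 h4 h5
    rwa [h2, h3, h4, h5]

/-- The compatibility of a Weyl structure with the metric, for arbitrary vector fields. -/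
theorem IsLocalWeyl.fderiv_metric_apply {V : Type*} [NormedAddCommGroup V] [NormedSpace ℝ V]
    {G : V → V →L[ℝ] V →L[ℝ] ℝ} {Γ : V → V →L[ℝ] V →L[ℝ] V} {θ : V → V →L[ℝ] ℝ} {z : V}
    (h : IsLocalWeyl G Γ θ z) {Y Z : V → V} (hY : DifferentiableAt ℝ Y z)
    (hZ : DifferentiableAt ℝ Z z) (v : V) :
    fderiv ℝ (fun y => G y (Y y) (Z y)) z v =
      G z (fderiv ℝ Y z v + Γ z v (Y z)) (Z z) + G z (Y z) (fderiv ℝ Z z v + Γ z v (Z z))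
        - 2 * θ z v * G z (Y z) (Z z) := by
  have hG := h.contDiffAt_metric.differentiableAt_infty
  rw [fderiv_clm_apply (hG.clm_apply hY) hZ, fderiv_clm_apply hG hY]
  simp only [_root_.add_apply, ContinuousLinearMap.comp_apply, ContinuousLinearMap.flip_apply,
    map_add, h.compat.self_of_nhds]
  ring

section Intrinsic
variable {m : ℕ} {M : Type*} [TopologicalSpace M] [ChartedSpace (EuclideanSpace ℝ (Fin m)) M]
  [IsManifold (𝓡 m) ∞ M]

/-- The Lee form may be recognized in charts. -/
theorem HasChristoffel.isLeeForm {cov : ConnOp m M} {g : Metric m M}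
    {Γ : M → EuclideanSpace ℝ (Fin m) → EuclideanSpace ℝ (Fin m) →L[ℝ]
      EuclideanSpace ℝ (Fin m) →L[ℝ] EuclideanSpace ℝ (Fin m)}
    {θ : Π y : M, TangentSpace (𝓡 m) y →L[ℝ] ℝ} (h : ∀ x, HasChristoffel cov x (Γ x))
    (hW : ∀ x, IsLocalWeyl (localMetric x g) (Γ x) (localForm x θ) (extChartAt (𝓡 m) x x)) :
    IsLeeForm g cov θ := by
  intro x v Y Z hY hZ
  have hx := mem_chart_source (EuclideanSpace ℝ (Fin m)) x
  have hY' := (mdifferentiableAt_field_iff hx).1 hY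
  have hZ' := (mdifferentiableAt_field_iff hx).1 hZ
  have hG := (hW x).contDiffAt_metric.differentiableAt_infty
  have hval : ∀ Y : Π y : M, TangentSpace (𝓡 m) y,
      localField x Y (extChartAt (𝓡 m) x x) = Y x := fun Y =>
    (inChart_apply _ hx).trans (coframe_self (Y x))
  have hS : inChart x (fun y => g.inner y (Y y) (Z y)) =ᶠ[𝓝 (extChartAt (𝓡 m) x x)]
      fun z => localMetric x g z (localField x Y z) (localField x Z z) := by
    have h1 : ∀ᶠ y in 𝓝 x, g.inner y (Y y) (Z y) =
        g.inner y (frame x y (coframe x y (Y y))) (frame x y (coframe x y (Z y))) := by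
      filter_upwards [eventually_mem_source (m := m) x] with y hy
      rw [frame_coframe hy, frame_coframe hy]
    exact (tendsto_symm hx).eventually h1
  have hcov : ∀ Y : Π y : M, TangentSpace (𝓡 m) y,
      MDifferentiableAt (𝓡 m) ((𝓡 m).prod 𝓘(ℝ, EuclideanSpace ℝ (Fin m)))
        (fun y => TotalSpace.mk' (EuclideanSpace ℝ (Fin m)) y (Y y)) x →
      cov Y x v = fderiv ℝ (localField x Y) (extChartAt (𝓡 m) x x) v
        + Γ x (extChartAt (𝓡 m) x x) v (Y x) := by
    intro Y hY
    have h1 := (h x).eq.self_of_nhds Y hY v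
    have h2 : coframe x x (cov Y x (frame x x v)) = cov Y x v :=
      (coframe_self _).trans (congrArg (cov Y x) (frame_self v))
    refine (h2.symm.trans h1).trans ?_
    exact congrArg (fun w => _ + Γ x (extChartAt (𝓡 m) x x) v w) (coframe_self (Y x))
  have h1 := mvfderiv_frame hx (hS.differentiableAt_iff.2 ((hG.clm_apply hY').clm_apply hZ')) v
  rw [hS.fderiv_eq] at h1
  have hF := (hW x).fderiv_metric_apply hY' hZ' v
  rw [hval, hval] at hF
  refine (congrArg (mvfderiv (𝓡 m) (fun y => g.inner y (Y y) (Z y)) x) (frame_self v)).symm.trans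
    ((h1.trans hF).trans ?_)
  refine congrArg₂ (· - ·) (congrArg₂ (· + ·) ?_ ?_) (congrArg₂ (· * ·) (congrArg (2 * ·) ?_) ?_)
  · exact (localMetric_self _ _ _).trans (congrArg (fun w => g.inner x w (Z x)) (hcov Y hY).symm)
  · exact (localMetric_self _ _ _).trans (congrArg (fun w => g.inner x (Y x) w) (hcov Z hZ).symm)
  · exact localForm_self _ _
  · exact localMetric_self _ _ _

/-- The differential of a function, in coordinates. -/
theorem localForm_mvfderiv {f : M → ℝ} (hf : ContMDiff (𝓡 m) 𝓘(ℝ) ∞ f) (x : M) :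
    localForm x (fun y => mvfderiv (𝓡 m) f y) =ᶠ[𝓝 (extChartAt (𝓡 m) x x)]
      fun z => fderiv ℝ (inChart x f) z := by
  have hx := mem_chart_source (EuclideanSpace ℝ (Fin m)) x
  have h1 : ∀ᶠ y in 𝓝 x, ∀ a, mvfderiv (𝓡 m) f y (frame x y a) =
      fderiv ℝ (inChart x f) (extChartAt (𝓡 m) x y) a := by
    filter_upwards [eventually_mem_source (m := m) x] with y hy a
    exact mvfderiv_frame hy (contDiffAt_inChart le_rfl hy (hf y)).differentiableAt_infty a
  filter_upwards [(tendsto_symm hx).eventually h1, eventually_right_inv x] with z h2 h3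
  rw [h3] at h2
  ext a
  exact h2 a

end Intrinsic

section Submanifold
variable {m n : ℕ}
  {M : Type*} [TopologicalSpace M] [ChartedSpace (EuclideanSpace ℝ (Fin m)) M]
  [IsManifold (𝓡 m) ∞ M]
  {N : Type*} [TopologicalSpace N] [ChartedSpace (EuclideanSpace ℝ (Fin n)) N]
  [IsManifold (𝓡 n) ∞ N] {φ : N → M} {cov : ConnOp m M}
  {C : ConformalStructure m M} {CN : ConformalStructure n N} {g g' : Metric m M} {gN : Metric n N}

theorem pullbackForm_rescale {f : M → ℝ} (hf : IsRescaling g g' f) (x : N)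
    (u v : TangentSpace (𝓡 n) x) :
    pullbackForm g' φ x u v = Real.exp (2 * f (φ x)) * pullbackForm g φ x u v :=
  hf.2 _ _ _

/-- The orthogonal decomposition only depends on the conformal class. -/
theorem tanPart_rescale {f : M → ℝ} (hf : IsRescaling g g' f) {x : N}
    (hinj : Function.Injective (mfderiv (𝓡 n) (𝓡 m) φ x)) :
    tanPart (n := n) g' φ x = tanPart (n := n) g φ x := by
  ext1 A
  have h1 : ∀ w, pullbackForm g φ x (tanPart (n := n) g' φ x A) w =
      pullbackForm g φ x (tanPart (n := n) g φ x A) w := by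
    intro w
    have h2 := pullbackForm_tanPart g' hinj A w
    rw [pullbackForm_rescale hf, hf.2] at h2
    rw [pullbackForm_tanPart g hinj]
    exact mul_left_cancel₀ (Real.exp_ne_zero _) h2
  set a := tanPart (n := n) g' φ x A
  set b := tanPart (n := n) g φ x A
  have h2 : pullbackForm g φ x (a - b) (a - b) = 0 := by
    have h3 := h1 (a - b)
    simp only [pullbackForm, map_sub, _root_.sub_apply] at h3 ⊢
    linarith
  by_contra hne
  refine (g.pos (φ x) (mfderiv (𝓡 n) (𝓡 m) φ x (a - b)) fun h0 => hne ?_).ne' h2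
  exact sub_eq_zero.1 (hinj (h0.trans (map_zero (mfderiv (𝓡 n) (𝓡 m) φ x)).symm))

theorem inducedConn_rescale (hg : g ∈ C.metrics) (hg' : g' ∈ C.metrics)
    (hinj : ∀ y, Function.Injective (mfderiv (𝓡 n) (𝓡 m) φ y)) (cov : ConnOp m M) :
    inducedConn (n := n) g' cov φ = inducedConn (n := n) g cov φ := by
  obtain ⟨f, hf⟩ := (C.mem_iff g hg g').1 hg'
  funext Y x
  rw [inducedConn, inducedConn, tanPart_rescale hf (hinj x)]

theorem localMetric_eventuallyEq_pullMetric (hφ : ContMDiff (𝓡 n) (𝓡 m) ∞ φ)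
    (hgN : ∀ x u v, gN.inner x u v = pullbackForm g φ x u v) (x : N) :
    localMetric x gN =ᶠ[𝓝 (extChartAt (𝓡 n) x x)]
      pullMetric (mapInCharts φ x) (localMetric (φ x) g) := by
  have hx := mem_chart_source (EuclideanSpace ℝ (Fin n)) x
  have h1 : ∀ᶠ y in 𝓝 x, ∀ a b, gN.inner y (frame x y a) (frame x y b) =
      pullMetric (mapInCharts φ x) (localMetric (φ x) g) (extChartAt (𝓡 n) x y) a b := by
    filter_upwards [eventually_mem_source (m := n) x, eventually_map_mem_source hφ x] with y hy hy' a b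
    rw [hgN, pullMetric_mapInCharts hφ g hy hy']
  filter_upwards [(tendsto_symm hx).eventually h1, eventually_right_inv x] with z h2 h3
  rw [h3] at h2
  ext a b
  exact h2 a b

theorem localForm_comp_mfderiv (hφ : ContMDiff (𝓡 n) (𝓡 m) ∞ φ)
    (θ : Π p : M, TangentSpace (𝓡 m) p →L[ℝ] ℝ) (x : N) :
    localForm x (fun y => (θ (φ y)).comp (mfderiv (𝓡 n) (𝓡 m) φ y)) =ᶠ[𝓝 (extChartAt (𝓡 n) x x)]
      pullOneForm (mapInCharts φ x) (localForm (φ x) θ) := by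
  have hx := mem_chart_source (EuclideanSpace ℝ (Fin n)) x
  have h1 : ∀ᶠ y in 𝓝 x, ∀ a, θ (φ y) (mfderiv (𝓡 n) (𝓡 m) φ y (frame x y a)) =
      localForm (φ x) θ (mapInCharts φ x (extChartAt (𝓡 n) x y))
        (fderiv ℝ (mapInCharts φ x) (extChartAt (𝓡 n) x y) a) := by
    filter_upwards [eventually_mem_source (m := n) x, eventually_map_mem_source hφ x] with y hy hy' a
    rw [mfderiv_frame hφ hy hy', mapInCharts_apply hy]
    exact (inChart_apply (fun p => θ p (frame (φ x) p
      (fderiv ℝ (mapInCharts φ x) (extChartAt (𝓡 n) x y) a))) hy').symm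
  filter_upwards [(tendsto_symm hx).eventually h1, eventually_right_inv x] with z h2 h3
  rw [h3] at h2
  ext a
  exact h2 a

/-- The local Christoffel symbols of the induced connection. -/
theorem IsWeyl.hasChristoffel_inducedConn (h : IsWeyl C cov) (hm : m ≠ 0) (hg : g ∈ C.metrics)
    (hφ : ContMDiff (𝓡 n) (𝓡 m) ∞ φ)
    (hinj : ∀ y, Function.Injective (mfderiv (𝓡 n) (𝓡 m) φ y)) (x : N) :
    HasChristoffel (inducedConn (n := n) g cov φ) x
      (pullChristoffel (mapInCharts φ x) (localMetric (φ x) g) (christoffel cov (φ x))) :=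
  (h.hasChristoffel (φ x)).inducedConn (h.isLocalWeyl hm hg (φ x)) hφ hinj

/-- The induced connection is a Weyl structure of the submanifold. -/
theorem IsWeyl.inducedConn (h : IsWeyl C cov) (hm : m ≠ 0) (hg : g ∈ C.metrics)
    (hφ : ContMDiff (𝓡 n) (𝓡 m) ∞ φ)
    (hinj : ∀ y, Function.Injective (mfderiv (𝓡 n) (𝓡 m) φ y)) (hgN : gN ∈ CN.metrics)
    (hpull : ∀ x u v, gN.inner x u v = pullbackForm g φ x u v) :
    IsWeyl CN (inducedConn (n := n) g cov φ) := by
  have hΓ := h.hasChristoffel_inducedConn hm hg hφ hinj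
  refine ⟨fun x => (hΓ x).christoffel, fun gN' hgN' => ?_⟩
  obtain ⟨f, hf⟩ := (CN.mem_iff gN hgN gN').1 hgN'
  refine ⟨fun x => (leeForm g cov (φ x)).comp (mfderiv (𝓡 n) (𝓡 m) φ x) - mvfderiv (𝓡 n) f x,
    HasChristoffel.isLeeForm hΓ fun x => ?_⟩
  have h1 := ((h.isLocalWeyl hm hg (φ x)).pull_mapInCharts hφ hinj).congr
    (localMetric_eventuallyEq_pullMetric hφ hpull x) EventuallyEq.rfl
    (localForm_comp_mfderiv hφ (leeForm g cov) x)
  refine (h1.rescale (contDiffAt_inChart le_rfl (mem_chart_source _ x) (hf.1 x))).congr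
    (by rw [localMetric_rescale hf]) EventuallyEq.rfl ?_
  filter_upwards [localForm_mvfderiv hf.1 x] with z hz
  rw [← hz]
  rfl

/-- The Lee form of the induced connection is the restriction of the Lee form. -/
theorem IsWeyl.localLee_inducedConn (h : IsWeyl C cov) (hm : m ≠ 0) (hn : n ≠ 0) (hg : g ∈ C.metrics)
    (hφ : ContMDiff (𝓡 n) (𝓡 m) ∞ φ)
    (hinj : ∀ y, Function.Injective (mfderiv (𝓡 n) (𝓡 m) φ y)) (hgN : gN ∈ CN.metrics)
    (hpull : ∀ x u v, gN.inner x u v = pullbackForm g φ x u v) (x : N) :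
    localLee gN (ConformalSubmanifold.inducedConn (n := n) g cov φ) x =ᶠ[𝓝 (extChartAt (𝓡 n) x x)]
      pullOneForm (mapInCharts φ x) (localLee g cov (φ x)) := by
  have := nontrivial_of_ne_zero hn
  exact ((h.isLocalWeyl hm hg (φ x)).pull_mapInCharts hφ hinj).lee_unique
    ((h.hasChristoffel_inducedConn hm hg hφ hinj x).isLocalWeyl hn
      ((h.inducedConn hm hg hφ hinj hgN hpull).isLeeForm hgN))
    (localMetric_eventuallyEq_pullMetric hφ hpull x)

end Submanifold

/-! ### The fundamental form and the mean curvature, in coordinates -/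

section LocalExtrinsic
variable {V : Type*} [NormedAddCommGroup V] [NormedSpace ℝ V]
  {W : Type*} [NormedAddCommGroup W] [NormedSpace ℝ W] {n : ℕ}

/-- The projection to the normal space of the submanifold parametrized by `F`. -/
def norProj (F : W → V) (G : V → V →L[ℝ] V →L[ℝ] ℝ) (z : W) : V →L[ℝ] V :=
  .id ℝ V - (fderiv ℝ F z).comp (tanProj F G z)

/-- The fundamental form `B(u, v) = (∇_u ∂_v)^⊥` of the submanifold parametrized by `F`. -/
def localFund (F : W → V) (G : V → V →L[ℝ] V →L[ℝ] ℝ) (Γ : V → V →L[ℝ] V →L[ℝ] V) (z u v : W) : V :=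
  norProj F G z (alongDeriv F Γ z u v)

variable (b : Module.Basis (Fin n) ℝ W)

/-- The mean curvature of the submanifold parametrized by `F`. -/
def localMean (F : W → V) (G : V → V →L[ℝ] V →L[ℝ] ℝ) (Γ : V → V →L[ℝ] V →L[ℝ] V) (z : W) : V :=
  (1 / n : ℝ) • traceWith b (fun u v => pullMetric F G z u v) (localFund F G Γ z)

/-- The extrinsic part `½ c(H, H) c + H(B₀)` of the relative Schouten-Weyl tensor. -/
def localExtrinsic (F : W → V) (G : V → V →L[ℝ] V →L[ℝ] ℝ) (Γ : V → V →L[ℝ] V →L[ℝ] V)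
    (z u v : W) : ℝ :=
  1 / 2 * G (F z) (localMean b F G Γ z) (localMean b F G Γ z) * pullMetric F G z u v
    + G (F z) (localMean b F G Γ z)
      (localFund F G Γ z u v - pullMetric F G z u v • localMean b F G Γ z)

variable {G : V → V →L[ℝ] V →L[ℝ] ℝ} {Γ Γ₁ Γ₂ : V → V →L[ℝ] V →L[ℝ] V}
  {θ θ₁ θ₂ : V → V →L[ℝ] ℝ} {F : W → V} {z : W} {s : V}

theorem metric_norProj (h : (pullMetric F G z).IsInvertible) (A : V) (w : W) :
    G (F z) (norProj F G z A) (fderiv ℝ F z w) = 0 := by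
  have h1 := pullMetric_tanProj h A w
  rw [pullMetric, pullBilin_apply] at h1
  simp [norProj, h1]

theorem norProj_fderiv (h : (pullMetric F G z).IsInvertible) (w : W) :
    norProj F G z (fderiv ℝ F z w) = 0 := by
  have h1 : tanProj F G z (fderiv ℝ F z w) = w := by
    apply h.injective
    ext c
    rw [pullMetric_tanProj h]
    rfl
  simp [norProj, h1]

theorem IsLocalWeyl.localFund_symm (h : IsLocalWeyl G Γ θ (F z)) (hF : ContDiffAt ℝ ∞ F z) (u v : W) :
    localFund F G Γ z u v = localFund F G Γ z v u := by
  have h1 : fderiv ℝ (fderiv ℝ F) z u v = fderiv ℝ (fderiv ℝ F) z v u :=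
    (hF.of_le two_le_infty).isSymmSndFDerivAt (by simp) u v
  simp only [localFund, alongDeriv, _root_.add_apply, pullBilin_apply, h1,
    h.christoffel_symm.self_of_nhds (fderiv ℝ F z u)]

/-- Adding `γ` to the Lee form subtracts `c ⊗ γ^⊥` from the fundamental form. -/
theorem IsLocalWeyl.localFund_sub (h₁ : IsLocalWeyl G Γ₁ θ₁ (F z)) (h₂ : IsLocalWeyl G Γ₂ θ₂ (F z))
    (h : (pullMetric F G z).IsInvertible) (hs : ∀ c, G (F z) s c = (θ₂ (F z) - θ₁ (F z)) c) (u v : W) :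
    localFund F G Γ₂ z u v = localFund F G Γ₁ z u v - pullMetric F G z u v • norProj F G z s := by
  have h1 : Γ₂ (F z) (fderiv ℝ F z u) (fderiv ℝ F z v) =
      Γ₁ (F z) (fderiv ℝ F z u) (fderiv ℝ F z v)
      + ((θ₂ (F z) - θ₁ (F z)) (fderiv ℝ F z u) • fderiv ℝ F z v
        + (θ₂ (F z) - θ₁ (F z)) (fderiv ℝ F z v) • fderiv ℝ F z u
        - pullMetric F G z u v • s) := by
    refine h₁.metric_ext fun c => ?_
    have h2 := (h₁.christoffel_sub h₂).self_of_nhds (fderiv ℝ F z u) (fderiv ℝ F z v) c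
    rw [map_sub, _root_.sub_apply] at h2
    simp only [map_add, map_sub, map_smul, _root_.add_apply, _root_.sub_apply, _root_.smul_apply,
      smul_eq_mul, hs] at h2 ⊢
    rw [pullMetric, pullBilin_apply]
    linear_combination h2
  simp only [localFund, alongDeriv, _root_.add_apply, pullBilin_apply, h1, map_add, map_sub, map_smul,
    norProj_fderiv h, smul_zero, zero_add, zero_sub]
  abel

/-- Adding `γ` to the Lee form subtracts `γ^⊥` from the mean curvature. -/
theorem IsLocalWeyl.localMean_sub [FiniteDimensional ℝ W] (hn : n ≠ 0)
    (h₁ : IsLocalWeyl G Γ₁ θ₁ (F z)) (h₂ : IsLocalWeyl G Γ₂ θ₂ (F z))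
    (hinj : Function.Injective (fderiv ℝ F z)) (h : (pullMetric F G z).IsInvertible)
    (hs : ∀ c, G (F z) s c = (θ₂ (F z) - θ₁ (F z)) c) :
    localMean b F G Γ₂ z = localMean b F G Γ₁ z - norProj F G z s := by
  have h1 : localFund F G Γ₂ z =
      fun u v => localFund F G Γ₁ z u v - pullMetric F G z u v • norProj F G z s := by
    funext u v
    exact h₁.localFund_sub h₂ h hs u v
  have h2 : traceWith b (fun u v => pullMetric F G z u v) (fun u v => pullMetric F G z u v) = n :=
    ConformalSubmanifold.traceWith_self b (q := toBilin (pullMetric F G z))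
      (fun v hv => h₁.metric_pos.self_of_nhds _ fun h0 => hv (hinj (h0.trans (map_zero _).symm)))
      (fun u v => h₁.metric_symm.self_of_nhds _ _)
  have hn' : (n : ℝ) ≠ 0 := by exact_mod_cast hn
  rw [localMean, h1, traceWith_sub, traceWith_smul_const, h2, smul_sub, smul_smul,
    one_div_mul_cancel hn', one_smul, localMean]

/-- The change of the extrinsic part of the relative Schouten-Weyl tensor is the difference of the
changes of the Schouten-Weyl tensors, as computed by the Gauss formula. -/
theorem IsLocalWeyl.localExtrinsic_sub [FiniteDimensional ℝ W] (hn : n ≠ 0)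
    (h₁ : IsLocalWeyl G Γ₁ θ₁ (F z)) (h₂ : IsLocalWeyl G Γ₂ θ₂ (F z)) (hF : ContDiffAt ℝ ∞ F z)
    (hinj : Function.Injective (fderiv ℝ F z)) (h : (pullMetric F G z).IsInvertible)
    (hs : ∀ c, G (F z) s c = (θ₂ (F z) - θ₁ (F z)) c) (u v : W) :
    localExtrinsic b F G Γ₂ z u v - localExtrinsic b F G Γ₁ z u v =
      schoutenChange G Γ₁ (fun y => θ₂ y - θ₁ y) (F z) s (fderiv ℝ F z u) (fderiv ℝ F z v)
      - schoutenChange (pullMetric F G) (pullChristoffel F G Γ₁)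
        (pullOneForm F fun y => θ₂ y - θ₁ y) z (tanProj F G z s) u v := by
  rw [schoutenChange_pull hF (h₂.contDiffAt_lee.sub h₁.contDiffAt_lee) s (tanProj F G z s) u v]
  have hsymm := h₁.metric_symm.self_of_nhds
  have hB : alongDeriv F Γ₁ z u v - fderiv ℝ F z (tanProj F G z (alongDeriv F Γ₁ z u v)) =
      localFund F G Γ₁ z u v := rfl
  have hσ : s - fderiv ℝ F z (tanProj F G z s) = norProj F G z s := rfl
  have h0 (A : V) : G (F z) (norProj F G z s) (norProj F G z A) =
      (θ₂ (F z) - θ₁ (F z)) (norProj F G z A) := by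
    rw [← hσ, map_sub, _root_.sub_apply, hs, hsymm (fderiv ℝ F z _), metric_norProj h, sub_zero]
  have h1 : G (F z) (norProj F G z s) (localFund F G Γ₁ z u v) =
      (θ₂ (F z) - θ₁ (F z)) (localFund F G Γ₁ z u v) := h0 _
  have h2 := h0 s
  rw [hB, ← map_sub, hσ, ← h1, ← h2, localExtrinsic, localExtrinsic, h₁.localFund_sub h₂ h hs,
    h₁.localMean_sub b hn h₂ hinj h hs]
  simp only [map_sub, map_smul, _root_.sub_apply, smul_eq_mul]
  rw [hsymm (norProj F G z s) (localMean b F G Γ₁ z)]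
  ring

theorem isBilin_localExtrinsic (F : W → V) (G : V → V →L[ℝ] V →L[ℝ] ℝ)
    (Γ : V → V →L[ℝ] V →L[ℝ] V) (z : W) : IsBilin (localExtrinsic b F G Γ z) := by
  have h1 : IsBilin fun u v => pullMetric F G z u v := ⟨toBilin (pullMetric F G z), fun _ _ => rfl⟩
  have h2 : IsBilin fun u v => G (F z) (localMean b F G Γ z) (localFund F G Γ z u v) :=
    ⟨toBilin ((ContinuousLinearMap.compL ℝ W V ℝ ((G (F z) (localMean b F G Γ z)).comp
      (norProj F G z))).comp (alongDeriv F Γ z)), fun _ _ => rfl⟩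
  have h3 := h2.add (h1.const_mul (-(1 / 2) * G (F z) (localMean b F G Γ z) (localMean b F G Γ z)))
  obtain ⟨L, hL⟩ := h3
  refine ⟨L, fun u v => (hL u v).trans ?_⟩
  simp only [localExtrinsic, map_sub, map_smul, smul_eq_mul]
  ring

theorem IsLocalWeyl.localExtrinsic_symm (h : IsLocalWeyl G Γ θ (F z)) (hF : ContDiffAt ℝ ∞ F z)
    (u v : W) : localExtrinsic b F G Γ z u v = localExtrinsic b F G Γ z v u := by
  have h1 : pullMetric F G z u v = pullMetric F G z v u := h.metric_symm.self_of_nhds _ _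
  rw [localExtrinsic, localExtrinsic, h.localFund_symm hF, h1]

end LocalExtrinsic

/-! ### The relative Schouten-Weyl tensor in coordinates -/

theorem schoutenChange_congr {V : Type*} [NormedAddCommGroup V] [NormedSpace ℝ V]
    {G G' : V → V →L[ℝ] V →L[ℝ] ℝ} {Γ Γ' : V → V →L[ℝ] V →L[ℝ] V} {γ γ' : V → V →L[ℝ] ℝ} {z : V}
    (hG : G' =ᶠ[𝓝 z] G) (hΓ : Γ' =ᶠ[𝓝 z] Γ) (hγ : γ' =ᶠ[𝓝 z] γ) (s u v : V) :
    schoutenChange G' Γ' γ' z s u v = schoutenChange G Γ γ z s u v := by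
  rw [schoutenChange, schoutenChange, covOneForm, covOneForm, hγ.fderiv_eq, hγ.self_of_nhds,
    hG.self_of_nhds, hΓ.self_of_nhds]

section Submanifold
variable {m n : ℕ}
  {M : Type*} [TopologicalSpace M] [ChartedSpace (EuclideanSpace ℝ (Fin m)) M]
  [IsManifold (𝓡 m) ∞ M]
  {N : Type*} [TopologicalSpace N] [ChartedSpace (EuclideanSpace ℝ (Fin n)) N]
  [IsManifold (𝓡 n) ∞ N] {φ : N → M} {cov cov₁ cov₂ : ConnOp m M} {x : N}
  {C : ConformalStructure m M} {CN : ConformalStructure n N} {g g' : Metric m M} {gN : Metric n N}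
  {Γ : EuclideanSpace ℝ (Fin m) → EuclideanSpace ℝ (Fin m) →L[ℝ]
      EuclideanSpace ℝ (Fin m) →L[ℝ] EuclideanSpace ℝ (Fin m)}

theorem mfderiv_self (hφ : ContMDiff (𝓡 n) (𝓡 m) ∞ φ) (x : N) (u : EuclideanSpace ℝ (Fin n)) :
    mfderiv (𝓡 n) (𝓡 m) φ x u = fderiv ℝ (mapInCharts (m := m) φ x) (extChartAt (𝓡 n) x x) u :=
  (coframe_self _).symm.trans ((congrArg (fun w => coframe (φ x) (φ x) (mfderiv (𝓡 n) (𝓡 m) φ x w))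
    (frame_self u).symm).trans
    (coframe_mfderiv hφ (mem_chart_source _ x) (mem_chart_source _ (φ x)) u))

theorem pullbackForm_self (hφ : ContMDiff (𝓡 n) (𝓡 m) ∞ φ) (g : Metric m M) (x : N)
    (u v : EuclideanSpace ℝ (Fin n)) :
    pullbackForm g φ x u v =
      pullMetric (mapInCharts φ x) (localMetric (φ x) g) (extChartAt (𝓡 n) x x) u v := by
  rw [pullMetric_mapInCharts hφ g (mem_chart_source _ x) (mem_chart_source _ (φ x))]
  exact congrArg₂ (pullbackForm g φ x) (frame_self u).symm (frame_self v).symm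

theorem isInvertible_pullMetric_mapInCharts (hφ : ContMDiff (𝓡 n) (𝓡 m) ∞ φ) (g : Metric m M)
    (hinj : ∀ y, Function.Injective (mfderiv (𝓡 n) (𝓡 m) φ y)) (x : N) :
    (pullMetric (mapInCharts φ x) (localMetric (φ x) g) (extChartAt (𝓡 n) x x)).IsInvertible := by
  refine pullMetric_isInvertible (fun a ha => ?_)
    (eventually_fderiv_mapInCharts_injective hφ hinj x).self_of_nhds
  rw [mapInCharts_self, localMetric_self]
  exact g.pos (φ x) a ha

theorem tanPart_self (hφ : ContMDiff (𝓡 n) (𝓡 m) ∞ φ) (g : Metric m M)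
    (hinj : ∀ y, Function.Injective (mfderiv (𝓡 n) (𝓡 m) φ y)) (x : N)
    (A : EuclideanSpace ℝ (Fin m)) :
    tanPart (n := n) g φ x A =
      tanProj (mapInCharts φ x) (localMetric (φ x) g) (extChartAt (𝓡 n) x x) A :=
  (coframe_self _).symm.trans ((coframe_tanPart hφ g (hinj x) (mem_chart_source _ x)
    (mem_chart_source _ (φ x)) A).trans (congrArg (tanProj (mapInCharts φ x) (localMetric (φ x) g)
      (extChartAt (𝓡 n) x x)) (coframe_self A)))

theorem norPart_self (hφ : ContMDiff (𝓡 n) (𝓡 m) ∞ φ) (g : Metric m M)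
    (hinj : ∀ y, Function.Injective (mfderiv (𝓡 n) (𝓡 m) φ y)) (x : N)
    (A : EuclideanSpace ℝ (Fin m)) :
    norPart n g φ x A =
      norProj (mapInCharts φ x) (localMetric (φ x) g) (extChartAt (𝓡 n) x x) A := by
  have h : mfderiv (𝓡 n) (𝓡 m) φ x (tanPart (n := n) g φ x A) =
      fderiv ℝ (mapInCharts (m := m) φ x) (extChartAt (𝓡 n) x x)
        (tanProj (mapInCharts φ x) (localMetric (φ x) g) (extChartAt (𝓡 n) x x) A) :=
    (congrArg (mfderiv (𝓡 n) (𝓡 m) φ x) (tanPart_self hφ g hinj x A)).trans (mfderiv_self hφ x _)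
  exact congrArg (fun b : EuclideanSpace ℝ (Fin m) => A - b) h

/-- The covariant derivative along `φ` of a coordinate vector field. -/
theorem HasChristoffel.covTangent_frame (h : HasChristoffel cov (φ x) Γ)
    (hφ : ContMDiff (𝓡 n) (𝓡 m) ∞ φ) (u v : EuclideanSpace ℝ (Fin n))
    {Y : Π y : N, TangentSpace (𝓡 n) y} (hY : ∀ᶠ y in 𝓝 x, Y y = frame x y v) :
    covTangent cov φ Y x u = alongDeriv (mapInCharts φ x) Γ (extChartAt (𝓡 n) x x) u v := by
  have hx := mem_chart_source (EuclideanSpace ℝ (Fin n)) x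
  have h2 := localField_frame_eventuallyEq hx hY
  have h1 := (h.coframe_covTangent hφ).self_of_nhds Y ((mdifferentiableAt_field_iff hx).2
    (h2.differentiableAt_iff.2 (differentiableAt_const v))) u
  rw [h2.fderiv_eq, hY.self_of_nhds, coframe_frame hx, fderiv_fun_const, Pi.zero_apply,
    _root_.zero_apply, map_zero, zero_add] at h1
  exact (coframe_self _).symm.trans ((congrArg (fun w => coframe (φ x) (φ x)
    (covTangent cov φ Y x w)) (frame_self u).symm).trans h1)

/-- The fundamental form in coordinates. -/
theorem HasChristoffel.fundForm_eq (h : HasChristoffel cov (φ x) Γ)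
    (hφ : ContMDiff (𝓡 n) (𝓡 m) ∞ φ) (g : Metric m M)
    (hinj : ∀ y, Function.Injective (mfderiv (𝓡 n) (𝓡 m) φ y)) (u v : EuclideanSpace ℝ (Fin n)) :
    fundForm (n := n) g cov φ x u v =
      localFund (mapInCharts φ x) (localMetric (φ x) g) Γ (extChartAt (𝓡 n) x x) u v :=
  (congrArg (norPart n g φ x) (h.covTangent_frame hφ u v (extend_eventuallyEq_frame x v))).trans
    (norPart_self hφ g hinj x _)

theorem HasChristoffel.meanCurv_eq (h : HasChristoffel cov (φ x) Γ)
    (hφ : ContMDiff (𝓡 n) (𝓡 m) ∞ φ) (g : Metric m M)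
    (hinj : ∀ y, Function.Injective (mfderiv (𝓡 n) (𝓡 m) φ y)) :
    meanCurv n g cov φ x = localMean (EuclideanSpace.basisFun (Fin n) ℝ).toBasis
      (mapInCharts φ x) (localMetric (φ x) g) Γ (extChartAt (𝓡 n) x x) :=
  congrArg₂ (fun (q : EuclideanSpace ℝ (Fin n) → EuclideanSpace ℝ (Fin n) → ℝ)
      (B : EuclideanSpace ℝ (Fin n) → EuclideanSpace ℝ (Fin n) → EuclideanSpace ℝ (Fin m)) =>
      (1 / n : ℝ) • traceWith (EuclideanSpace.basisFun (Fin n) ℝ).toBasis q B)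
    (funext fun u => funext fun v => pullbackForm_self hφ g x u v)
    (funext fun u => funext fun v => h.fundForm_eq hφ g hinj u v)

/-- The relative Schouten-Weyl tensor in coordinates. -/
theorem relSchouten_eq (SM : LowDimStructure C) (SN : LowDimStructure CN)
    (hφ : ContMDiff (𝓡 n) (𝓡 m) ∞ φ)
    (hinj : ∀ y, Function.Injective (mfderiv (𝓡 n) (𝓡 m) φ y)) (D : WeylStructure C)
    (h : HasChristoffel D.conn.toFun (φ x) Γ) (g : C.metrics) (gN : CN.metrics)
    (u v : EuclideanSpace ℝ (Fin n)) :
    relSchouten SM SN φ D g gN x u v =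
      schouten SM g D.conn.toFun (φ x)
          (fderiv ℝ (mapInCharts (m := m) φ x) (extChartAt (𝓡 n) x x) u)
          (fderiv ℝ (mapInCharts (m := m) φ x) (extChartAt (𝓡 n) x x) v)
        - schouten SN gN (inducedConn (g : Metric m M) D.conn.toFun φ) x u v
        + localExtrinsic (EuclideanSpace.basisFun (Fin n) ℝ).toBasis (mapInCharts φ x)
          (localMetric (φ x) (g : Metric m M)) Γ (extChartAt (𝓡 n) x x) u v := by
  have hH := h.meanCurv_eq hφ (g : Metric m M) hinj
  have hB := h.fundForm_eq hφ (g : Metric m M) hinj u v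
  have hp := pullbackForm_self hφ (g : Metric m M) x u v
  have hi : ∀ a b : EuclideanSpace ℝ (Fin m), (g : Metric m M).inner (φ x) a b =
      localMetric (φ x) (g : Metric m M) (mapInCharts φ x (extChartAt (𝓡 n) x x)) a b :=
    fun a b => by rw [mapInCharts_self, localMetric_self]
  have hH2 : (g : Metric m M).inner (φ x) (meanCurv n (g : Metric m M) D.conn.toFun φ x)
      (meanCurv n (g : Metric m M) D.conn.toFun φ x) = _ := (hi _ _).trans
    (congrArg (fun a => localMetric (φ x) (g : Metric m M)
      (mapInCharts φ x (extChartAt (𝓡 n) x x)) a a) hH)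
  have hB0 : fundForm₀ (g : Metric m M) D.conn.toFun φ x u v = _ :=
    congrArg₂ (fun a b : EuclideanSpace ℝ (Fin m) => a - b) hB
      (congrArg₂ (fun (c : ℝ) (a : EuclideanSpace ℝ (Fin m)) => c • a) hp hH)
  have hHB : (g : Metric m M).inner (φ x) (meanCurv n (g : Metric m M) D.conn.toFun φ x)
      (fundForm₀ (g : Metric m M) D.conn.toFun φ x u v) = _ := (hi _ _).trans
    (congrArg₂ (fun a b => localMetric (φ x) (g : Metric m M)
      (mapInCharts φ x (extChartAt (𝓡 n) x x)) a b) hH hB0)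
  have hS : schouten SM g D.conn.toFun (φ x) (mfderiv (𝓡 n) (𝓡 m) φ x u)
      (mfderiv (𝓡 n) (𝓡 m) φ x v) = _ :=
    congrArg₂ (schouten SM g D.conn.toFun (φ x)) (mfderiv_self hφ x u) (mfderiv_self hφ x v)
  refine (add_assoc _ _ _).trans ?_
  exact congrArg₂ (· + ·) (congrArg (· - schouten SN gN _ x u v) hS)
    (congrArg₂ (· + ·) (congrArg₂ (fun a b => 1 / 2 * a * b) hH2 hp) hHB)

end Submanifold

/-! ### Invariance and symmetry of the relative Schouten-Weyl tensor -/

section Submanifold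
variable {m n : ℕ}
  {M : Type*} [TopologicalSpace M] [ChartedSpace (EuclideanSpace ℝ (Fin m)) M]
  [IsManifold (𝓡 m) ∞ M]
  {N : Type*} [TopologicalSpace N] [ChartedSpace (EuclideanSpace ℝ (Fin n)) N]
  [IsManifold (𝓡 n) ∞ N] {φ : N → M} {cov cov₁ cov₂ : ConnOp m M} {x : N}
  {C : ConformalStructure m M} {CN : ConformalStructure n N} {g g' : Metric m M} {gN : Metric n N}

theorem mapInCharts_isLocalWeyl (h : IsWeyl C cov) (hm : m ≠ 0) (hg : g ∈ C.metrics) (x : N) :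
    IsLocalWeyl (localMetric (φ x) g) (christoffel cov (φ x)) (localLee g cov (φ x))
      (mapInCharts φ x (extChartAt (𝓡 n) x x)) := by
  rw [mapInCharts_self]
  exact h.isLocalWeyl hm hg (φ x)

theorem localMetric_leeDiffVec_map (g : Metric m M) (cov₁ cov₂ : ConnOp m M) (x : N)
    (c : EuclideanSpace ℝ (Fin m)) :
    localMetric (φ x) g (mapInCharts φ x (extChartAt (𝓡 n) x x)) (leeDiffVec g cov₁ cov₂ (φ x)) c =
      leeDiff g cov₁ cov₂ (φ x) (mapInCharts φ x (extChartAt (𝓡 n) x x)) c := by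
  rw [mapInCharts_self]
  exact localMetric_leeDiffVec g cov₁ cov₂ (φ x) c

/-- The change of the Schouten tensor of the submanifold, in terms of the data of the ambient
manifold. -/
theorem weylChange_inducedConn (h₁ : IsWeyl C cov₁) (h₂ : IsWeyl C cov₂) (hm : m ≠ 0) (hn : n ≠ 0)
    (hg : g ∈ C.metrics) (hφ : ContMDiff (𝓡 n) (𝓡 m) ∞ φ)
    (hinj : ∀ y, Function.Injective (mfderiv (𝓡 n) (𝓡 m) φ y)) (hgN : gN ∈ CN.metrics)
    (hpull : ∀ x u v, gN.inner x u v = pullbackForm g φ x u v) (x : N)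
    (u v : EuclideanSpace ℝ (Fin n)) :
    weylChange gN (inducedConn g cov₁ φ) (inducedConn g cov₂ φ) x u v =
      schoutenChange (pullMetric (mapInCharts φ x) (localMetric (φ x) g))
        (pullChristoffel (mapInCharts φ x) (localMetric (φ x) g) (christoffel cov₁ (φ x)))
        (pullOneForm (mapInCharts φ x) (leeDiff g cov₁ cov₂ (φ x))) (extChartAt (𝓡 n) x x)
        (tanProj (mapInCharts φ x) (localMetric (φ x) g) (extChartAt (𝓡 n) x x)
          (leeDiffVec g cov₁ cov₂ (φ x))) u v := by
  have hG := localMetric_eventuallyEq_pullMetric hφ hpull x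
  have hγ : leeDiff gN (inducedConn g cov₁ φ) (inducedConn g cov₂ φ) x =ᶠ[𝓝 (extChartAt (𝓡 n) x x)]
      pullOneForm (mapInCharts φ x) (leeDiff g cov₁ cov₂ (φ x)) := by
    filter_upwards [h₁.localLee_inducedConn hm hn hg hφ hinj hgN hpull x,
      h₂.localLee_inducedConn hm hn hg hφ hinj hgN hpull x] with z e₁ e₂
    rw [leeDiff, e₁, e₂]
    ext c
    rfl
  have ht : leeDiffVec gN (inducedConn g cov₁ φ) (inducedConn g cov₂ φ) x =
      tanProj (mapInCharts φ x) (localMetric (φ x) g) (extChartAt (𝓡 n) x x)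
          (leeDiffVec g cov₁ cov₂ (φ x)) := by
    apply (localMetric_isInvertible gN x).injective
    ext c
    rw [localMetric_leeDiffVec, hγ.self_of_nhds, hG.self_of_nhds,
      pullMetric_tanProj (isInvertible_pullMetric_mapInCharts hφ g hinj x),
      localMetric_leeDiffVec_map]
    rfl
  rw [weylChange, ht]
  exact schoutenChange_congr hG
    (h₁.hasChristoffel_inducedConn hm hg hφ hinj x).christoffel_eventuallyEq hγ _ u v

/-- The relative Schouten-Weyl tensor does not depend on the Weyl structure: the change of the extrinsic
part compensates the changes of the two Schouten-Weyl tensors. -/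
theorem relSchouten_weyl [T2Space M] [T2Space N] (SM : LowDimStructure C)
    (SN : LowDimStructure CN) (hm : m ≠ 0)
    (hn : n ≠ 0) (hφ : ContMDiff (𝓡 n) (𝓡 m) ∞ φ)
    (hinj : ∀ y, Function.Injective (mfderiv (𝓡 n) (𝓡 m) φ y)) (D₁ D₂ : WeylStructure C)
    (g : C.metrics) (gN : CN.metrics)
    (hpull : ∀ x u v, (gN : Metric n N).inner x u v = pullbackForm (g : Metric m M) φ x u v)
    (x : N) (u v : EuclideanSpace ℝ (Fin n)) :
    relSchouten SM SN φ D₂ g gN x u v = relSchouten SM SN φ D₁ g gN x u v := by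
  have h₁ := D₁.isWeyl
  have h₂ := D₂.isWeyl
  rw [relSchouten_eq SM SN hφ hinj D₂ (h₂.hasChristoffel (φ x)),
    relSchouten_eq SM SN hφ hinj D₁ (h₁.hasChristoffel (φ x)),
    schouten_sub SM h₁ h₂ hm, schouten_sub SN (h₁.inducedConn hm g.2 hφ hinj gN.2 hpull)
      (h₂.inducedConn hm g.2 hφ hinj gN.2 hpull) hn,
    weylChange_inducedConn h₁ h₂ hm hn g.2 hφ hinj gN.2 hpull]
  have key := (mapInCharts_isLocalWeyl (φ := φ) h₁ hm g.2 x).localExtrinsic_sub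
    (EuclideanSpace.basisFun (Fin n) ℝ).toBasis hn
    (mapInCharts_isLocalWeyl h₂ hm g.2 x)
    (contDiffAt_mapInCharts hφ (mem_chart_source _ x) (mem_chart_source _ (φ x)))
    (eventually_fderiv_mapInCharts_injective hφ hinj x).self_of_nhds
    (isInvertible_pullMetric_mapInCharts hφ (g : Metric m M) hinj x)
    (localMetric_leeDiffVec_map (g : Metric m M) _ _ x) u v
  have hW : weylChange (g : Metric m M) D₁.conn.toFun D₂.conn.toFun (φ x)
      (fderiv ℝ (mapInCharts (m := m) φ x) (extChartAt (𝓡 n) x x) u)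
      (fderiv ℝ (mapInCharts (m := m) φ x) (extChartAt (𝓡 n) x x) v) =
      schoutenChange (localMetric (φ x) (g : Metric m M)) (christoffel D₁.conn.toFun (φ x))
        (leeDiff (g : Metric m M) D₁.conn.toFun D₂.conn.toFun (φ x))
        (mapInCharts φ x (extChartAt (𝓡 n) x x))
        (leeDiffVec (g : Metric m M) D₁.conn.toFun D₂.conn.toFun (φ x))
        (fderiv ℝ (mapInCharts (m := m) φ x) (extChartAt (𝓡 n) x x) u)
        (fderiv ℝ (mapInCharts (m := m) φ x) (extChartAt (𝓡 n) x x) v) := by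
    rw [mapInCharts_self]
    rfl
  rw [hW]
  have e : leeDiff (g : Metric m M) D₁.conn.toFun D₂.conn.toFun (φ x) =
    fun y => localLee (g : Metric m M) D₂.conn.toFun (φ x) y -
      localLee (g : Metric m M) D₁.conn.toFun (φ x) y := rfl
  rw [← e] at key
  linear_combination key

/-- The relative Schouten-Weyl tensor is symmetric: the skew part of the Schouten-Weyl tensor is
the exterior derivative of the Lee form, which is compatible with restriction. -/
theorem relSchouten_symm [T2Space M] [T2Space N] (SM : LowDimStructure C)
    (SN : LowDimStructure CN) (hm : m ≠ 0)
    (hn : n ≠ 0) (hφ : ContMDiff (𝓡 n) (𝓡 m) ∞ φ)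
    (hinj : ∀ y, Function.Injective (mfderiv (𝓡 n) (𝓡 m) φ y)) (D : WeylStructure C)
    (g : C.metrics) (gN : CN.metrics)
    (hpull : ∀ x u v, (gN : Metric n N).inner x u v = pullbackForm (g : Metric m M) φ x u v)
    (x : N) (u v : EuclideanSpace ℝ (Fin n)) :
    relSchouten SM SN φ D g gN x u v = relSchouten SM SN φ D g gN x v u := by
  have h := D.isWeyl
  have hF := contDiffAt_mapInCharts (x₀ := x) (y := x) hφ (mem_chart_source _ x)
    (mem_chart_source _ (φ x))
  have hW := mapInCharts_isLocalWeyl (n := n) (φ := φ) h hm g.2 x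
  have h1 := schouten_skew SM h hm g (φ x)
    (fderiv ℝ (mapInCharts (m := m) φ x) (extChartAt (𝓡 n) x x) u)
    (fderiv ℝ (mapInCharts (m := m) φ x) (extChartAt (𝓡 n) x x) v)
  have h2 := schouten_skew SN (h.inducedConn hm g.2 hφ hinj gN.2 hpull) hn gN x u v
  rw [(h.localLee_inducedConn hm hn g.2 hφ hinj gN.2 hpull x).fderiv_eq,
    fderiv_pullOneForm hF hW.contDiffAt_lee, fderiv_pullOneForm hF hW.contDiffAt_lee,
    (hF.of_le two_le_infty).isSymmSndFDerivAt (by simp) u v, mapInCharts_self] at h2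
  rw [relSchouten_eq SM SN hφ hinj D (h.hasChristoffel (φ x)),
    relSchouten_eq SM SN hφ hinj D (h.hasChristoffel (φ x)),
    hW.localExtrinsic_symm (EuclideanSpace.basisFun (Fin n) ℝ).toBasis hF u v]
  linear_combination h1 - h2

theorem isBilin_relSchouten [T2Space M] [T2Space N] (SM : LowDimStructure C)
    (SN : LowDimStructure CN) (hm : m ≠ 0)
    (hn : n ≠ 0) (hφ : ContMDiff (𝓡 n) (𝓡 m) ∞ φ)
    (hinj : ∀ y, Function.Injective (mfderiv (𝓡 n) (𝓡 m) φ y)) (D : WeylStructure C)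
    (g : C.metrics) (gN : CN.metrics)
    (hpull : ∀ x u v, (gN : Metric n N).inner x u v = pullbackForm (g : Metric m M) φ x u v)
    (x : N) : IsBilin (V := EuclideanSpace ℝ (Fin n)) (relSchouten SM SN φ D g gN x) := by
  have h := D.isWeyl
  have h1 := (((isBilin_schouten SM h hm g (φ x)).comp
    (fderiv ℝ (mapInCharts (m := m) φ x) (extChartAt (𝓡 n) x x) :
      EuclideanSpace ℝ (Fin n) →ₗ[ℝ] EuclideanSpace ℝ (Fin m))).sub
    (isBilin_schouten SN (h.inducedConn hm g.2 hφ hinj gN.2 hpull) hn gN x)).add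
    (isBilin_localExtrinsic (EuclideanSpace.basisFun (Fin n) ℝ).toBasis (mapInCharts φ x)
      (localMetric (φ x) (g : Metric m M)) (christoffel D.conn.toFun (φ x)) (extChartAt (𝓡 n) x x))
  obtain ⟨L, hL⟩ := h1
  exact ⟨L, fun u v => (hL u v).trans
    (relSchouten_eq SM SN hφ hinj D (h.hasChristoffel (φ x)) g gN u v).symm⟩

theorem fundForm_rescale {f : M → ℝ} (hf : IsRescaling g g' f)
    (hinj : ∀ y, Function.Injective (mfderiv (𝓡 n) (𝓡 m) φ y)) (x : N) :
    fundForm (n := n) g' cov φ x = fundForm (n := n) g cov φ x := by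
  funext u v
  rw [fundForm, fundForm, norPart, norPart, tanPart_rescale hf (hinj x)]

/-- The mean curvature is a section of `ν ⊗ L⁻²`. -/
theorem meanCurv_rescale {f : M → ℝ} (hf : IsRescaling g g' f)
    (hinj : ∀ y, Function.Injective (mfderiv (𝓡 n) (𝓡 m) φ y)) (x : N) :
    meanCurv n g' cov φ x = (Real.exp (2 * f (φ x)))⁻¹ • meanCurv n g cov φ x := by
  have hp : pullbackForm (n := n) g' φ x =
      fun u v => Real.exp (2 * f (φ x)) * pullbackForm g φ x u v := by
    funext u v
    exact pullbackForm_rescale hf x u v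
  rw [meanCurv, meanCurv, fundForm_rescale hf hinj, hp, traceWith_mul_form _ (Real.exp_ne_zero _),
    smul_comm]

theorem fundForm₀_rescale {f : M → ℝ} (hf : IsRescaling g g' f)
    (hinj : ∀ y, Function.Injective (mfderiv (𝓡 n) (𝓡 m) φ y)) (x : N) :
    fundForm₀ (n := n) g' cov φ x = fundForm₀ (n := n) g cov φ x := by
  funext u v
  rw [fundForm₀, fundForm₀, fundForm_rescale hf hinj, meanCurv_rescale hf hinj,
    pullbackForm_rescale hf, smul_smul, mul_right_comm, mul_inv_cancel₀ (Real.exp_ne_zero _), one_mul]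

/-- The relative Schouten-Weyl tensor does not depend on the metrics used to write it. -/
theorem relSchouten_rescale [T2Space M] [T2Space N] (SM : LowDimStructure C)
    (SN : LowDimStructure CN) (hm : m ≠ 0)
    (hφ : ContMDiff (𝓡 n) (𝓡 m) ∞ φ)
    (hinj : ∀ y, Function.Injective (mfderiv (𝓡 n) (𝓡 m) φ y)) (D : WeylStructure C)
    (g g' : C.metrics) (gN gN' : CN.metrics)
    (hpull : ∀ x u v, (gN : Metric n N).inner x u v = pullbackForm (g : Metric m M) φ x u v)
    (x : N) (u v : TangentSpace (𝓡 n) x) :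
    relSchouten SM SN φ D g' gN' x u v = relSchouten SM SN φ D g gN x u v := by
  have h := D.isWeyl
  obtain ⟨f, hf⟩ := (C.mem_iff g g.2 g').1 g'.2
  have h1 := schouten_rescale SM h g g' (φ x) (mfderiv (𝓡 n) (𝓡 m) φ x u) (mfderiv (𝓡 n) (𝓡 m) φ x v)
  have h2 := schouten_rescale SN (h.inducedConn hm g.2 hφ hinj gN.2 hpull) gN gN' x u v
  have h3 := mul_inv_cancel₀ (Real.exp_ne_zero (2 * f (φ x)))
  simp only [relSchouten]
  rw [inducedConn_rescale g.2 g'.2 hinj, fundForm₀_rescale hf hinj, meanCurv_rescale hf hinj,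
    pullbackForm_rescale hf, h1, h2]
  simp only [hf.2, map_smul, _root_.smul_apply, smul_eq_mul]
  generalize Real.exp (2 * f (φ x)) = c at *
  have hinv : c⁻¹ * c = 1 := by rw [mul_comm, h3]
  simp only [← mul_assoc, hinv, one_mul]
  linear_combination (1 / 2 * (g : Metric m M).inner (φ x)
    (meanCurv n (g : Metric m M) D.conn.toFun φ x) (meanCurv n (g : Metric m M) D.conn.toFun φ x)
    * pullbackForm (g : Metric m M) φ x u v) * hinv

end Submanifold

end

end ConformalSubmanifold

theorem proposition4p10 {m n : ℕ} (hm : 2 ≤ m) (hn : 1 ≤ n)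
    {M : Type*} [TopologicalSpace M] [ChartedSpace (EuclideanSpace ℝ (Fin m)) M]
    [IsManifold (𝓡 m) ∞ M] [T2Space M] [SecondCountableTopology M]
    {N : Type*} [TopologicalSpace N] [ChartedSpace (EuclideanSpace ℝ (Fin n)) N]
    [IsManifold (𝓡 n) ∞ N] [T2Space N] [SecondCountableTopology N]
    (C : ConformalSubmanifold.ConformalStructure m M)
    (SM : ConformalSubmanifold.LowDimStructure C)
    (CN : ConformalSubmanifold.ConformalStructure n N)
    (SN : ConformalSubmanifold.LowDimStructure CN)
    (φ : N → M) (hφ : ConformalSubmanifold.IsConformalSubmanifold C CN φ) :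
    ∃ ρ : Π x : N, TangentSpace (𝓡 n) x →L[ℝ] TangentSpace (𝓡 n) x →L[ℝ] ℝ,
      (∀ x u v, ρ x u v = ρ x v u) ∧
      ∀ (D : ConformalSubmanifold.WeylStructure C) (g : C.metrics) (gN : CN.metrics)
        (x : N) (u v : TangentSpace (𝓡 n) x),
        ConformalSubmanifold.relSchouten SM SN φ D g gN x u v = ρ x u v := by
  open ConformalSubmanifold in
  have hm' : m ≠ 0 := by omega
  have hn' : n ≠ 0 := by omega
  -- without any Weyl structure there is no condition on `ρ` besides the symmetry
  by_cases hD : Nonempty (WeylStructure C)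
  swap
  · exact ⟨0, fun _ _ _ => rfl, fun D => (hD ⟨D⟩).elim⟩
  obtain ⟨D₀⟩ := hD
  have hφs : ContMDiff (𝓡 n) (𝓡 m) ∞ φ := hφ.embedding.contMDiff
  have hinj : ∀ y, Function.Injective (mfderiv (𝓡 n) (𝓡 m) φ y) := fun y =>
    mfderiv_injective_of_isImmersionAt (hφ.embedding.isImmersion.isImmersionAt y)
  obtain ⟨g₀, hg₀⟩ := C.nonempty
  obtain ⟨gN₀, hgN₀, hpull⟩ := hφ.conformal g₀ hg₀
  -- `ρ` is the tensor computed with `D₀`, `g₀` and the metric that `g₀` induces on `N`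
  choose L hL using isBilin_relSchouten SM SN hm' hn' hφs hinj D₀ ⟨g₀, hg₀⟩ ⟨gN₀, hgN₀⟩ hpull
  let ρ (x : N) : EuclideanSpace ℝ (Fin n) →L[ℝ] EuclideanSpace ℝ (Fin n) →L[ℝ] ℝ :=
    LinearMap.toContinuousLinearMap
      ((LinearMap.toContinuousLinearMap (𝕜 := ℝ) (E := EuclideanSpace ℝ (Fin n))
        (F' := ℝ)).toLinearMap.comp (L x))
  have hρ : ∀ x u v, ρ x u v = relSchouten SM SN φ D₀ ⟨g₀, hg₀⟩ ⟨gN₀, hgN₀⟩ x u v := hL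
  refine ⟨ρ, fun x u v => ?_, fun D g gN x u v => ?_⟩
  · exact (hρ x u v).trans ((relSchouten_symm SM SN hm' hn' hφs hinj D₀ ⟨g₀, hg₀⟩ ⟨gN₀, hgN₀⟩
      hpull x u v).trans (hρ x v u).symm)
  · exact (relSchouten_rescale SM SN hm' hφs hinj D ⟨g₀, hg₀⟩ g ⟨gN₀, hgN₀⟩ gN hpull x u v).trans
      ((relSchouten_weyl SM SN hm' hn' hφs hinj D₀ D ⟨g₀, hg₀⟩ ⟨gN₀, hgN₀⟩ hpull x u v).trans
        (hρ x u v).symm)
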